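/- **Setting.** Manifolds are real, finite-dimensional, Hausdorff, paracompact and $C^\infty$, without boundary. Let $\tau:E\to M$ be a smooth real vector bundle of finite rank with a Lie algebroid structure $([\![\cdot,\cdot]\!],\rho)$: a smooth bundle map $\rho:E\to TM$ and a real Lie bracket on the space $\Gamma(E)$ of smooth sections with $[\![X,fY]\!]=f[\![X,Y]\!]+\rho(X)(f)\,Y$ for $f\in C^\infty(M)$. For $\mu\in\Gamma(\wedge^kE^*)$ put $$d^E\mu(X_0,\dots,X_k)=\sum_i(-1)^i\rho(X_i)\big(\mu(X_0,\dots,\widehat{X_i},\dots,X_k)\big)+\sum_{i<j}(-1)^{i+j}\mu([\![X_i,X_j]\!],X_0,\dots,\widehat{X_i},\dots,\widehat{X_j},\dots,X_k).$$ A *symplectic section* of $E$ is an $\Omega\in\Gamma(\wedge^2E^*)$ that is nondegenerate on every fibre and satisfies $d^E\Omega=0$; a Lie algebroid is *symplectic* if it has one. **Prolongation.** $\mathcal L^\tau E$ is the vector bundle over $E$ with fibre $\{(b,v)\in E_{\tau(a)}\times T_aE:\rho(b)=T\tau(v)\}$ at $a\in E$. There is exactly one Lie algebroid structure on $\mathcal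 L^\tau E$ with anchor $(b,v)\mapsto v$ and bracket $$[\![(h_i(X_i\circ\tau),V),(s_j(Y_j\circ\tau),W)]\!]^\tau=\big(h_is_j([\![X_i,Y_j]\!]\circ\tau)+V(s_j)(Y_j\circ\tau)-W(h_i)(X_i\circ\tau),\,[V,W]\big)$$ (finite sums over repeated indices; $h_i,s_j\in C^\infty(E)$, $X_i,Y_j\in\Gamma(E)$, $V,W$ vector fields on $E$), and $\mathcal L^\tau E$ carries this structure. **Lifts.** For $f\in C^\infty(M)$ let $f^c(a)=\rho(a)(f)$ and $f^v=f\circ\tau$. Each $X\in\Gamma(E)$ has a unique vertical lift and a unique complete lift, the smooth sections $X^{\mathbf v}(a)=(0,X(\tau(a))^v_a)$ and $X^{\mathbf c}(a)=(X(\tau(a)),X^c(a))$ of $\mathcal L^\tau E$. Here $b^v_a\in T_aE$ is the velocity at $t=0$ of $t\mapsto a+tb$, and $X^c$ is the vector field on $E$ that is $\tau$-projectable on $\rho(X)$ and satisfies $X^c(\hat\alpha)=\widehat{\mathcal L^E_X\alpha}$ for all $\alpha\in\Gamma(E^*)$, where $\hat\alpha(b)=\alpha(b)$ and $\mathcal L^E_X=i_Xd^E+d^Ei_X$.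 A *complete lift* of $\alpha\in\Gamma(\wedge^kE^*)$ is a section $\alpha^{\mathbf c}$ of $\wedge^k(\mathcal L^\tau E)^*$ such that, for all $X_1,\dots,X_k\in\Gamma(E)$, $$\alpha^{\mathbf c}(X_1^{\mathbf c},\dots,X_k^{\mathbf c})=\alpha(X_1,\dots,X_k)^c,\qquad \alpha^{\mathbf c}(X_1^{\mathbf v},X_2^{\mathbf c},\dots,X_k^{\mathbf c})=\alpha(X_1,\dots,X_k)^v,$$ $$\alpha^{\mathbf c}(X_1^{\mathbf v},\dots,X_s^{\mathbf v},X_{s+1}^{\mathbf c},\dots,X_k^{\mathbf c})=0\quad(2\le s\le k).$$ **Theorem 6.4.** Every $\Omega\in\Gamma(\wedge^2E^*)$ has a unique complete lift $\Omega^{\mathbf c}\in\Gamma(\wedge^2(\mathcal L^\tau E)^*)$, and $d^{\mathcal L^\tau E}(\Omega^{\mathbf c})=(d^E\Omega)^{\mathbf c}$. If $\Omega$ is a symplectic section of $E$, then $\Omega^{\mathbf c}$ is a symplectic section of $\mathcal L^\tau E$. In particular, if $E$ is a symplectic Lie algebroid, so is $\mathcal L^\tau E$. -/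

import Mathlib

open Bundle Set
open scoped Manifold ContDiff Bundle

noncomputable section

section General

variable {B : Type*} [NormedAddCommGroup B] [NormedSpace ℝ B]
  {H : Type*} [TopologicalSpace H] (I : ModelWithCorners ℝ B H)
  {M : Type*} [TopologicalSpace M] [ChartedSpace H M] [IsManifold I ∞ M]
  (F : Type*) [NormedAddCommGroup F] [NormedSpace ℝ F]
  (E : M → Type*) [TopologicalSpace (TotalSpace F E)]
  [∀ x, AddCommGroup (E x)] [∀ x, Module ℝ (E x)] [∀ x, TopologicalSpace (E x)]
  [FiberBundle F E] [VectorBundle ℝ F E]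

/-- The derivative `v(f)` of a real function `f` on `M` along a tangent vector `v ∈ T_x M`. -/
def directionalDeriv (f : M → ℝ) (x : M) (v : TangentSpace I x) : ℝ :=
  mfderiv I 𝓘(ℝ, ℝ) f x v

/-- A Lie algebroid structure on a smooth real vector bundle `E → M`: a smooth bundle map
`ρ : E → TM` (the anchor) and a real Lie bracket on the space of smooth sections of `E`,
related by the Leibniz rule `⟦X, f Y⟧ = f ⟦X, Y⟧ + ρ(X)(f) Y`. -/
@[ext]
structure LieAlgebroid where
  /-- The anchor on fibres. -/
  anchor : ∀ x : M, E x →ₗ[ℝ] TangentSpace I x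
  /-- The bracket of sections. -/
  bracket : Cₛ^∞⟮I; F, E⟯ → Cₛ^∞⟮I; F, E⟯ → Cₛ^∞⟮I; F, E⟯
  contMDiff_anchor : ContMDiff (I.prod 𝓘(ℝ, F)) I.tangent ∞
    (fun p : TotalSpace F E => (⟨p.proj, anchor p.proj p.2⟩ : TangentBundle I M))
  bracket_add_right : ∀ X Y Z, bracket X (Y + Z) = bracket X Y + bracket X Z
  bracket_smul_right : ∀ (c : ℝ) X Y, bracket X (c • Y) = c • bracket X Y
  bracket_skew : ∀ X Y, bracket X Y = -bracket Y X
  jacobi : ∀ X Y Z,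
    bracket X (bracket Y Z) + bracket Y (bracket Z X) + bracket Z (bracket X Y) = 0
  leibniz : ∀ (X Y fY : Cₛ^∞⟮I; F, E⟯) (f : C^∞⟮I, M; ℝ⟯), (∀ x, fY x = f x • Y x) →
    ∀ x, bracket X fY x
      = f x • bracket X Y x + directionalDeriv I f x (anchor x (X x)) • Y x

/-- A smooth section of `⋀ᵏ E*`: a family of alternating `k`-linear forms on the fibres of `E`,
depending smoothly on the base point, that is, taking smooth values on smooth sections. -/
@[ext]
structure BundleForm (k : ℕ) where
  /-- The form on each fibre. -/
  toFun : ∀ x : M, E x [⋀^Fin k]→ₗ[ℝ] ℝ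
  contMDiff_eval : ∀ X : Fin k → Cₛ^∞⟮I; F, E⟯,
    ContMDiff I 𝓘(ℝ, ℝ) ∞ (fun x => toFun x (fun i => X i x))

end General

namespace BundleForm

variable {B : Type*} [NormedAddCommGroup B] [NormedSpace ℝ B]
  {H : Type*} [TopologicalSpace H] {I : ModelWithCorners ℝ B H}
  {M : Type*} [TopologicalSpace M] [ChartedSpace H M] [IsManifold I ∞ M]
  {F : Type*} [NormedAddCommGroup F] [NormedSpace ℝ F]
  {E : M → Type*} [TopologicalSpace (TotalSpace F E)]
  [∀ x, AddCommGroup (E x)] [∀ x, Module ℝ (E x)] [∀ x, TopologicalSpace (E x)]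
  [FiberBundle F E]

/-- The function `μ(X₁, …, X_k)` on `M`. -/
def eval {k : ℕ} (μ : BundleForm I F E k) (X : Fin k → Cₛ^∞⟮I; F, E⟯) (x : M) : ℝ :=
  μ.toFun x (fun i => X i x)

end BundleForm

namespace LieAlgebroid

variable {B : Type*} [NormedAddCommGroup B] [NormedSpace ℝ B]
  {H : Type*} [TopologicalSpace H] {I : ModelWithCorners ℝ B H}
  {M : Type*} [TopologicalSpace M] [ChartedSpace H M] [IsManifold I ∞ M]
  {F : Type*} [NormedAddCommGroup F] [NormedSpace ℝ F]
  {E : M → Type*} [TopologicalSpace (TotalSpace F E)]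
  [∀ x, AddCommGroup (E x)] [∀ x, Module ℝ (E x)] [∀ x, TopologicalSpace (E x)]
  [FiberBundle F E] [VectorBundle ℝ F E]

section Differential

variable (A : LieAlgebroid I F E)

/-- The derivative at `x` of a function `f` along the image of `b ∈ E_x` under the anchor:
`ρ(b)(f)`. -/
def anchorDeriv (f : M → ℝ) (x : M) (b : E x) : ℝ :=
  directionalDeriv I f x (A.anchor x b)

/-- The second sum of the differential,
`∑_{i < j} (-1)^(i+j) μ(⟦X_i, X_j⟧, X_0, …, X̂_i, …, X̂_j, …, X_k)`; it is empty for `k = 0`. Here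
`l ↦ j.succAbove (i.succAbove l)` enumerates the indices other than `i < j` in order. -/
def bracketSum : ∀ {k : ℕ}, BundleForm I F E k → (Fin (k + 1) → Cₛ^∞⟮I; F, E⟯) → M → ℝ
  | 0, _, _, _ => 0
  | k + 1, μ, X, x => ∑ j : Fin (k + 2), ∑ i : Fin (k + 1),
      if i.castSucc < j then
        (-1 : ℝ) ^ ((i : ℕ) + (j : ℕ)) * μ.eval
          (Fin.cons (A.bracket (X i.castSucc) (X j)) fun l => X (j.succAbove (i.succAbove l))) x
      else 0

/-- The differential `d^E μ` of a section `μ` of `⋀ᵏ E*`, given by its values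
`(d^E μ)(X_0, …, X_k)` on smooth sections of `E`. -/
def differential {k : ℕ} (μ : BundleForm I F E k) (X : Fin (k + 1) → Cₛ^∞⟮I; F, E⟯) (x : M) : ℝ :=
  ∑ i : Fin (k + 1), (-1 : ℝ) ^ (i : ℕ) *
      A.anchorDeriv (μ.eval fun l => X (i.succAbove l)) x (X i x)
    + A.bracketSum μ X x

/-- `Ω` is a symplectic section: it is nondegenerate on each fibre and `d^E Ω = 0`. -/
def IsSymplecticSection (Ω : BundleForm I F E 2) : Prop :=
  (∀ (x : M) (u : E x), (∀ v : E x, Ω.toFun x ![u, v] = 0) → u = 0) ∧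
    ∀ (X : Fin 3 → Cₛ^∞⟮I; F, E⟯) (x : M), A.differential Ω X x = 0

/-- The Lie derivative `𝓛_X α = i_X d^E α + d^E (i_X α)` of a section `α` of `E*`, evaluated on a
section `Y`. -/
def lieDerivOneForm (X : Cₛ^∞⟮I; F, E⟯) (α : BundleForm I F E 1) (Y : Cₛ^∞⟮I; F, E⟯) (x : M) : ℝ :=
  A.differential α ![X, Y] x + A.anchorDeriv (α.eval ![X]) x (Y x)

end Differential

/-! ### The prolongation over the bundle projection -/

section Prolongation

variable (A : LieAlgebroid I F E)

/-- The fibre at `a ∈ E` of the prolongation, as a subspace of `E_{τ(a)} × T_a E`: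
the pairs `(b, v)` with `ρ(b) = Tτ(v)`. -/
def prolongationSubmodule (a : TotalSpace F E) :
    Submodule ℝ (E a.proj × TangentSpace (I.prod 𝓘(ℝ, F)) a) :=
  LinearMap.eqLocus (A.anchor a.proj ∘ₗ LinearMap.fst ℝ _ _)
    ((mfderiv (I.prod 𝓘(ℝ, F)) I (π F E) a).toLinearMap ∘ₗ LinearMap.snd ℝ _ _)

/-- The fibres of the prolongation of `E` over the bundle projection `τ : E → M`. -/
def Prolongation (a : TotalSpace F E) : Type _ := A.prolongationSubmodule a

instance (a : TotalSpace F E) : AddCommGroup (A.Prolongation a) :=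
  inferInstanceAs (AddCommGroup (A.prolongationSubmodule a))

instance (a : TotalSpace F E) : Module ℝ (A.Prolongation a) :=
  inferInstanceAs (Module ℝ (A.prolongationSubmodule a))

instance (a : TotalSpace F E) : TopologicalSpace (A.Prolongation a) :=
  inferInstanceAs (TopologicalSpace (A.prolongationSubmodule a))

namespace Prolongation

variable {A}

/-- The first projection `(b, v) ↦ b`. -/
def pr₁ {a : TotalSpace F E} (z : A.Prolongation a) : E a.proj := z.1.1

/-- The second projection `(b, v) ↦ v`. -/
def pr₂ {a : TotalSpace F E} (z : A.Prolongation a) : TangentSpace (I.prod 𝓘(ℝ, F)) a := z.1.2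

theorem anchor_pr₁ {a : TotalSpace F E} (z : A.Prolongation a) :
    A.anchor a.proj z.pr₁ = mfderiv (I.prod 𝓘(ℝ, F)) I (π F E) a z.pr₂ := z.2

@[ext]
theorem ext {a : TotalSpace F E} {z w : A.Prolongation a} (h₁ : z.pr₁ = w.pr₁)
    (h₂ : z.pr₂ = w.pr₂) : z = w := Subtype.ext (Prod.ext h₁ h₂)

end Prolongation

end Prolongation

end LieAlgebroid

namespace LieAlgebroid

set_option linter.unusedSectionVars false

/-! ### The vector bundle structure of the prolongation

A local trivialization `e` of `E` over `U ⊆ M` induces the trivialization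
`(b, v) ↦ (e(b), T(pr_F ∘ e)(v))` of the prolongation over `τ⁻¹(U)`, with values in `F × F`. -/

section ProlongationBundle

variable {B : Type*} [NormedAddCommGroup B] [NormedSpace ℝ B]
  {H : Type*} [TopologicalSpace H] {I : ModelWithCorners ℝ B H}
  {M : Type*} [TopologicalSpace M] [ChartedSpace H M] [IsManifold I ∞ M]
  {F : Type*} [NormedAddCommGroup F] [NormedSpace ℝ F]
  {E : M → Type*} [TopologicalSpace (TotalSpace F E)]
  [∀ x, AddCommGroup (E x)] [∀ x, Module ℝ (E x)] [∀ x, TopologicalSpace (E x)]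
  [FiberBundle F E] [VectorBundle ℝ F E] [ContMDiffVectorBundle ∞ F E I]

variable (I) in
/-- The fibre component of a tangent vector of `E` in a trivialization. -/
def fibreComponent (e : Trivialization F (π F E)) (a : TotalSpace F E) :
    TangentSpace (I.prod 𝓘(ℝ, F)) a →L[ℝ] F :=
  mfderiv (I.prod 𝓘(ℝ, F)) 𝓘(ℝ, F) (fun q => (e q).2) a

variable (I) in
/-- The tangent vector of `E` at `a` with given components in a trivialization. -/
def tangentLift (e : Trivialization F (π F E)) (a : TotalSpace F E) :
    TangentSpace I a.proj × F →L[ℝ] TangentSpace (I.prod 𝓘(ℝ, F)) a :=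
  mfderiv (I.prod 𝓘(ℝ, F)) (I.prod 𝓘(ℝ, F)) e.toOpenPartialHomeomorph.symm (e a)

variable (e : Trivialization F (π F E)) [MemTrivializationAtlas e]

variable (I) in
theorem mdifferentiable_trivialization :
    e.toOpenPartialHomeomorph.MDifferentiable (I.prod 𝓘(ℝ, F)) (I.prod 𝓘(ℝ, F)) :=
  ⟨(e.contMDiffOn (IB := I) (n := ∞)).mdifferentiableOn (by simp),
    (e.contMDiffOn_symm (IB := I) (n := ∞)).mdifferentiableOn (by simp)⟩

theorem contMDiffOn_snd_trivialization :
    ContMDiffOn (I.prod 𝓘(ℝ, F)) 𝓘(ℝ, F) ∞ (fun q => (e q).2) e.source :=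
  contMDiff_snd.comp_contMDiffOn (e.contMDiffOn (IB := I) (n := ∞))

variable {e}

theorem mfderiv_trivialization_apply {a : TotalSpace F E} (ha : a ∈ e.source)
    (v : TangentSpace (I.prod 𝓘(ℝ, F)) a) :
    (mfderiv (I.prod 𝓘(ℝ, F)) (I.prod 𝓘(ℝ, F)) e.toOpenPartialHomeomorph a v :
      TangentSpace I a.proj × F) =
      (mfderiv (I.prod 𝓘(ℝ, F)) I (π F E) a v, fibreComponent I e a v) := by
  have h1 : MDifferentiableAt (I.prod 𝓘(ℝ, F)) I (π F E) a :=
    ((contMDiff_proj E (n := ∞)).mdifferentiable (by simp)) a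
  have h2 : MDifferentiableAt (I.prod 𝓘(ℝ, F)) 𝓘(ℝ, F) (fun q => (e q).2) a :=
    ((contMDiffOn_snd_trivialization e).contMDiffAt
      (e.open_source.mem_nhds ha)).mdifferentiableAt (by simp)
  have h3 : (e.toOpenPartialHomeomorph : TotalSpace F E → M × F)
      =ᶠ[nhds a] fun q => (π F E q, (e q).2) := by
    filter_upwards [e.open_source.mem_nhds ha] with q hq
    exact (e.mk_proj_snd hq).symm
  rw [h3.mfderiv_eq, mfderiv_prodMk h1 h2]
  rfl

theorem tangentLift_components {a : TotalSpace F E} (ha : a ∈ e.source)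
    (v : TangentSpace (I.prod 𝓘(ℝ, F)) a) :
    tangentLift I e a (mfderiv (I.prod 𝓘(ℝ, F)) I (π F E) a v, fibreComponent I e a v) = v := by
  refine (congrArg (tangentLift I e a) (mfderiv_trivialization_apply ha v)).symm.trans ?_
  exact congrArg (fun L => L v) ((mdifferentiable_trivialization I e).symm_comp_deriv ha)

theorem components_tangentLift {a : TotalSpace F E} (ha : a ∈ e.source) (z : TangentSpace I a.proj × F) :
    (mfderiv (I.prod 𝓘(ℝ, F)) I (π F E) a (tangentLift I e a z),
      fibreComponent I e a (tangentLift I e a z)) = z := by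
  refine (mfderiv_trivialization_apply ha _).symm.trans ?_
  have h := (mdifferentiable_trivialization I e).comp_symm_deriv
    (e.toOpenPartialHomeomorph.map_source ha)
  rw [e.toOpenPartialHomeomorph.left_inv ha] at h
  exact congrArg (fun L => L z) h

variable (A : LieAlgebroid I F E)

variable (e) in
/-- The inverse of the trivialization of the prolongation induced by `e`. -/
def prolongationLift (a : TotalSpace F E) (ha : a ∈ e.source) (z : F × F) : A.Prolongation a :=
  ⟨(e.symm a.proj z.1, tangentLift I e a (A.anchor a.proj (e.symm a.proj z.1), z.2)),
    (congrArg Prod.fst (components_tangentLift ha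
      (A.anchor a.proj (e.symm a.proj z.1), z.2))).symm⟩

open Classical in
variable (e) in
/-- The local trivialization of the prolongation induced by a local trivialization of `E`. -/
def prolongationPretrivialization :
    Pretrivialization (F × F) (π (F × F) A.Prolongation) where
  toFun p := (p.proj, ((e ⟨p.proj.proj, p.2.pr₁⟩).2, fibreComponent I e p.proj p.2.pr₂))
  invFun q := ⟨q.1, if h : q.1 ∈ e.source then A.prolongationLift e q.1 h q.2 else 0⟩
  source := π (F × F) A.Prolongation ⁻¹' e.source
  target := e.source ×ˢ univ
  map_source' _ h := ⟨h, mem_univ _⟩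
  map_target' _ h := h.1
  left_inv' := by
    rintro ⟨a, z⟩ h
    replace h : a ∈ e.source := h
    have h' : a.proj ∈ e.baseSet := e.mem_source.1 h
    simp only [dif_pos h]
    refine congrArg (TotalSpace.mk a) ?_
    have h1 : e.symm a.proj (e ⟨a.proj, z.pr₁⟩).2 = z.pr₁ := e.symm_apply_apply_mk h' z.pr₁
    refine Prolongation.ext h1 ?_
    refine Eq.trans ?_ (tangentLift_components h z.pr₂)
    refine congrArg (fun w => tangentLift I e a (w, _)) ?_
    exact (congrArg (A.anchor a.proj) h1).trans z.anchor_pr₁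
  right_inv' := by
    rintro ⟨a, z⟩ ⟨h, -⟩
    replace h : a ∈ e.source := h
    have h' : a.proj ∈ e.baseSet := e.mem_source.1 h
    simp only [dif_pos h]
    refine Prod.ext rfl (Prod.ext ?_ ?_)
    · exact congrArg Prod.snd (e.apply_mk_symm h' z.1)
    · exact congrArg (Prod.snd : TangentSpace I a.proj × F → F) (components_tangentLift h
        (A.anchor a.proj (e.symm a.proj z.1), z.2))
  open_target := e.open_source.prod isOpen_univ
  baseSet := e.source
  open_baseSet := e.open_source
  source_eq := rfl
  target_eq := rfl
  proj_toFun _ _ := rfl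

instance prolongationPretrivialization_isLinear :
    (A.prolongationPretrivialization e).IsLinear ℝ where
  linear a ha :=
    have h' : a.proj ∈ e.baseSet := e.mem_source.1 ha
    { map_add z w := Prod.ext ((e.linear ℝ h').map_add z.pr₁ w.pr₁)
        ((fibreComponent I e a).map_add z.pr₂ w.pr₂)
      map_smul c z := Prod.ext ((e.linear ℝ h').map_smul c z.pr₁)
        ((fibreComponent I e a).map_smul c z.pr₂) }

theorem prolongationPretrivialization_symm_apply {a : TotalSpace F E} (ha : a ∈ e.source)
    (z : F × F) :
    (A.prolongationPretrivialization e).symm a z = A.prolongationLift e a ha z := by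
  have h := (A.prolongationPretrivialization e).mk_symm (show a ∈ _ from ha) z
  have h2 : (A.prolongationPretrivialization e).toPartialEquiv.symm (a, z)
      = ⟨a, A.prolongationLift e a ha z⟩ :=
    congrArg (TotalSpace.mk a) (dif_pos ha)
  rw [h2] at h
  exact eq_of_heq (TotalSpace.mk.inj h).2

variable [FiniteDimensional ℝ F]

/-- Transition functions of the prolongation. -/
def prolongationCoordChange (e e' : Trivialization F (π F E)) [MemTrivializationAtlas e]
    [MemTrivializationAtlas e'] (a : TotalSpace F E) : F × F →L[ℝ] F × F :=
  LinearMap.toContinuousLinearMap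
    ((A.prolongationPretrivialization e').linearMapAt ℝ a ∘ₗ
      (A.prolongationPretrivialization e).symmₗ ℝ a)

theorem prolongationCoordChange_apply (e e' : Trivialization F (π F E)) [MemTrivializationAtlas e]
    [MemTrivializationAtlas e'] {a : TotalSpace F E} (ha : a ∈ e.source ∩ e'.source) (z : F × F) :
    A.prolongationCoordChange e e' a z = (A.prolongationPretrivialization e'
      ⟨a, (A.prolongationPretrivialization e).symm a z⟩).2 := by
  simp only [prolongationCoordChange, LinearMap.coe_toContinuousLinearMap', LinearMap.comp_apply]
  rw [Pretrivialization.coe_linearMapAt_of_mem _ (show a ∈ _ from ha.2)]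
  exact congrArg (fun y => (A.prolongationPretrivialization e' ⟨a, y⟩).2)
    (Pretrivialization.symmₗ_apply (R := ℝ) _ (show a ∈ _ from ha.1) z)

theorem contMDiffOn_clm_of_apply {J H' N G : Type*} [NormedAddCommGroup J] [NormedSpace ℝ J]
    [TopologicalSpace H'] {K : ModelWithCorners ℝ J H'} [TopologicalSpace N] [ChartedSpace H' N]
    [NormedAddCommGroup G] [NormedSpace ℝ G] [FiniteDimensional ℝ G] {f : N → G →L[ℝ] G}
    {s : Set N} (h : ∀ v, ContMDiffOn K 𝓘(ℝ, G) ∞ (fun x => f x v) s) :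
    ContMDiffOn K 𝓘(ℝ, G →L[ℝ] G) ∞ f s := by
  let e₁ : G ≃L[ℝ] (Fin (Module.finrank ℝ G) → ℝ) :=
    ContinuousLinearEquiv.ofFinrankEq (Module.finrank_fin_fun ℝ).symm
  let e₂ := (e₁.arrowCongr (1 : G ≃L[ℝ] G)).trans (ContinuousLinearEquiv.piRing (Fin _))
  have h1 : f = fun x => e₂.symm (e₂ (f x)) := by simp
  rw [h1]
  exact e₂.symm.contDiff.contMDiff.comp_contMDiffOn (contMDiffOn_pi_space.2 fun i => h _)

theorem contMDiffOn_prolongationCoordChange (e e' : Trivialization F (π F E))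
    [MemTrivializationAtlas e] [MemTrivializationAtlas e'] :
    ContMDiffOn (I.prod 𝓘(ℝ, F)) 𝓘(ℝ, F × F →L[ℝ] F × F) ∞ (A.prolongationCoordChange e e')
      (e.source ∩ e'.source) := by
  refine contMDiffOn_clm_of_apply fun z => ?_
  -- the section of `E` with constant components
  have hs : ContMDiffOn (I.prod 𝓘(ℝ, F)) (I.prod 𝓘(ℝ, F)) ∞
      (fun a : TotalSpace F E => (⟨a.proj, e.symm a.proj z.1⟩ : TotalSpace F E))
      (e.source ∩ e'.source) := by
    have : ContMDiffOn (I.prod 𝓘(ℝ, F)) (I.prod 𝓘(ℝ, F)) ∞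
        (fun a : TotalSpace F E => ((a.proj, z.1) : M × F)) (e.source ∩ e'.source) :=
      (contMDiffOn_proj E).prodMk contMDiffOn_const
    refine ((e.contMDiffOn_symm (IB := I) (n := ∞)).comp this ?_).congr ?_
    · intro a ha
      exact e.mem_target.2 (e.mem_source.1 ha.1)
    · intro a ha
      exact e.mk_symm (e.mem_source.1 ha.1) z.1
  have h1 : ContMDiffOn (I.prod 𝓘(ℝ, F)) 𝓘(ℝ, F) ∞
      (fun a : TotalSpace F E => (e' ⟨a.proj, e.symm a.proj z.1⟩).2) (e.source ∩ e'.source) :=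
    (contMDiffOn_snd_trivialization e').comp hs
      fun a ha => (e'.mem_source (x := ⟨a.proj, _⟩)).2 ((e'.mem_source (x := a)).1 ha.2)
  -- the fibre coordinates of `e'` read in `e`
  let s : Set (M × F) := e.target ∩ e.toOpenPartialHomeomorph.symm ⁻¹' e'.source
  have hso : IsOpen s :=
    e.toOpenPartialHomeomorph.isOpen_inter_preimage_symm e'.open_source
  have hg : ContMDiffOn (I.prod 𝓘(ℝ, F)) 𝓘(ℝ, F) ∞
      (fun q : M × F => (e' (e.toOpenPartialHomeomorph.symm q)).2) s :=
    (contMDiffOn_snd_trivialization e').comp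
      ((e.contMDiffOn_symm (IB := I) (n := ∞)).mono inter_subset_left) fun q hq => hq.2
  have hV : ContMDiffOn (I.prod 𝓘(ℝ, F)) (I.prod 𝓘(ℝ, F)).tangent ∞
      (fun a : TotalSpace F E => (⟨(a.proj, (e a).2),
        (A.anchor a.proj (e.symm a.proj z.1), z.2)⟩ : TangentBundle (I.prod 𝓘(ℝ, F)) (M × F)))
      (e.source ∩ e'.source) := by
    have hw : ContMDiff 𝓘(ℝ, F) 𝓘(ℝ, F).tangent ∞
        (fun c : F => (⟨c, z.2⟩ : TangentBundle 𝓘(ℝ, F) F)) :=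
      contMDiff_vectorSpace_iff_contDiff.2 contDiff_const
    exact (contMDiff_equivTangentBundleProd_symm (n := ∞)).comp_contMDiffOn
      ((A.contMDiff_anchor.comp_contMDiffOn hs).prodMk
        (hw.comp_contMDiffOn ((contMDiffOn_snd_trivialization e).mono inter_subset_left)))
  have hT := (hg.contMDiffOn_tangentMapWithin (m := ∞) (by simp) hso.uniqueMDiffOn).comp hV
    (fun a ha => by
      change (a.proj, (e a).2) ∈ s
      rw [e.mk_proj_snd ha.1]
      refine ⟨e.map_source ha.1, ?_⟩
      change e.toOpenPartialHomeomorph.symm (e a) ∈ e'.source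
      rw [show e.toOpenPartialHomeomorph.symm (e a) = a from
        e.toOpenPartialHomeomorph.left_inv ha.1]
      exact ha.2)
  have h2 := (contMDiff_snd_tangentBundle_modelSpace F 𝓘(ℝ, F) (n := ∞)).comp_contMDiffOn hT
  refine (h1.prodMk_space h2).congr fun a ha => ?_
  rw [A.prolongationCoordChange_apply e e' ha, A.prolongationPretrivialization_symm_apply ha.1]
  refine Prod.ext rfl ?_
  set ζ : TangentSpace I a.proj × F := (A.anchor a.proj (e.symm a.proj z.1), z.2) with hζ
  change fibreComponent I e' a (tangentLift I e a ζ) = mfderivWithin (I.prod 𝓘(ℝ, F)) 𝓘(ℝ, F)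
    (fun q : M × F => (e' (e.toOpenPartialHomeomorph.symm q)).2) s (a.proj, (e a).2) ζ
  have hl : e.toOpenPartialHomeomorph.symm (e a) = a := e.toOpenPartialHomeomorph.left_inv ha.1
  have hmem : e a ∈ s :=
    ⟨e.map_source ha.1, by change e.toOpenPartialHomeomorph.symm (e a) ∈ e'.source; rw [hl]; exact ha.2⟩
  rw [e.mk_proj_snd ha.1, mfderivWithin_of_isOpen hso hmem]
  have hd1 : MDifferentiableAt (I.prod 𝓘(ℝ, F)) (I.prod 𝓘(ℝ, F))
      e.toOpenPartialHomeomorph.symm (e a) :=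
    (mdifferentiable_trivialization I e).mdifferentiableAt_symm (e.map_source ha.1)
  have hd2 : MDifferentiableAt (I.prod 𝓘(ℝ, F)) 𝓘(ℝ, F) (fun q => (e' q).2)
      (e.toOpenPartialHomeomorph.symm (e a)) := by
    rw [hl]
    exact ((contMDiffOn_snd_trivialization e').contMDiffAt
      (e'.open_source.mem_nhds ha.2)).mdifferentiableAt (by simp)
  have hc := mfderiv_comp (e a) hd2 hd1
  refine Eq.trans ?_ (congrArg (fun L => L ζ) hc.symm)
  change _ = mfderiv (I.prod 𝓘(ℝ, F)) 𝓘(ℝ, F) (fun q => (e' q).2)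
    (e.toOpenPartialHomeomorph.symm (e a)) (tangentLift I e a ζ)
  rw [hl]
  rfl

open Classical in
/-- The vector prebundle defining the prolongation. -/
def prolongationPrebundle : VectorPrebundle ℝ (F × F) A.Prolongation where
  pretrivializationAtlas := {f | ∃ (e : Trivialization F (π F E)) (_ : MemTrivializationAtlas e),
    f = A.prolongationPretrivialization e}
  pretrivialization_linear' := by
    rintro _ ⟨e, he, rfl⟩
    infer_instance
  pretrivializationAt a := A.prolongationPretrivialization (trivializationAt F E a.proj)
  mem_base_pretrivializationAt a := FiberBundle.mem_trivializationAt_proj_source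
  pretrivialization_mem_atlas a := ⟨trivializationAt F E a.proj, inferInstance, rfl⟩
  exists_coordChange := by
    rintro _ ⟨e, he, rfl⟩ _ ⟨e', he', rfl⟩
    exact ⟨A.prolongationCoordChange e e',
      (A.contMDiffOn_prolongationCoordChange e e').continuousOn,
      fun a ha z => A.prolongationCoordChange_apply e e' ha z⟩
  totalSpaceMk_isInducing := by
    intro a
    set e := trivializationAt F E a.proj
    have ha : a ∈ e.source := FiberBundle.mem_trivializationAt_proj_source
    have hb : a.proj ∈ e.baseSet := e.mem_source.1 ha
    have hc1 : Continuous fun u : E a.proj => (e ⟨a.proj, u⟩).2 :=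
      (e.continuousLinearEquivAt ℝ a.proj hb).continuous.congr fun u => by simp
    have hc2 : Continuous fun u : F => e.symm a.proj u :=
      (e.symmL ℝ a.proj).continuous.congr fun u => by simp [hb]
    have hc3 : Continuous fun u : F => A.anchor a.proj (e.symm a.proj u) := by
      have := (A.anchor a.proj ∘ₗ (e.symmL ℝ a.proj).toLinearMap).continuous_of_finiteDimensional
      exact this.congr fun u => by simp [hb]
    have hl : Function.LeftInverse (fun q : TotalSpace F E × (F × F) =>
        A.prolongationLift e a ha q.2)
        (A.prolongationPretrivialization e ∘ TotalSpace.mk a) := by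
      intro z
      have := (A.prolongationPretrivialization e).symm_apply_apply_mk (show a ∈ _ from ha) z
      rwa [A.prolongationPretrivialization_symm_apply ha] at this
    refine (hl.isEmbedding ?_ ?_).isInducing
    · refine Continuous.subtype_mk (Continuous.prodMk ?_ ?_) _
      · exact hc2.comp (continuous_fst.comp continuous_snd)
      · exact (tangentLift I e a).continuous.comp
          ((hc3.comp (continuous_fst.comp continuous_snd)).prodMk
            (continuous_snd.comp continuous_snd))
    · refine continuous_const.prodMk (Continuous.prodMk ?_ ?_)
      · exact hc1.comp (continuous_fst.comp continuous_subtype_val)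
      · exact (fibreComponent I e a).continuous.comp
          (continuous_snd.comp continuous_subtype_val)

instance prolongationTopology : TopologicalSpace (TotalSpace (F × F) A.Prolongation) :=
  A.prolongationPrebundle.totalSpaceTopology

instance prolongationFiberBundle : FiberBundle (F × F) A.Prolongation :=
  A.prolongationPrebundle.toFiberBundle

instance prolongationVectorBundle : VectorBundle ℝ (F × F) A.Prolongation :=
  A.prolongationPrebundle.toVectorBundle

instance prolongationPrebundle_isContMDiff :
    A.prolongationPrebundle.IsContMDiff (I.prod 𝓘(ℝ, F)) ∞ where
  exists_contMDiffCoordChange := by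
    rintro _ ⟨e, he, rfl⟩ _ ⟨e', he', rfl⟩
    exact ⟨A.prolongationCoordChange e e', A.contMDiffOn_prolongationCoordChange e e',
      fun a ha z => A.prolongationCoordChange_apply e e' ha z⟩

instance prolongationContMDiffVectorBundle :
    ContMDiffVectorBundle ∞ (F × F) A.Prolongation (I.prod 𝓘(ℝ, F)) :=
  A.prolongationPrebundle.contMDiffVectorBundle (I.prod 𝓘(ℝ, F))

end ProlongationBundle

end LieAlgebroid

namespace LieAlgebroid

/-! ### The Lie algebroid structure of the prolongation, and lifts -/

section Lifts

variable {B : Type*} [NormedAddCommGroup B] [NormedSpace ℝ B]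
  {H : Type*} [TopologicalSpace H] {I : ModelWithCorners ℝ B H}
  {M : Type*} [TopologicalSpace M] [ChartedSpace H M] [IsManifold I ∞ M]
  {F : Type*} [NormedAddCommGroup F] [NormedSpace ℝ F] [FiniteDimensional ℝ F]
  {E : M → Type*} [TopologicalSpace (TotalSpace F E)]
  [∀ x, AddCommGroup (E x)] [∀ x, Module ℝ (E x)] [∀ x, TopologicalSpace (E x)]
  [FiberBundle F E] [VectorBundle ℝ F E] [ContMDiffVectorBundle ∞ F E I]
  (A : LieAlgebroid I F E)

/-- Smooth sections of the prolongation of `E` over `τ : E → M`. -/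
abbrev ProlongationSection : Type _ := Cₛ^∞⟮I.prod 𝓘(ℝ, F); F × F, A.Prolongation⟯

/-- `L` is the Lie algebroid structure of the prolongation of `A` over `τ`: its anchor is
`(b, v) ↦ v`, and
`⟦(∑ hᵢ (Xᵢ ∘ τ), V), (∑ sⱼ (Yⱼ ∘ τ), W)⟧ =
  (∑ hᵢ sⱼ (⟦Xᵢ, Yⱼ⟧ ∘ τ) + ∑ V(sⱼ) (Yⱼ ∘ τ) - ∑ W(hᵢ) (Xᵢ ∘ τ), [V, W])`
for finite families of smooth functions `hᵢ, sⱼ` on `E` and sections `Xᵢ, Yⱼ` of `E`. -/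
structure IsProlongation
    (L : LieAlgebroid (I.prod 𝓘(ℝ, F)) (F × F) A.Prolongation) : Prop where
  anchor_eq : ∀ (a : TotalSpace F E) (z : A.Prolongation a), L.anchor a z = z.pr₂
  bracket_eq : ∀ (ξ η : A.ProlongationSection) (p q : ℕ)
    (h : Fin p → C^∞⟮I.prod 𝓘(ℝ, F), TotalSpace F E; ℝ⟯) (X : Fin p → Cₛ^∞⟮I; F, E⟯)
    (s : Fin q → C^∞⟮I.prod 𝓘(ℝ, F), TotalSpace F E; ℝ⟯) (Y : Fin q → Cₛ^∞⟮I; F, E⟯),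
    (∀ a, (ξ a).pr₁ = ∑ i, h i a • X i a.proj) →
    (∀ a, (η a).pr₁ = ∑ j, s j a • Y j a.proj) →
    ∀ a, (L.bracket ξ η a).pr₁ =
          ∑ i, ∑ j, (h i a * s j a) • A.bracket (X i) (Y j) a.proj
          + ∑ j, directionalDeriv (I.prod 𝓘(ℝ, F)) (s j) a (ξ a).pr₂ • Y j a.proj
          - ∑ i, directionalDeriv (I.prod 𝓘(ℝ, F)) (h i) a (η a).pr₂ • X i a.proj ∧
      (L.bracket ξ η a).pr₂ = VectorField.mlieBracket (I.prod 𝓘(ℝ, F))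
          (fun b => (ξ b).pr₂) (fun b => (η b).pr₂) a

variable (I) in
/-- The vertical tangent vector `bᵛₐ ∈ T_a E` corresponding to `b ∈ E_{τ(a)}`: the velocity at
`t = 0` of the curve `t ↦ a + t b`. -/
def verticalVector (a : TotalSpace F E) (b : E a.proj) : TangentSpace (I.prod 𝓘(ℝ, F)) a :=
  mfderiv 𝓘(ℝ, ℝ) (I.prod 𝓘(ℝ, F)) (fun t : ℝ => (⟨a.proj, a.2 + t • b⟩ : TotalSpace F E)) 0
    (1 : ℝ)

/-- `ξ` is the vertical lift of the section `X` to the prolongation: `ξ(a) = (0, X(τ(a))ᵛₐ)`. -/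
def IsVerticalLift (X : Cₛ^∞⟮I; F, E⟯) (ξ : A.ProlongationSection) : Prop :=
  ∀ a, (ξ a).pr₁ = 0 ∧ (ξ a).pr₂ = verticalVector I a (X a.proj)

/-- The linear function `α̂(b) = α(τ(b))(b)` on `E` defined by a section `α` of `E*`. -/
def linearFunction (α : BundleForm I F E 1) (b : TotalSpace F E) : ℝ :=
  α.toFun b.proj ![b.2]

/-- `V` is the complete lift of the section `X` to a vector field on `E`: it is `τ`-projectable on
`ρ(X)`, and `V(α̂)` is the linear function of `𝓛_X α` for each section `α` of `E*`. The latter is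
expressed at the points `Y(x)`, with `Y` a section; these are all the points of `E`. -/
def IsCompleteLiftField (X : Cₛ^∞⟮I; F, E⟯)
    (V : ∀ a : TotalSpace F E, TangentSpace (I.prod 𝓘(ℝ, F)) a) : Prop :=
  (∀ a, mfderiv (I.prod 𝓘(ℝ, F)) I (π F E) a (V a) = A.anchor a.proj (X a.proj)) ∧
    ∀ (α : BundleForm I F E 1) (Y : Cₛ^∞⟮I; F, E⟯) (x : M),
      directionalDeriv (I.prod 𝓘(ℝ, F)) (linearFunction α) ⟨x, Y x⟩ (V ⟨x, Y x⟩)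
        = A.lieDerivOneForm X α Y x

/-- `ξ` is the complete lift of the section `X` to the prolongation: `ξ(a) = (X(τ(a)), Xᶜ(a))`. -/
def IsCompleteLift (X : Cₛ^∞⟮I; F, E⟯) (ξ : A.ProlongationSection) : Prop :=
  (∀ a, (ξ a).pr₁ = X a.proj) ∧ A.IsCompleteLiftField X (fun a => (ξ a).pr₂)

/-- `β` is the complete lift `αᶜ` of `α`. Sections of `⋀ᵏ E*` and of `⋀ᵏ` of the dual of the
prolongation are given here by their values on smooth sections. The value of `β` is
`α(X₁, …, X_k)ᶜ` on the complete lifts of `X₁, …, X_k`, it is `α(X₁, …, X_k)ᵛ` if the first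
section is lifted vertically instead, and it is zero if the first `s ≥ 2` sections are. Here
`fᶜ(a) = ρ(a)(f)` and `fᵛ(a) = f(τ(a))`. -/
def IsCompleteLiftForm {k : ℕ} (α : (Fin k → Cₛ^∞⟮I; F, E⟯) → M → ℝ)
    (β : (Fin k → A.ProlongationSection) → TotalSpace F E → ℝ) : Prop :=
  ∀ (X : Fin k → Cₛ^∞⟮I; F, E⟯) (Xv Xc : Fin k → A.ProlongationSection),
    (∀ i, A.IsVerticalLift (X i) (Xv i)) → (∀ i, A.IsCompleteLift (X i) (Xc i)) →
    ∀ a : TotalSpace F E,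
      β Xc a = A.anchorDeriv (α X) a.proj a.2 ∧
      (1 ≤ k → β (fun i => if (i : ℕ) < 1 then Xv i else Xc i) a = α X a.proj) ∧
      ∀ s : ℕ, 2 ≤ s → s ≤ k → β (fun i => if (i : ℕ) < s then Xv i else Xc i) a = 0

end Lifts

end LieAlgebroid

end

/-!
All the objects on the prolongation are described by forms and functions on `E`. An element
`z = (b, v)` of the prolongation at `a ∈ E` is determined by the numbers `α(b)` and `v(α̂)`, for
sections `α` of `E*` (`Prolongation.ext_forms`). Conversely, a functional `Λ` on `Γ(E*)` with
`Λ(f α) = f Λ(α) + u(f) α(a)` comes from a tangent vector of `E` at `a` over `u`, and from a vector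
of the fibre if `u = 0` (`IsFibreDerivation.exists_tangent`, `IsFibreDerivation.exists_vector`). The
complete lift of `X` comes in this way from `𝓛_X`, and the first component of the bracket of
sections `ξ = (b, V)` and `η = (c, W)` of the prolongation from
`α ↦ V(α(c)) - W(α(b)) - dα(b, c)`; its second component is `[V, W]`. Frames multiplied by bump
functions (`CutoffFrame`) make these constructions global and smooth without a partition of unity.

The sections `lift X Y = Xᶜ + Yᵛ` take all values at each point (`exists_lift_eq`), and
`⟦Xᶜ + Yᵛ, X'ᶜ + Y'ᵛ⟧ = ⟦X, X'⟧ᶜ + (⟦X, Y'⟧ - ⟦X', Y⟧)ᵛ` (`prolongationBracket_lift`). Tensorial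
identities therefore need to be checked on lifts only. This gives the Jacobi identity, the Jacobiator
being tensorial because the second projection is a homomorphism of brackets (`jacobiator_congr`).
The bracket is unique because the first component of a section of the prolongation is locally a
linear combination of sections of `E` (`IsProlongation.unique`).

The complete lift of `Ω` is determined by
`Ωᶜ(Xᶜ + Yᵛ, X'ᶜ + Y'ᵛ) = Ω(X, X')ᶜ + Ω(Y, X')ᵛ + Ω(X, Y')ᵛ`. It exists by the Leibniz rule for
complete lifts in a frame, `Ωᶜ = ∑ⱼ (Ω(·, eⱼ)ᶜ ⊗ (εʲ)ᵛ + Ω(·, eⱼ)ᵛ ⊗ (εʲ)ᶜ)`, where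
`αᶜ(b, v) = v(α̂) + dα(a, b)` at `a` (`completeLiftBilin_lift`). Since `Xᶜ + Yᵛ` maps `fᶜ` to
`(ρ(X)f)ᶜ + (ρ(Y)f)ᵛ` and `fᵛ` to `(ρ(X)f)ᵛ`, the formula for the bracket of lifts shows that
`d Ωᶜ` has on lifts the values of the complete lift of `dΩ` (`differential_completeLiftForm_lift`).
In particular `d Ωᶜ = 0` if `dΩ = 0`. If `Ω` is nondegenerate, then pairing with vertical lifts shows
that an element of the kernel of `Ωᶜ` is vertical, and pairing with complete lifts that it vanishes
(`completeLiftForm_nondegenerate`).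
-/

noncomputable section

set_option linter.unusedSectionVars false

/-! ### Directional derivatives -/

section DirectionalDerivative

open Filter Topology

variable {B : Type*} [NormedAddCommGroup B] [NormedSpace ℝ B]
  {H : Type*} [TopologicalSpace H] {I : ModelWithCorners ℝ B H}
  {M : Type*} [TopologicalSpace M] [ChartedSpace H M]

theorem directionalDeriv_add_vector (f : M → ℝ) (x : M) (v w : TangentSpace I x) :
    directionalDeriv I f x (v + w) = directionalDeriv I f x v + directionalDeriv I f x w :=
  (mfderiv I 𝓘(ℝ, ℝ) f x).map_add v w

theorem directionalDeriv_smul_vector (f : M → ℝ) (x : M) (c : ℝ) (v : TangentSpace I x) :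
    directionalDeriv I f x (c • v) = c * directionalDeriv I f x v :=
  (mfderiv I 𝓘(ℝ, ℝ) f x).map_smul c v

theorem directionalDeriv_zero_vector (f : M → ℝ) (x : M) :
    directionalDeriv I f x (0 : TangentSpace I x) = 0 :=
  (mfderiv I 𝓘(ℝ, ℝ) f x).map_zero

theorem directionalDeriv_sum_vector {ι : Type*} (s : Finset ι) (f : M → ℝ) (x : M)
    (v : ι → TangentSpace I x) :
    directionalDeriv I f x (∑ i ∈ s, v i) = ∑ i ∈ s, directionalDeriv I f x (v i) :=
  map_sum (mfderiv I 𝓘(ℝ, ℝ) f x) v s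

theorem directionalDeriv_congr {f g : M → ℝ} {x : M} (h : f =ᶠ[𝓝 x] g) (v : TangentSpace I x) :
    directionalDeriv I f x v = directionalDeriv I g x v :=
  congrArg (fun L : B →L[ℝ] ℝ => L v) h.mfderiv_eq

theorem directionalDeriv_const (c : ℝ) (x : M) (v : TangentSpace I x) :
    directionalDeriv I (fun _ => c) x v = 0 := by
  unfold directionalDeriv
  rw [mfderiv_const]
  rfl

theorem directionalDeriv_eventually_const {f : M → ℝ} {c : ℝ} {x : M} (h : ∀ᶠ y in 𝓝 x, f y = c)
    (v : TangentSpace I x) : directionalDeriv I f x v = 0 :=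
  (directionalDeriv_congr h v).trans (directionalDeriv_const c x v)

theorem directionalDeriv_add {f g : M → ℝ} (hf : ContMDiff I 𝓘(ℝ, ℝ) ∞ f)
    (hg : ContMDiff I 𝓘(ℝ, ℝ) ∞ g) (x : M) (v : TangentSpace I x) :
    directionalDeriv I (fun y => f y + g y) x v
      = directionalDeriv I f x v + directionalDeriv I g x v :=
  congrArg (fun L : B →L[ℝ] ℝ => L v)
    (mfderiv_add (hf.mdifferentiable (by simp) x) (hg.mdifferentiable (by simp) x))

theorem directionalDeriv_mul {f g : M → ℝ} (hf : ContMDiff I 𝓘(ℝ, ℝ) ∞ f)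
    (hg : ContMDiff I 𝓘(ℝ, ℝ) ∞ g) (x : M) (v : TangentSpace I x) :
    directionalDeriv I (fun y => f y * g y) x v
      = f x * directionalDeriv I g x v + directionalDeriv I f x v * g x := by
  have h := (hf.mdifferentiable (by simp) x).hasMFDerivAt.mul
    (hg.mdifferentiable (by simp) x).hasMFDerivAt
  have h2 := congrArg (fun L : B →L[ℝ] ℝ => L v) h.mfderiv
  refine h2.trans ?_
  change f x * directionalDeriv I g x v + g x * directionalDeriv I f x v = _
  ring

theorem directionalDeriv_neg (f : M → ℝ) (x : M) (v : TangentSpace I x) :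
    directionalDeriv I (fun y => - f y) x v = - directionalDeriv I f x v :=
  congrArg (fun L : B →L[ℝ] ℝ => L v) mfderiv_neg

theorem directionalDeriv_sub {f g : M → ℝ} (hf : ContMDiff I 𝓘(ℝ, ℝ) ∞ f)
    (hg : ContMDiff I 𝓘(ℝ, ℝ) ∞ g) (x : M) (v : TangentSpace I x) :
    directionalDeriv I (fun y => f y - g y) x v
      = directionalDeriv I f x v - directionalDeriv I g x v :=
  congrArg (fun L : B →L[ℝ] ℝ => L v)
    (mfderiv_sub (hf.mdifferentiable (by simp) x) (hg.mdifferentiable (by simp) x))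

theorem directionalDeriv_sum {ι : Type*} (s : Finset ι) {f : ι → M → ℝ}
    (hf : ∀ i, ContMDiff I 𝓘(ℝ, ℝ) ∞ (f i)) (x : M) (v : TangentSpace I x) :
    directionalDeriv I (fun y => ∑ i ∈ s, f i y) x v = ∑ i ∈ s, directionalDeriv I (f i) x v := by
  classical
  induction s using Finset.induction_on with
  | empty => simpa using directionalDeriv_const 0 x v
  | insert i s hi ih =>
    simp only [Finset.sum_insert hi]
    rw [directionalDeriv_add (hf i) (contMDiff_finsetSum fun j _ => hf j), ih]

/-- The Leibniz rule for a finite sum of products. -/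
theorem directionalDeriv_sum_mul {ι : Type*} (s : Finset ι) {f g : ι → M → ℝ}
    (hf : ∀ i, ContMDiff I 𝓘(ℝ, ℝ) ∞ (f i)) (hg : ∀ i, ContMDiff I 𝓘(ℝ, ℝ) ∞ (g i)) (x : M)
    (v : TangentSpace I x) :
    directionalDeriv I (fun y => ∑ i ∈ s, f i y * g i y) x v
      = ∑ i ∈ s, (f i x * directionalDeriv I (g i) x v + directionalDeriv I (f i) x v * g i x) := by
  rw [directionalDeriv_sum s (f := fun i y => f i y * g i y) (fun i => (hf i).mul (hg i))]
  exact Finset.sum_congr rfl fun i _ => directionalDeriv_mul (hf i) (hg i) x v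

theorem directionalDeriv_comp {B' : Type*} [NormedAddCommGroup B'] [NormedSpace ℝ B']
    {H' : Type*} [TopologicalSpace H'] {I' : ModelWithCorners ℝ B' H'}
    {N : Type*} [TopologicalSpace N] [ChartedSpace H' N] {f : M → ℝ} {φ : N → M} {y : N}
    (hf : MDifferentiableAt I 𝓘(ℝ, ℝ) f (φ y)) (hφ : MDifferentiableAt I' I φ y)
    (v : TangentSpace I' y) :
    directionalDeriv I' (fun z => f (φ z)) y v
      = directionalDeriv I f (φ y) (mfderiv I' I φ y v) :=
  congrArg (fun L : B' →L[ℝ] ℝ => L v) (mfderiv_comp y hf hφ)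

theorem contMDiff_directionalDeriv [IsManifold I ∞ M] {B' : Type*} [NormedAddCommGroup B']
    [NormedSpace ℝ B']
    {H' : Type*} [TopologicalSpace H'] {I' : ModelWithCorners ℝ B' H'}
    {N : Type*} [TopologicalSpace N] [ChartedSpace H' N] {f : M → ℝ}
    (hf : ContMDiff I 𝓘(ℝ, ℝ) ∞ f) {φ : N → TangentBundle I M} (hφ : ContMDiff I' I.tangent ∞ φ) :
    ContMDiff I' 𝓘(ℝ, ℝ) ∞ (fun y => directionalDeriv I f (φ y).1 (φ y).2) :=
  (contMDiff_snd_tangentBundle_modelSpace ℝ 𝓘(ℝ, ℝ) (n := ∞)).comp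
    ((hf.contMDiff_tangentMap (m := ∞) (by simp)).comp hφ)

end DirectionalDerivative

/-! ### Smooth sections, forms of degree at most two, and cut-off frames -/

section Sections

open Filter Topology

variable {B : Type*} [NormedAddCommGroup B] [NormedSpace ℝ B]
  {H : Type*} [TopologicalSpace H] {I : ModelWithCorners ℝ B H}
  {M : Type*} [TopologicalSpace M] [ChartedSpace H M]
  {F : Type*} [NormedAddCommGroup F] [NormedSpace ℝ F]
  {E : M → Type*} [TopologicalSpace (TotalSpace F E)]
  [∀ x, AddCommGroup (E x)] [∀ x, Module ℝ (E x)] [∀ x, TopologicalSpace (E x)]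
  [FiberBundle F E]

/-- The product of a smooth function and a smooth section. -/
def funSmul [VectorBundle ℝ F E] (f : C^∞⟮I, M; ℝ⟯) (X : Cₛ^∞⟮I; F, E⟯) : Cₛ^∞⟮I; F, E⟯ :=
  ⟨fun x => f x • X x, f.contMDiff.smul_section X.contMDiff⟩

@[simp]
theorem funSmul_apply [VectorBundle ℝ F E] (f : C^∞⟮I, M; ℝ⟯) (X : Cₛ^∞⟮I; F, E⟯) (x : M) :
    funSmul f X x = f x • X x := rfl

theorem update_vec_one {α : Type*} (a b : α) : Function.update ![a] 0 b = ![b] :=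
  funext fun i => by fin_cases i; rfl

theorem update_vec_two_zero {α : Type*} (a b c : α) : Function.update ![a, b] 0 c = ![c, b] :=
  funext fun i => by fin_cases i <;> rfl

theorem update_vec_two_one {α : Type*} (a b c : α) : Function.update ![a, b] 1 c = ![a, c] :=
  funext fun i => by fin_cases i <;> rfl

/-- A section of `⋀¹ E*` as a family of linear forms. -/
def BundleForm.toLin (α : BundleForm I F E 1) (x : M) : E x →ₗ[ℝ] ℝ where
  toFun b := α.toFun x ![b]
  map_add' b c := by
    simpa only [update_vec_one] using (α.toFun x).map_update_add ![b] 0 b c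
  map_smul' r b := by
    simpa only [update_vec_one, RingHom.id_apply] using (α.toFun x).map_update_smul ![b] 0 r b

theorem BundleForm.eval_one (α : BundleForm I F E 1) (X : Fin 1 → Cₛ^∞⟮I; F, E⟯) (x : M) :
    α.eval X x = α.toLin x (X 0 x) := by
  unfold BundleForm.eval
  exact congrArg (α.toFun x) (funext fun i => by fin_cases i; rfl)

theorem BundleForm.contMDiff_toLin (α : BundleForm I F E 1) (X : Cₛ^∞⟮I; F, E⟯) :
    ContMDiff I 𝓘(ℝ, ℝ) ∞ (fun x => α.toLin x (X x)) := by
  refine (α.contMDiff_eval ![X]).congr fun x => ?_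
  exact (α.eval_one ![X] x).symm

/-- The section of `⋀¹ E*` given by a family of linear forms. -/
def BundleForm.ofLin (l : ∀ x, E x →ₗ[ℝ] ℝ)
    (hl : ∀ X : Cₛ^∞⟮I; F, E⟯, ContMDiff I 𝓘(ℝ, ℝ) ∞ (fun x => l x (X x))) :
    BundleForm I F E 1 where
  toFun x := AlternatingMap.ofSubsingleton ℝ (E x) ℝ (0 : Fin 1) (l x)
  contMDiff_eval X := hl (X 0)

/-- A section of `⋀² E*` as a family of bilinear forms. -/
def BundleForm.toBilin (Ω : BundleForm I F E 2) (x : M) : E x →ₗ[ℝ] E x →ₗ[ℝ] ℝ :=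
  LinearMap.mk₂ ℝ (fun u v => Ω.toFun x ![u, v])
    (fun u u' v => by simpa only [update_vec_two_zero, update_vec_two_one] using
      (Ω.toFun x).map_update_add ![u, v] 0 u u')
    (fun r u v => by simpa only [update_vec_two_zero, update_vec_two_one] using
      (Ω.toFun x).map_update_smul ![u, v] 0 r u)
    (fun u v v' => by simpa only [update_vec_two_zero, update_vec_two_one] using
      (Ω.toFun x).map_update_add ![u, v] 1 v v')
    (fun r u v => by simpa only [update_vec_two_zero, update_vec_two_one] using
      (Ω.toFun x).map_update_smul ![u, v] 1 r v)

theorem BundleForm.toBilin_apply (Ω : BundleForm I F E 2) (x : M) (u v : E x) :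
    Ω.toBilin x u v = Ω.toFun x ![u, v] := rfl

theorem BundleForm.eval_two (Ω : BundleForm I F E 2) (X : Fin 2 → Cₛ^∞⟮I; F, E⟯) (x : M) :
    Ω.eval X x = Ω.toBilin x (X 0 x) (X 1 x) := by
  unfold BundleForm.eval
  exact congrArg (Ω.toFun x) (funext fun i => by fin_cases i <;> rfl)

theorem BundleForm.toBilin_self (Ω : BundleForm I F E 2) (x : M) (u : E x) :
    Ω.toBilin x u u = 0 :=
  (Ω.toFun x).map_eq_zero_of_eq ![u, u] (i := 0) (j := 1) rfl (by decide)

theorem BundleForm.toBilin_swap (Ω : BundleForm I F E 2) (x : M) (u v : E x) :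
    Ω.toBilin x u v = - Ω.toBilin x v u :=
  (LinearMap.IsAlt.neg (B := Ω.toBilin x) (Ω.toBilin_self x) v u).symm

theorem BundleForm.contMDiff_toBilin (Ω : BundleForm I F E 2) (X Y : Cₛ^∞⟮I; F, E⟯) :
    ContMDiff I 𝓘(ℝ, ℝ) ∞ (fun x => Ω.toBilin x (X x) (Y x)) := by
  refine (Ω.contMDiff_eval ![X, Y]).congr fun x => ?_
  exact (Ω.eval_two ![X, Y] x).symm

/-- The section of `⋀² E*` given by a family of alternating bilinear forms. -/
def BundleForm.ofBilin (b : ∀ x, E x →ₗ[ℝ] E x →ₗ[ℝ] ℝ) (hb : ∀ x u, b x u u = 0)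
    (hs : ∀ X Y : Cₛ^∞⟮I; F, E⟯, ContMDiff I 𝓘(ℝ, ℝ) ∞ (fun x => b x (X x) (Y x))) :
    BundleForm I F E 2 where
  toFun x :=
    { toFun := fun v => b x (v 0) (v 1)
      map_update_add' := by
        intro _ v i u w
        fin_cases i <;> simp
      map_update_smul' := by
        intro _ v i r w
        fin_cases i <;> simp
      map_eq_zero_of_eq' := by
        intro v i j h hij
        fin_cases i <;> fin_cases j <;> simp_all }
  contMDiff_eval X := hs (X 0) (X 1)

theorem BundleForm.ext_toBilin {Ω Ω' : BundleForm I F E 2}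
    (h : ∀ x u v, Ω.toBilin x u v = Ω'.toBilin x u v) : Ω = Ω' := by
  ext x v
  have hv : v = ![v 0, v 1] := funext fun i => by fin_cases i <;> rfl
  rw [hv]
  exact h x _ _

/-- The product of a smooth function and a section of `⋀¹ E*`. -/
def BundleForm.funMul (f : C^∞⟮I, M; ℝ⟯) (α : BundleForm I F E 1) : BundleForm I F E 1 :=
  BundleForm.ofLin (fun x => f x • α.toLin x) fun X => f.contMDiff.mul (α.contMDiff_toLin X)

@[simp]
theorem BundleForm.toLin_funMul (f : C^∞⟮I, M; ℝ⟯) (α : BundleForm I F E 1) (x : M) (b : E x) :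
    (BundleForm.funMul f α).toLin x b = f x * α.toLin x b := rfl

/-- Global data on `E` that restrict near `x₀` to a frame and its dual coframe: they are products of
a local frame and of the coordinates of a trivialization by a bump function. -/
structure CutoffFrame [VectorBundle ℝ F E] [FiniteDimensional ℝ F] (x₀ : M) where
  /-- The cut-off function. -/
  χ : C^∞⟮I, M; ℝ⟯
  /-- The sections forming a frame near `x₀`. -/
  e : Fin (Module.finrank ℝ F) → Cₛ^∞⟮I; F, E⟯
  /-- The forms giving the coordinates near `x₀`. -/
  ε : Fin (Module.finrank ℝ F) → BundleForm I F E 1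
  eventually_χ : ∀ᶠ x in 𝓝 x₀, χ x = 1
  sum_smul : ∀ x (b : E x), ∑ i, (ε i).toLin x b • e i x = χ x • b
  eventually_ε : ∀ᶠ x in 𝓝 x₀, ∀ (b : E x) i, (ε i).toLin x b
    = (Module.finBasis ℝ F).repr (trivializationAt F E x₀ ⟨x, b⟩).2 i

theorem CutoffFrame.χ_self [VectorBundle ℝ F E] [FiniteDimensional ℝ F] {x₀ : M}
    (fr : CutoffFrame (I := I) (F := F) (E := E) x₀) : fr.χ x₀ = 1 := fr.eventually_χ.self_of_nhds

variable [VectorBundle ℝ F E] [ContMDiffVectorBundle ∞ F E I] [IsManifold I ∞ M]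
  [T2Space M] [FiniteDimensional ℝ B] [FiniteDimensional ℝ F]

variable (I F E) in
theorem nonempty_cutoffFrame (x₀ : M) : Nonempty (CutoffFrame (I := I) (F := F) (E := E) x₀) := by
  classical
  -- frame and coframe are both multiplied by a bump function `ψ`, which makes `χ = ψ²`
  set e := trivializationAt F E x₀ with he
  have hx₀ : x₀ ∈ e.baseSet := FiberBundle.mem_baseSet_trivializationAt' x₀
  obtain ⟨ψ, -, hψ⟩ := ((SmoothBumpFunction.nhds_basis_tsupport (I := I) x₀).mem_iff).1
    (e.open_baseSet.mem_nhds hx₀)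
  let bs := Module.finBasis ℝ F
  have : ContMDiffVectorBundle 1 F E I := ContMDiffVectorBundle.of_le (n := ∞) (by simp)
  have hψs : ContMDiff I 𝓘(ℝ, ℝ) ∞ ψ := ψ.contMDiff
  have h0 : ∀ x, x ∉ e.baseSet → ψ x = 0 := fun x hx =>
    image_eq_zero_of_notMem_tsupport fun h => hx (hψ h)
  let s : Fin (Module.finrank ℝ F) → Cₛ^∞⟮I; F, E⟯ := fun i =>
    ⟨fun x => ψ x • e.localFrame bs i x,
      ContMDiffOn.smul_section_of_tsupport hψs.contMDiffOn e.open_baseSet hψ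
        (e.contMDiffOn_localFrame_baseSet ∞ bs i)⟩
  let ε : Fin (Module.finrank ℝ F) → BundleForm I F E 1 := fun i =>
    BundleForm.ofLin (fun x => ψ x • e.localFrameCoeff I bs i x) fun X => by
      intro x
      by_cases hx : x ∈ tsupport ψ
      · exact (hψs x).mul (contMDiffAt_localFrameCoeff (e := e) (I := I) bs (hψ hx)
          X.contMDiff.contMDiffAt i)
      · have : (fun x => (ψ x • e.localFrameCoeff I bs i x) (X x)) =ᶠ[𝓝 x] fun _ => (0 : ℝ) := by
          filter_upwards [(isClosed_tsupport ψ).isOpen_compl.mem_nhds hx] with y hy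
          simp [image_eq_zero_of_notMem_tsupport hy]
        exact contMDiffAt_const.congr_of_eventuallyEq this
  refine ⟨⟨⟨fun x => ψ x * ψ x, hψs.mul hψs⟩, s, ε, ?_, ?_, ?_⟩⟩
  · filter_upwards [ψ.eventuallyEq_one] with x hx
    change ψ x * ψ x = 1
    rw [hx]; simp
  · intro x b
    change ∑ i, (ψ x • e.localFrameCoeff I bs i x) b • ψ x • e.localFrame bs i x = (ψ x * ψ x) • b
    by_cases hx : x ∈ e.baseSet
    · have h1 := e.eq_sum_localFrameCoeff_smul (I := I) (b := bs)
        (s := Function.update (fun _ => 0) x b) hx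
      simp only [Function.update_self] at h1
      conv_rhs => rw [h1, Finset.smul_sum]
      refine Finset.sum_congr rfl fun i _ => ?_
      simp only [LinearMap.smul_apply, smul_smul, smul_eq_mul]
      ring_nf
    · simp [h0 x hx]
  · filter_upwards [ψ.eventuallyEq_one, e.open_baseSet.mem_nhds hx₀] with x hx hxb b i
    change (ψ x • e.localFrameCoeff I bs i x) b = _
    have h1 := e.localFrameCoeff_eq_coeff (I := I) (b := bs) (i := i)
        (s := Function.update (fun _ => 0) x b) hxb
    simp only [Function.update_self] at h1
    rw [LinearMap.smul_apply, h1, hx]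
    simp [bs, he]

variable (I F E) in
/-- A choice of cut-off frame near `x₀`. -/
def cutoffFrame (x₀ : M) : CutoffFrame (I := I) (F := F) (E := E) x₀ :=
  (nonempty_cutoffFrame I F E x₀).some

end Sections

/-! ### Tensoriality -/

section Tensorial

open Filter Topology

variable {B : Type*} [NormedAddCommGroup B] [NormedSpace ℝ B]
  {H : Type*} [TopologicalSpace H] {I : ModelWithCorners ℝ B H}
  {M : Type*} [TopologicalSpace M] [ChartedSpace H M]
  {F : Type*} [NormedAddCommGroup F] [NormedSpace ℝ F]
  {E : M → Type*} [TopologicalSpace (TotalSpace F E)]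
  [∀ x, AddCommGroup (E x)] [∀ x, Module ℝ (E x)] [∀ x, TopologicalSpace (E x)]
  [FiberBundle F E] [VectorBundle ℝ F E] [ContMDiffVectorBundle ∞ F E I] [IsManifold I ∞ M]
  [T2Space M] [FiniteDimensional ℝ B] [FiniteDimensional ℝ F]

variable (I F E) in
/-- A linear choice of global smooth sections with given value at `x`. -/
def sectionThrough (x : M) : E x →ₗ[ℝ] Cₛ^∞⟮I; F, E⟯ where
  toFun b := ∑ i, ((cutoffFrame I F E x).ε i).toLin x b • (cutoffFrame I F E x).e i
  map_add' b c := by simp only [map_add, add_smul, Finset.sum_add_distrib]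
  map_smul' r b := by simp only [map_smul, smul_assoc, Finset.smul_sum, RingHom.id_apply]

theorem ContMDiffSection.sum_apply {ι : Type*} (s : Finset ι) (X : ι → Cₛ^∞⟮I; F, E⟯) (x : M) :
    (∑ i ∈ s, X i) x = ∑ i ∈ s, X i x :=
  (congrFun (map_sum (ContMDiffSection.coeAddHom I F ∞ E) X s) x).trans
    (Finset.sum_apply x s _)

@[simp]
theorem sectionThrough_self (x : M) (b : E x) : sectionThrough I F E x b x = b := by
  have h := (cutoffFrame I F E x).sum_smul x b
  rw [CutoffFrame.χ_self, one_smul] at h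
  refine Eq.trans ?_ h
  exact ContMDiffSection.sum_apply _ _ x

/-- An additive map on sections which is linear over the smooth functions, these acting by their
values at `x₀`, depends only on the value of the section at `x₀`. -/
theorem tensorial_congr {G : Type*} [AddCommGroup G] [Module ℝ G] {x₀ : M}
    {T : Cₛ^∞⟮I; F, E⟯ → G} (hadd : ∀ X Y, T (X + Y) = T X + T Y)
    (hsmul : ∀ (f : C^∞⟮I, M; ℝ⟯) X, T (funSmul f X) = f x₀ • T X)
    {X Y : Cₛ^∞⟮I; F, E⟯} (h : X x₀ = Y x₀) : T X = T Y := by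
  -- replace the section by its product with the cut-off function and expand in the frame
  let T' : Cₛ^∞⟮I; F, E⟯ →+ G := AddMonoidHom.mk' T hadd
  let fr := cutoffFrame I F E x₀
  have key : ∀ Z : Cₛ^∞⟮I; F, E⟯, T Z = ∑ i, (fr.ε i).toLin x₀ (Z x₀) • T (fr.e i) := by
    intro Z
    have h1 : funSmul fr.χ Z = ∑ i, funSmul ⟨_, (fr.ε i).contMDiff_toLin Z⟩ (fr.e i) := by
      ext x
      rw [ContMDiffSection.sum_apply]
      exact (fr.sum_smul x (Z x)).symm
    have h2 : T (funSmul fr.χ Z) = T Z := by rw [hsmul, fr.χ_self, one_smul]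
    rw [← h2, h1]
    refine (map_sum T' _ _).trans (Finset.sum_congr rfl fun i _ => ?_)
    exact hsmul _ _
  rw [key X, key Y, h]

/-- For a skew-symmetric bracket of sections satisfying the Leibniz rule with respect to `D`, the
failure of the Jacobiator to be linear over the functions is the failure of `D` to be a homomorphism
of brackets. -/
theorem jacobiator_funSmul (br : Cₛ^∞⟮I; F, E⟯ → Cₛ^∞⟮I; F, E⟯ → Cₛ^∞⟮I; F, E⟯)
    (D : Cₛ^∞⟮I; F, E⟯ → C^∞⟮I, M; ℝ⟯ → C^∞⟮I, M; ℝ⟯)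
    (hadd : ∀ X Y Z, br X (Y + Z) = br X Y + br X Z) (hskew : ∀ X Y, br X Y = -br Y X)
    (hleib : ∀ X f Y, br X (funSmul f Y) = funSmul f (br X Y) + funSmul (D X f) Y)
    (X Y Z : Cₛ^∞⟮I; F, E⟯) (f : C^∞⟮I, M; ℝ⟯) (x : M) :
    br X (br Y (funSmul f Z)) x + br Y (br (funSmul f Z) X) x + br (funSmul f Z) (br X Y) x
      = f x • (br X (br Y Z) x + br Y (br Z X) x + br Z (br X Y) x)
        + (D X (D Y f) x - D Y (D X f) x - D (br X Y) f x) • Z x := by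
  have hneg : ∀ X Y, br X (-Y) = - br X Y := fun X => map_neg (AddMonoidHom.mk' (br X) (hadd X))
  have h1 : ∀ X Y, br X Y x = - br Y X x := fun X Y => by rw [hskew X Y]; rfl
  have h2 : br (funSmul f Z) X = -(funSmul f (br X Z) + funSmul (D X f) Z) := by
    rw [hskew, hleib]
  have h3 : br Y (br Z X) x = - br Y (br X Z) x := by
    rw [hskew Z X, hneg]; rfl
  rw [hleib, h2, hneg, hadd, hadd, hleib, hleib, hleib, hleib, hskew (funSmul f Z), hleib, h3,
    h1 Z (br X Y)]
  simp only [ContMDiffSection.coe_add, ContMDiffSection.coe_neg, Pi.add_apply, Pi.neg_apply,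
    funSmul_apply]
  module

end Tensorial

/-! ### Lie algebroids: the anchor and the differential in low degrees -/

namespace LieAlgebroid

section Calculus

open Filter Topology

variable {B : Type*} [NormedAddCommGroup B] [NormedSpace ℝ B]
  {H : Type*} [TopologicalSpace H] {I : ModelWithCorners ℝ B H}
  {M : Type*} [TopologicalSpace M] [ChartedSpace H M] [IsManifold I ∞ M]
  {F : Type*} [NormedAddCommGroup F] [NormedSpace ℝ F]
  {E : M → Type*} [TopologicalSpace (TotalSpace F E)]
  [∀ x, AddCommGroup (E x)] [∀ x, Module ℝ (E x)] [∀ x, TopologicalSpace (E x)]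
  [FiberBundle F E] [VectorBundle ℝ F E]
  (A : LieAlgebroid I F E)

theorem contMDiff_anchorDeriv {f : M → ℝ} (hf : ContMDiff I 𝓘(ℝ, ℝ) ∞ f) (X : Cₛ^∞⟮I; F, E⟯) :
    ContMDiff I 𝓘(ℝ, ℝ) ∞ (fun x => A.anchorDeriv f x (X x)) :=
  contMDiff_directionalDeriv hf (A.contMDiff_anchor.comp X.contMDiff)

theorem contMDiff_anchorDeriv_totalSpace [ContMDiffVectorBundle ∞ F E I] {f : M → ℝ}
    (hf : ContMDiff I 𝓘(ℝ, ℝ) ∞ f) :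
    ContMDiff (I.prod 𝓘(ℝ, F)) 𝓘(ℝ, ℝ) ∞
      (fun a : TotalSpace F E => A.anchorDeriv f a.proj a.2) :=
  contMDiff_directionalDeriv hf A.contMDiff_anchor

theorem anchorDeriv_add_vector (f : M → ℝ) (x : M) (b c : E x) :
    A.anchorDeriv f x (b + c) = A.anchorDeriv f x b + A.anchorDeriv f x c := by
  unfold anchorDeriv
  rw [map_add, directionalDeriv_add_vector]

theorem anchorDeriv_smul_vector (f : M → ℝ) (x : M) (r : ℝ) (b : E x) :
    A.anchorDeriv f x (r • b) = r * A.anchorDeriv f x b := by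
  unfold anchorDeriv
  rw [map_smul, directionalDeriv_smul_vector]

theorem anchorDeriv_zero_vector (f : M → ℝ) (x : M) : A.anchorDeriv f x (0 : E x) = 0 := by
  unfold anchorDeriv
  rw [map_zero, directionalDeriv_zero_vector]

/-- The section `df = ρ^* df` of `E*`. -/
def dFun (f : C^∞⟮I, M; ℝ⟯) : BundleForm I F E 1 :=
  BundleForm.ofLin (fun x =>
    { toFun := fun b => A.anchorDeriv f x b
      map_add' := A.anchorDeriv_add_vector f x
      map_smul' := A.anchorDeriv_smul_vector f x }) fun X => A.contMDiff_anchorDeriv f.contMDiff X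

@[simp]
theorem toLin_dFun (f : C^∞⟮I, M; ℝ⟯) (x : M) (b : E x) :
    (A.dFun f).toLin x b = A.anchorDeriv f x b := rfl

theorem anchorDeriv_add {f g : M → ℝ} (hf : ContMDiff I 𝓘(ℝ, ℝ) ∞ f)
    (hg : ContMDiff I 𝓘(ℝ, ℝ) ∞ g) (x : M) (b : E x) :
    A.anchorDeriv (fun y => f y + g y) x b = A.anchorDeriv f x b + A.anchorDeriv g x b :=
  directionalDeriv_add hf hg x _

theorem anchorDeriv_sub {f g : M → ℝ} (hf : ContMDiff I 𝓘(ℝ, ℝ) ∞ f)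
    (hg : ContMDiff I 𝓘(ℝ, ℝ) ∞ g) (x : M) (b : E x) :
    A.anchorDeriv (fun y => f y - g y) x b = A.anchorDeriv f x b - A.anchorDeriv g x b :=
  directionalDeriv_sub hf hg x _

theorem anchorDeriv_neg (f : M → ℝ) (x : M) (b : E x) :
    A.anchorDeriv (fun y => - f y) x b = - A.anchorDeriv f x b :=
  directionalDeriv_neg f x _

theorem anchorDeriv_mul {f g : M → ℝ} (hf : ContMDiff I 𝓘(ℝ, ℝ) ∞ f)
    (hg : ContMDiff I 𝓘(ℝ, ℝ) ∞ g) (x : M) (b : E x) :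
    A.anchorDeriv (fun y => f y * g y) x b
      = f x * A.anchorDeriv g x b + A.anchorDeriv f x b * g x :=
  directionalDeriv_mul hf hg x _

theorem anchorDeriv_sum_mul {ι : Type*} (s : Finset ι) {f g : ι → M → ℝ}
    (hf : ∀ i, ContMDiff I 𝓘(ℝ, ℝ) ∞ (f i)) (hg : ∀ i, ContMDiff I 𝓘(ℝ, ℝ) ∞ (g i)) (x : M)
    (b : E x) :
    A.anchorDeriv (fun y => ∑ i ∈ s, f i y * g i y) x b
      = ∑ i ∈ s, (f i x * A.anchorDeriv (g i) x b + A.anchorDeriv (f i) x b * g i x) :=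
  directionalDeriv_sum_mul s hf hg x _

theorem anchorDeriv_const (c : ℝ) (x : M) (b : E x) : A.anchorDeriv (fun _ => c) x b = 0 :=
  directionalDeriv_const c x _

theorem bracket_add_left (X Y Z : Cₛ^∞⟮I; F, E⟯) :
    A.bracket (X + Y) Z = A.bracket X Z + A.bracket Y Z := by
  rw [A.bracket_skew, A.bracket_add_right, A.bracket_skew Z X, A.bracket_skew Z Y]
  abel

theorem bracket_skew_apply (X Y : Cₛ^∞⟮I; F, E⟯) (x : M) :
    A.bracket X Y x = - A.bracket Y X x := by
  rw [A.bracket_skew X Y]; rfl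

theorem bracket_funSmul_right (f : C^∞⟮I, M; ℝ⟯) (X Y : Cₛ^∞⟮I; F, E⟯) (x : M) :
    A.bracket X (funSmul f Y) x = f x • A.bracket X Y x + A.anchorDeriv f x (X x) • Y x :=
  A.leibniz X Y (funSmul f Y) f (fun _ => rfl) x

theorem bracket_funSmul_left (f : C^∞⟮I, M; ℝ⟯) (X Y : Cₛ^∞⟮I; F, E⟯) (x : M) :
    A.bracket (funSmul f X) Y x = f x • A.bracket X Y x - A.anchorDeriv f x (Y x) • X x := by
  rw [A.bracket_skew_apply, A.bracket_funSmul_right, A.bracket_skew_apply Y X]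
  module

theorem differential_one (α : BundleForm I F E 1) (X : Fin 2 → Cₛ^∞⟮I; F, E⟯) (x : M) :
    A.differential α X x = A.anchorDeriv (fun y => α.toLin y (X 1 y)) x (X 0 x)
      - A.anchorDeriv (fun y => α.toLin y (X 0 y)) x (X 1 x)
      - α.toLin x (A.bracket (X 0) (X 1) x) := by
  have h0 : (α.eval fun l => X ((0 : Fin 2).succAbove l)) = fun y => α.toLin y (X 1 y) :=
    funext fun y => α.eval_one _ y
  have h1 : (α.eval fun l => X ((1 : Fin 2).succAbove l)) = fun y => α.toLin y (X 0 y) :=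
    funext fun y => α.eval_one _ y
  change ∑ i : Fin 2, (-1 : ℝ) ^ (i : ℕ) *
      A.anchorDeriv (α.eval fun l => X (i.succAbove l)) x (X i x)
    + ∑ j : Fin 2, ∑ i : Fin 1, (if i.castSucc < j then (-1 : ℝ) ^ ((i : ℕ) + (j : ℕ)) *
        α.eval (Fin.cons (A.bracket (X i.castSucc) (X j))
          fun l => X (j.succAbove (i.succAbove l))) x else 0) = _
  simp only [Fin.sum_univ_two, Fin.sum_univ_one, h0, h1, BundleForm.eval_one, Fin.cons_zero]
  simp
  ring

theorem differential_two (Ω : BundleForm I F E 2) (X : Fin 3 → Cₛ^∞⟮I; F, E⟯) (x : M) :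
    A.differential Ω X x = A.anchorDeriv (fun y => Ω.toBilin y (X 1 y) (X 2 y)) x (X 0 x)
      - A.anchorDeriv (fun y => Ω.toBilin y (X 0 y) (X 2 y)) x (X 1 x)
      + A.anchorDeriv (fun y => Ω.toBilin y (X 0 y) (X 1 y)) x (X 2 x)
      - Ω.toBilin x (A.bracket (X 0) (X 1) x) (X 2 x)
      + Ω.toBilin x (A.bracket (X 0) (X 2) x) (X 1 x)
      - Ω.toBilin x (A.bracket (X 1) (X 2) x) (X 0 x) := by
  have h0 : (Ω.eval fun l => X ((0 : Fin 3).succAbove l))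
      = fun y => Ω.toBilin y (X 1 y) (X 2 y) := funext fun y => Ω.eval_two _ y
  have h1 : (Ω.eval fun l => X ((1 : Fin 3).succAbove l))
      = fun y => Ω.toBilin y (X 0 y) (X 2 y) := funext fun y => Ω.eval_two _ y
  have h2 : (Ω.eval fun l => X ((2 : Fin 3).succAbove l))
      = fun y => Ω.toBilin y (X 0 y) (X 1 y) := funext fun y => Ω.eval_two _ y
  change ∑ i : Fin 3, (-1 : ℝ) ^ (i : ℕ) *
      A.anchorDeriv (Ω.eval fun l => X (i.succAbove l)) x (X i x)
    + ∑ j : Fin 3, ∑ i : Fin 2, (if i.castSucc < j then (-1 : ℝ) ^ ((i : ℕ) + (j : ℕ)) *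
        Ω.eval (Fin.cons (A.bracket (X i.castSucc) (X j))
          fun l => X (j.succAbove (i.succAbove l))) x else 0) = _
  simp only [Fin.sum_univ_three, Fin.sum_univ_two, h0, h1, h2, BundleForm.eval_two]
  have c0 : (Fin.castSucc (0 : Fin 2)) = 0 := rfl
  have c1 : (Fin.castSucc (1 : Fin 2)) = 1 := rfl
  have o1 : Fin.cons (α := fun _ => Cₛ^∞⟮I; F, E⟯) (A.bracket (X 0) (X 1)) (fun l : Fin 1 =>
    X ((1 : Fin 3).succAbove ((0 : Fin 2).succAbove l))) 1 = X 2 := rfl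
  have o2 : Fin.cons (α := fun _ => Cₛ^∞⟮I; F, E⟯) (A.bracket (X 0) (X 2)) (fun l : Fin 1 =>
    X ((2 : Fin 3).succAbove ((0 : Fin 2).succAbove l))) 1 = X 1 := rfl
  have o3 : Fin.cons (α := fun _ => Cₛ^∞⟮I; F, E⟯) (A.bracket (X 1) (X 2)) (fun l : Fin 1 =>
    X ((2 : Fin 3).succAbove ((1 : Fin 2).succAbove l))) 1 = X 0 := rfl
  simp only [c0, c1, o1, o2, o3, Fin.cons_zero]
  simp
  ring

section Anchor

variable [ContMDiffVectorBundle ∞ F E I] [T2Space M] [FiniteDimensional ℝ B]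
  [FiniteDimensional ℝ F]

/-- The anchor is a homomorphism of brackets, expressed on functions. It follows from the Jacobi
identity for `X, Y, fZ` with `Z` not vanishing at the given point. -/
theorem anchorDeriv_bracket {f : M → ℝ} (hf : ContMDiff I 𝓘(ℝ, ℝ) ∞ f) (X Y : Cₛ^∞⟮I; F, E⟯)
    (x : M) :
    A.anchorDeriv f x (A.bracket X Y x)
      = A.anchorDeriv (fun y => A.anchorDeriv f y (Y y)) x (X x)
        - A.anchorDeriv (fun y => A.anchorDeriv f y (X y)) x (Y x) := by
  by_cases hE : ∀ b : E x, b = 0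
  · rw [hE (A.bracket X Y x), hE (X x), hE (Y x)]
    simp only [anchorDeriv_zero_vector, sub_zero]
  push Not at hE
  obtain ⟨b, hb⟩ := hE
  let Z := sectionThrough I F E x b
  have hZ : Z x ≠ 0 := by rwa [show Z x = b from sectionThrough_self x b]
  let φ : C^∞⟮I, M; ℝ⟯ := ⟨f, hf⟩
  have h := jacobiator_funSmul A.bracket
    (fun X f => ⟨_, A.contMDiff_anchorDeriv f.contMDiff X⟩) A.bracket_add_right A.bracket_skew
    (fun X f Y => ContMDiffSection.ext fun y => A.bracket_funSmul_right f X Y y) X Y Z φ x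
  have h1 := congrArg (fun W => W x) (A.jacobi X Y (funSmul φ Z))
  have h2 := congrArg (fun W => W x) (A.jacobi X Y Z)
  simp only [ContMDiffSection.coe_add, Pi.add_apply, ContMDiffSection.coe_zero,
    Pi.zero_apply] at h1 h2
  rw [h1, h2, smul_zero, zero_add] at h
  exact (sub_eq_zero.1 ((smul_eq_zero.1 h.symm).resolve_right hZ)).symm

end Anchor

end Calculus

/-! ### Vector fields as derivations -/

section Tangent

open Filter Topology VectorField

variable {B : Type*} [NormedAddCommGroup B] [NormedSpace ℝ B] [FiniteDimensional ℝ B]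
  {H : Type*} [TopologicalSpace H] (I : ModelWithCorners ℝ B H)
  (M : Type*) [TopologicalSpace M] [ChartedSpace H M] [IsManifold I ∞ M]

/-- The tangent bundle as a Lie algebroid, with the Lie bracket of vector fields. -/
def tangentAlgebroid : LieAlgebroid I B (TangentSpace I : M → Type _) where
  anchor _ := LinearMap.id
  bracket X Y := ⟨mlieBracket I X Y, fun x => by
    have : CompleteSpace B := FiniteDimensional.complete ℝ B
    have : IsManifold I (minSmoothness ℝ 3) M :=
      IsManifold.of_le (n := ∞) (by simpa using ENat.LEInfty.out)
    have : IsManifold I (∞ + 1) M := inferInstanceAs (IsManifold I ∞ M)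
    exact ContMDiffAt.mlieBracket_vectorField (m := ⊤) (n := ⊤)
      (X.contMDiff x) (Y.contMDiff x) (by simp)⟩
  contMDiff_anchor := contMDiff_id
  bracket_add_right X Y Z := by
    have : CompleteSpace B := FiniteDimensional.complete ℝ B
    have : IsManifold I 2 M := IsManifold.of_le (n := ∞) ENat.LEInfty.out
    ext x
    exact mlieBracket_add_right (Y.contMDiff.mdifferentiable (by simp) x)
      (Z.contMDiff.mdifferentiable (by simp) x)
  bracket_smul_right c X Y := by
    have : CompleteSpace B := FiniteDimensional.complete ℝ B
    have : IsManifold I 2 M := IsManifold.of_le (n := ∞) ENat.LEInfty.out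
    ext x
    exact mlieBracket_const_smul_right (Y.contMDiff.mdifferentiable (by simp) x)
  bracket_skew X Y := by
    ext x
    exact mlieBracket_swap_apply
  jacobi X Y Z := by
    have : CompleteSpace B := FiniteDimensional.complete ℝ B
    have : IsManifold I (minSmoothness ℝ 3) M :=
      IsManifold.of_le (n := ∞) (by simpa using ENat.LEInfty.out)
    have : IsManifold I 2 M := IsManifold.of_le (n := ∞) ENat.LEInfty.out
    have : IsManifold I (∞ + 1) M := inferInstanceAs (IsManifold I ∞ M)
    have h2 : minSmoothness ℝ 2 ≤ ∞ := by simpa using ENat.LEInfty.out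
    ext x
    have h := leibniz_identity_mlieBracket_apply (I := I) (U := X) (V := Y) (W := Z) (x := x)
      ((X.contMDiff x).of_le h2) ((Y.contMDiff x).of_le h2)
      ((Z.contMDiff x).of_le h2)
    change mlieBracket I X (mlieBracket I Y Z) x + mlieBracket I Y (mlieBracket I Z X) x
      + mlieBracket I Z (mlieBracket I X Y) x = 0
    have h1 : mlieBracket I Y (mlieBracket I Z X) x = - mlieBracket I Y (mlieBracket I X Z) x := by
      have hs : ContMDiffAt I I.tangent ∞
          (fun y => (⟨y, mlieBracket I X Z y⟩ : TangentBundle I M)) x :=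
        ContMDiffAt.mlieBracket_vectorField (m := ⊤) (n := ⊤) (X.contMDiff x) (Z.contMDiff x)
          (by simp)
      have h3 : mlieBracket I Z X = (-1 : ℝ) • mlieBracket I X Z := by
        rw [mlieBracket_swap, neg_one_smul]
      rw [h3, mlieBracket_const_smul_right (hs.mdifferentiableAt (by simp)), neg_one_smul]
    rw [h, h1, mlieBracket_swap_apply (V := Z)]
    abel
  leibniz X Y fY f h x := by
    have : CompleteSpace B := FiniteDimensional.complete ℝ B
    have : IsManifold I 2 M := IsManifold.of_le (n := ∞) ENat.LEInfty.out
    have h1 : (fY : ∀ x, TangentSpace I x) = (f : M → ℝ) • (Y : ∀ x, TangentSpace I x) :=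
      funext h
    have h2 := mlieBracket_smul_right (I := I) (V := X) (W := Y) (f := f) (x := x)
      f.mdifferentiableAt (Y.contMDiff.mdifferentiable (by simp) x)
    change mlieBracket I X fY x = _
    rw [h1, h2, add_comm]
    rfl

variable {I M}

/-- The Lie bracket of vector fields acts on functions as the commutator: for the tangent algebroid,
this is the compatibility of the anchor with the brackets. -/
theorem directionalDeriv_mlieBracket [T2Space M] {f : M → ℝ} (hf : ContMDiff I 𝓘(ℝ, ℝ) ∞ f)
    {V W : ∀ x : M, TangentSpace I x}
    (hV : ContMDiff I I.tangent ∞ (fun x => (⟨x, V x⟩ : TangentBundle I M)))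
    (hW : ContMDiff I I.tangent ∞ (fun x => (⟨x, W x⟩ : TangentBundle I M))) (x : M) :
    directionalDeriv I f x (mlieBracket I V W x)
      = directionalDeriv I (fun y => directionalDeriv I f y (W y)) x (V x)
        - directionalDeriv I (fun y => directionalDeriv I f y (V y)) x (W x) :=
  (tangentAlgebroid I M).anchorDeriv_bracket hf ⟨V, hV⟩ ⟨W, hW⟩ x

end Tangent

/-! ### The differential of a section of `E*` -/

section Tensoriality

open Filter Topology

variable {B : Type*} [NormedAddCommGroup B] [NormedSpace ℝ B]
  {H : Type*} [TopologicalSpace H] {I : ModelWithCorners ℝ B H}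
  {M : Type*} [TopologicalSpace M] [ChartedSpace H M] [IsManifold I ∞ M]
  {F : Type*} [NormedAddCommGroup F] [NormedSpace ℝ F]
  {E : M → Type*} [TopologicalSpace (TotalSpace F E)]
  [∀ x, AddCommGroup (E x)] [∀ x, Module ℝ (E x)] [∀ x, TopologicalSpace (E x)]
  [FiberBundle F E] [VectorBundle ℝ F E] [ContMDiffVectorBundle ∞ F E I] [T2Space M]
  [FiniteDimensional ℝ B] [FiniteDimensional ℝ F]
  (A : LieAlgebroid I F E)

/-- The value of `dα` on a pair of sections. -/
def dPair (α : BundleForm I F E 1) (X Y : Cₛ^∞⟮I; F, E⟯) (x : M) : ℝ :=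
  A.anchorDeriv (fun y => α.toLin y (Y y)) x (X x)
    - A.anchorDeriv (fun y => α.toLin y (X y)) x (Y x) - α.toLin x (A.bracket X Y x)

theorem dPair_swap (α : BundleForm I F E 1) (X Y : Cₛ^∞⟮I; F, E⟯) (x : M) :
    A.dPair α X Y x = - A.dPair α Y X x := by
  unfold dPair
  rw [A.bracket_skew_apply X Y, map_neg]
  ring

theorem dPair_add_right (α : BundleForm I F E 1) (X Y Z : Cₛ^∞⟮I; F, E⟯) (x : M) :
    A.dPair α X (Y + Z) x = A.dPair α X Y x + A.dPair α X Z x := by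
  unfold dPair
  simp only [A.bracket_add_right, ContMDiffSection.coe_add, Pi.add_apply, map_add,
    A.anchorDeriv_add_vector]
  rw [A.anchorDeriv_add (α.contMDiff_toLin Y) (α.contMDiff_toLin Z)]
  ring

theorem dPair_funSmul_right (α : BundleForm I F E 1) (f : C^∞⟮I, M; ℝ⟯) (X Y : Cₛ^∞⟮I; F, E⟯)
    (x : M) : A.dPair α X (funSmul f Y) x = f x * A.dPair α X Y x := by
  unfold dPair
  simp only [A.bracket_funSmul_right, funSmul_apply, map_add, map_smul, smul_eq_mul,
    A.anchorDeriv_smul_vector]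
  rw [A.anchorDeriv_mul f.contMDiff (α.contMDiff_toLin Y)]
  ring

theorem dPair_congr (α : BundleForm I F E 1) {X X' Y Y' : Cₛ^∞⟮I; F, E⟯} {x : M}
    (hX : X x = X' x) (hY : Y x = Y' x) : A.dPair α X Y x = A.dPair α X' Y' x := by
  have h : ∀ {X Y Y' : Cₛ^∞⟮I; F, E⟯}, Y x = Y' x → A.dPair α X Y x = A.dPair α X Y' x :=
    fun {X _ _} h => tensorial_congr (T := fun Y => A.dPair α X Y x)
      (fun Y Z => A.dPair_add_right α X Y Z x) (fun f Y => A.dPair_funSmul_right α f X Y x) h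
  rw [h hY, dPair_swap, h hX, ← dPair_swap]

theorem dPair_smul_right (α : BundleForm I F E 1) (r : ℝ) (X Y : Cₛ^∞⟮I; F, E⟯)
    (x : M) : A.dPair α X (r • Y) x = r * A.dPair α X Y x :=
  A.dPair_funSmul_right α ⟨fun _ => r, contMDiff_const⟩ X Y x

/-- The alternating form `dα` on the fibre `E_x`. It is evaluated on sections through the given
vectors; the choice does not matter, see `dForm_apply`. -/
def dForm (α : BundleForm I F E 1) (x : M) : E x →ₗ[ℝ] E x →ₗ[ℝ] ℝ :=
  LinearMap.mk₂ ℝ (fun b c => A.dPair α (sectionThrough I F E x b) (sectionThrough I F E x c) x)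
    (fun b b' c => by
      rw [dPair_swap, map_add, dPair_add_right, dPair_swap A α _ (sectionThrough I F E x b),
        dPair_swap A α _ (sectionThrough I F E x b')]
      ring)
    (fun r b c => by
      rw [dPair_swap, map_smul, dPair_smul_right, dPair_swap A α _ (sectionThrough I F E x b),
        smul_eq_mul]
      ring)
    (fun b c c' => by rw [map_add, dPair_add_right])
    (fun r b c => by rw [map_smul, dPair_smul_right, smul_eq_mul])

theorem dForm_apply (α : BundleForm I F E 1) (X Y : Cₛ^∞⟮I; F, E⟯) (x : M) :
    A.dForm α x (X x) (Y x) = A.anchorDeriv (fun y => α.toLin y (Y y)) x (X x)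
      - A.anchorDeriv (fun y => α.toLin y (X y)) x (Y x) - α.toLin x (A.bracket X Y x) :=
  A.dPair_congr α (sectionThrough_self x _) (sectionThrough_self x _)

theorem differential_one_eq_dForm (α : BundleForm I F E 1) (X : Fin 2 → Cₛ^∞⟮I; F, E⟯) (x : M) :
    A.differential α X x = A.dForm α x (X 0 x) (X 1 x) := by
  rw [differential_one, dForm_apply]

theorem dForm_swap (α : BundleForm I F E 1) (x : M) (b c : E x) :
    A.dForm α x b c = - A.dForm α x c b :=
  A.dPair_swap α _ _ x

theorem contMDiff_dForm (α : BundleForm I F E 1) (X Y : Cₛ^∞⟮I; F, E⟯) :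
    ContMDiff I 𝓘(ℝ, ℝ) ∞ (fun x => A.dForm α x (X x) (Y x)) := by
  simp only [dForm_apply]
  exact ((A.contMDiff_anchorDeriv (α.contMDiff_toLin Y) X).sub
    (A.contMDiff_anchorDeriv (α.contMDiff_toLin X) Y)).sub (α.contMDiff_toLin _)

/-- `d² = 0` on functions. -/
theorem dForm_dFun (f : C^∞⟮I, M; ℝ⟯) (x : M) (b c : E x) : A.dForm (A.dFun f) x b c = 0 := by
  have h := A.dForm_apply (A.dFun f) (sectionThrough I F E x b) (sectionThrough I F E x c) x
  rw [sectionThrough_self, sectionThrough_self] at h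
  rw [h, toLin_dFun, A.anchorDeriv_bracket f.contMDiff]
  simp only [toLin_dFun, sectionThrough_self]
  ring

/-- The Leibniz rule for `d`, for a finite sum of products `∑ fᵢ αᵢ`. -/
theorem dForm_sum {ι : Type*} [Fintype ι] {f : ι → C^∞⟮I, M; ℝ⟯} {α : ι → BundleForm I F E 1}
    {β : BundleForm I F E 1} (h : ∀ x b, β.toLin x b = ∑ i, f i x * (α i).toLin x b)
    (x : M) (b c : E x) :
    A.dForm β x b c = ∑ i, (f i x * A.dForm (α i) x b c
      + (A.anchorDeriv (f i) x b * (α i).toLin x c - A.anchorDeriv (f i) x c * (α i).toLin x b)) := by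
  have key := fun α => A.dForm_apply α (sectionThrough I F E x b) (sectionThrough I F E x c) x
  simp only [sectionThrough_self] at key
  rw [key]
  simp only [key, h]
  rw [A.anchorDeriv_sum_mul _ (fun i => (f i).contMDiff) (fun i => (α i).contMDiff_toLin _),
    A.anchorDeriv_sum_mul _ (fun i => (f i).contMDiff) (fun i => (α i).contMDiff_toLin _),
    ← Finset.sum_sub_distrib, ← Finset.sum_sub_distrib]
  refine Finset.sum_congr rfl fun i _ => ?_
  simp only [sectionThrough_self]
  ring

theorem differential_two_swap₀₁ (Ω : BundleForm I F E 2) (X Y Z : Cₛ^∞⟮I; F, E⟯) (x : M) :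
    A.differential Ω ![X, Y, Z] x = - A.differential Ω ![Y, X, Z] x := by
  simp only [differential_two, Matrix.cons_val]
  rw [A.bracket_skew_apply X Y, show (fun y => Ω.toBilin y (X y) (Y y))
    = fun y => -Ω.toBilin y (Y y) (X y) from funext fun y => Ω.toBilin_swap y _ _,
    A.anchorDeriv_neg, map_neg, LinearMap.neg_apply]
  ring

theorem differential_two_swap₁₂ (Ω : BundleForm I F E 2) (X Y Z : Cₛ^∞⟮I; F, E⟯) (x : M) :
    A.differential Ω ![X, Y, Z] x = - A.differential Ω ![X, Z, Y] x := by
  simp only [differential_two, Matrix.cons_val]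
  rw [A.bracket_skew_apply Y Z, show (fun y => Ω.toBilin y (Y y) (Z y))
    = fun y => -Ω.toBilin y (Z y) (Y y) from funext fun y => Ω.toBilin_swap y _ _,
    A.anchorDeriv_neg, map_neg, LinearMap.neg_apply]
  ring

theorem differential_two_add (Ω : BundleForm I F E 2) (X Y Z Z' : Cₛ^∞⟮I; F, E⟯) (x : M) :
    A.differential Ω ![X, Y, Z + Z'] x
      = A.differential Ω ![X, Y, Z] x + A.differential Ω ![X, Y, Z'] x := by
  simp only [differential_two, Matrix.cons_val, A.bracket_add_right, ContMDiffSection.coe_add,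
    Pi.add_apply, map_add, LinearMap.add_apply, A.anchorDeriv_add_vector]
  rw [A.anchorDeriv_add (Ω.contMDiff_toBilin Y Z) (Ω.contMDiff_toBilin Y Z'),
    A.anchorDeriv_add (Ω.contMDiff_toBilin X Z) (Ω.contMDiff_toBilin X Z')]
  ring

theorem differential_two_funSmul (Ω : BundleForm I F E 2) (f : C^∞⟮I, M; ℝ⟯)
    (X Y Z : Cₛ^∞⟮I; F, E⟯) (x : M) :
    A.differential Ω ![X, Y, funSmul f Z] x = f x * A.differential Ω ![X, Y, Z] x := by
  simp only [differential_two, Matrix.cons_val, A.bracket_funSmul_right, funSmul_apply,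
    map_add, map_smul, smul_eq_mul, LinearMap.add_apply, LinearMap.smul_apply,
    A.anchorDeriv_smul_vector]
  rw [A.anchorDeriv_mul f.contMDiff (Ω.contMDiff_toBilin Y Z),
    A.anchorDeriv_mul f.contMDiff (Ω.contMDiff_toBilin X Z), Ω.toBilin_swap x (Z x) (Y x),
    Ω.toBilin_swap x (Z x) (X x)]
  ring

/-- The differential of a section of `⋀² E*` is tensorial. -/
theorem differential_two_congr (Ω : BundleForm I F E 2) {X X' Y Y' Z Z' : Cₛ^∞⟮I; F, E⟯} {x : M}
    (hX : X x = X' x) (hY : Y x = Y' x) (hZ : Z x = Z' x) :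
    A.differential Ω ![X, Y, Z] x = A.differential Ω ![X', Y', Z'] x := by
  have h : ∀ {X Y Z Z' : Cₛ^∞⟮I; F, E⟯}, Z x = Z' x →
      A.differential Ω ![X, Y, Z] x = A.differential Ω ![X, Y, Z'] x :=
    fun {X Y _ _} h => tensorial_congr (T := fun Z => A.differential Ω ![X, Y, Z] x)
      (fun Z Z' => A.differential_two_add Ω X Y Z Z' x)
      (fun f Z => A.differential_two_funSmul Ω f X Y Z x) h
  rw [h hZ, differential_two_swap₁₂, h hY, ← differential_two_swap₁₂, differential_two_swap₀₁,
    differential_two_swap₁₂, h hX, ← differential_two_swap₁₂, ← differential_two_swap₀₁]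

end Tensoriality

/-! ### Functions and tangent vectors on the total space -/

section TotalSpace

open Filter Topology

variable {B : Type*} [NormedAddCommGroup B] [NormedSpace ℝ B]
  {H : Type*} [TopologicalSpace H] {I : ModelWithCorners ℝ B H}
  {M : Type*} [TopologicalSpace M] [ChartedSpace H M] [IsManifold I ∞ M]
  {F : Type*} [NormedAddCommGroup F] [NormedSpace ℝ F]
  {E : M → Type*} [TopologicalSpace (TotalSpace F E)]
  [∀ x, AddCommGroup (E x)] [∀ x, Module ℝ (E x)] [∀ x, TopologicalSpace (E x)]
  [FiberBundle F E] [VectorBundle ℝ F E] [ContMDiffVectorBundle ∞ F E I] [T2Space M]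
  [FiniteDimensional ℝ B] [FiniteDimensional ℝ F]

/-- Bump functions on the total space, and hence frames of bundles over it, need this separation. -/
theorem t2Space_totalSpace {M : Type*} [TopologicalSpace M] [T2Space M] {F : Type*}
    [TopologicalSpace F] [T2Space F] {E : M → Type*} [TopologicalSpace (TotalSpace F E)]
    [∀ x, TopologicalSpace (E x)] [FiberBundle F E] : T2Space (TotalSpace F E) := by
  refine ⟨fun a b hab => ?_⟩
  by_cases h : a.proj = b.proj
  · set e := trivializationAt F E a.proj
    have ha : a ∈ e.source := FiberBundle.mem_trivializationAt_proj_source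
    have hb : b ∈ e.source := by
      rw [e.mem_source, ← h]; exact e.mem_source.1 ha
    have hne : e a ≠ e b := fun hE => hab (e.injOn ha hb hE)
    obtain ⟨u, v, hu, hv, hau, hbv, huv⟩ := t2_separation hne
    exact ⟨e.source ∩ e ⁻¹' u, e.source ∩ e ⁻¹' v,
      e.toOpenPartialHomeomorph.isOpen_inter_preimage hu,
      e.toOpenPartialHomeomorph.isOpen_inter_preimage hv, ⟨ha, hau⟩, ⟨hb, hbv⟩,
      (huv.preimage e).mono inter_subset_right inter_subset_right⟩
  · exact separated_by_continuous (FiberBundle.continuous_proj F E) h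

theorem linearFunction_eq (α : BundleForm I F E 1) (a : TotalSpace F E) :
    linearFunction α a = α.toLin a.proj a.2 := rfl

theorem contMDiffAt_repr_trivialization {x₀ : M} {a : TotalSpace F E}
    (ha : a ∈ (trivializationAt F E x₀).source) (i : Fin (Module.finrank ℝ F)) :
    ContMDiffAt (I.prod 𝓘(ℝ, F)) 𝓘(ℝ, ℝ) ∞
      (fun q => (Module.finBasis ℝ F).repr (trivializationAt F E x₀ q).2 i) a := by
  have h1 := (contMDiffOn_snd_trivialization (I := I) (trivializationAt F E x₀)).contMDiffAt
    ((trivializationAt F E x₀).open_source.mem_nhds ha)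
  exact (((Module.finBasis ℝ F).coord i).toContinuousLinearMap.contMDiff.contMDiffAt).comp a h1

theorem eventually_proj {p : M → Prop} {a : TotalSpace F E} (h : ∀ᶠ x in 𝓝 a.proj, p x) :
    ∀ᶠ q : TotalSpace F E in 𝓝 a, p q.proj :=
  (FiberBundle.continuous_proj F E).continuousAt.eventually h

theorem contMDiff_comp_proj {f : M → ℝ} (hf : ContMDiff I 𝓘(ℝ, ℝ) ∞ f) :
    ContMDiff (I.prod 𝓘(ℝ, F)) 𝓘(ℝ, ℝ) ∞ (fun a : TotalSpace F E => f a.proj) :=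
  hf.comp (contMDiff_proj E)

theorem contMDiff_linearFunction (α : BundleForm I F E 1) :
    ContMDiff (I.prod 𝓘(ℝ, F)) 𝓘(ℝ, ℝ) ∞ (linearFunction α) := by
  intro a
  let fr := cutoffFrame I F E a.proj
  have h : linearFunction α =ᶠ[𝓝 a] fun q => ∑ i, α.toLin q.proj (fr.e i q.proj)
      * (Module.finBasis ℝ F).repr (trivializationAt F E a.proj q).2 i := by
    filter_upwards [eventually_proj fr.eventually_χ, eventually_proj fr.eventually_ε] with q h1 h2
    have h3 := congrArg (α.toLin q.proj) (fr.sum_smul q.proj q.2)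
    rw [h1, one_smul, map_sum] at h3
    rw [linearFunction_eq, ← h3]
    refine Finset.sum_congr rfl fun i _ => ?_
    rw [map_smul, h2, smul_eq_mul, mul_comm]
  refine ContMDiffAt.congr_of_eventuallyEq ?_ h
  refine contMDiffAt_finsetSum fun i _ => ?_
  exact (contMDiff_comp_proj (α.contMDiff_toLin (fr.e i))).contMDiffAt.mul
    (contMDiffAt_repr_trivialization FiberBundle.mem_trivializationAt_proj_source i)

/-- The fibre coordinates of a tangent vector are its derivatives of the linear functions given by
the coframe. -/
theorem repr_fibreComponent {x₀ : M} {a : TotalSpace F E}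
    (ha : a ∈ (trivializationAt F E x₀).source) {ε : BundleForm I F E 1}
    {i : Fin (Module.finrank ℝ F)}
    (hε : ∀ᶠ x in 𝓝 a.proj, ∀ b : E x, ε.toLin x b
      = (Module.finBasis ℝ F).repr (trivializationAt F E x₀ ⟨x, b⟩).2 i)
    (v : TangentSpace (I.prod 𝓘(ℝ, F)) a) :
    (Module.finBasis ℝ F).repr (fibreComponent I (trivializationAt F E x₀) a v) i
      = directionalDeriv (I.prod 𝓘(ℝ, F)) (linearFunction ε) a v := by
  set e := trivializationAt F E x₀
  have h1 : linearFunction ε =ᶠ[𝓝 a]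
      fun q => ((Module.finBasis ℝ F).coord i).toContinuousLinearMap (e q).2 := by
    filter_upwards [eventually_proj hε] with q hq
    exact hq q.2
  rw [directionalDeriv_congr h1]
  have h2 : MDifferentiableAt (I.prod 𝓘(ℝ, F)) 𝓘(ℝ, F) (fun q => (e q).2) a :=
    ((contMDiffOn_snd_trivialization e).contMDiffAt
      (e.open_source.mem_nhds ha)).mdifferentiableAt (by simp)
  rw [directionalDeriv_comp (f := ((Module.finBasis ℝ F).coord i).toContinuousLinearMap)
    ((ContinuousLinearMap.contMDiff _ (n := ∞)).mdifferentiable (by simp) _) h2]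
  unfold directionalDeriv
  rw [ContinuousLinearMap.mfderiv_eq]
  rfl

/-- A tangent vector of the total space is determined by its projection and its derivatives of the
linear functions. -/
theorem tangent_ext {a : TotalSpace F E} {v w : TangentSpace (I.prod 𝓘(ℝ, F)) a}
    (h1 : mfderiv (I.prod 𝓘(ℝ, F)) I (π F E) a v = mfderiv (I.prod 𝓘(ℝ, F)) I (π F E) a w)
    (h2 : ∀ α : BundleForm I F E 1, directionalDeriv (I.prod 𝓘(ℝ, F)) (linearFunction α) a v
      = directionalDeriv (I.prod 𝓘(ℝ, F)) (linearFunction α) a w) : v = w := by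
  have ha : a ∈ (trivializationAt F E a.proj).source :=
    FiberBundle.mem_trivializationAt_proj_source
  let fr := cutoffFrame I F E a.proj
  have h3 : fibreComponent I (trivializationAt F E a.proj) a v
      = fibreComponent I (trivializationAt F E a.proj) a w := by
    refine (Module.finBasis ℝ F).ext_elem fun i => ?_
    have hε := fr.eventually_ε.mono fun x hx b => hx b i
    rw [repr_fibreComponent ha hε, repr_fibreComponent ha hε, h2]
  rw [← tangentLift_components ha v, ← tangentLift_components ha w, h1, h3]

theorem directionalDeriv_comp_proj {f : M → ℝ} (hf : ContMDiff I 𝓘(ℝ, ℝ) ∞ f)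
    (a : TotalSpace F E) (v : TangentSpace (I.prod 𝓘(ℝ, F)) a) :
    directionalDeriv (I.prod 𝓘(ℝ, F)) (fun q : TotalSpace F E => f q.proj) a v
      = directionalDeriv I f a.proj (mfderiv (I.prod 𝓘(ℝ, F)) I (π F E) a v) :=
  directionalDeriv_comp (hf.mdifferentiable (by simp) _)
    ((contMDiff_proj E (n := ∞)).mdifferentiable (by simp) a) v

/-- `Λ` is a derivation of the sections of `E*` at `a ∈ E` over the tangent vector `u` of the base:
`Λ(f α) = f Λ(α) + u(f) α(a)`, for finite sums. -/
def IsFibreDerivation (a : TotalSpace F E) (u : TangentSpace I a.proj)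
    (Λ : BundleForm I F E 1 → ℝ) : Prop :=
  ∀ (n : ℕ) (f : Fin n → C^∞⟮I, M; ℝ⟯) (α : Fin n → BundleForm I F E 1) (β : BundleForm I F E 1),
    (∀ x b, β.toLin x b = ∑ i, f i x * (α i).toLin x b) →
      Λ β = ∑ i, (f i a.proj * Λ (α i) + directionalDeriv I (f i) a.proj u * (α i).toLin a.proj a.2)

/-- A derivation is determined by its values on the coframe, and its formula in the frame follows from
the two expressions of `Λ(χ α)`, `χ` being the cut-off function. -/
theorem IsFibreDerivation.eq_sum {a : TotalSpace F E} {u : TangentSpace I a.proj}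
    {Λ : BundleForm I F E 1 → ℝ} (h : IsFibreDerivation a u Λ)
    (fr : CutoffFrame (I := I) (F := F) (E := E) a.proj) (α : BundleForm I F E 1) :
    Λ α = ∑ i, (α.toLin a.proj (fr.e i a.proj) * Λ (fr.ε i)
      + directionalDeriv I (fun x => α.toLin x (fr.e i x)) a.proj u
        * (fr.ε i).toLin a.proj a.2) := by
  have h1 := h 1 (fun _ => fr.χ) (fun _ => α) (BundleForm.funMul fr.χ α) (by simp)
  have h2 := h _ (fun i => ⟨_, α.contMDiff_toLin (fr.e i)⟩) fr.ε (BundleForm.funMul fr.χ α)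
    (fun x b => by
      have h3 := congrArg (α.toLin x) (fr.sum_smul x b)
      rw [map_sum, map_smul] at h3
      rw [BundleForm.toLin_funMul, ← smul_eq_mul, ← h3]
      refine Finset.sum_congr rfl fun i _ => ?_
      rw [map_smul, smul_eq_mul, mul_comm]
      rfl)
  rw [h2] at h1
  simp only [Finset.univ_unique, Finset.sum_singleton, fr.χ_self, one_mul,
    directionalDeriv_eventually_const fr.eventually_χ, zero_mul, add_zero] at h1
  exact h1.symm

theorem isFibreDerivation_linearFunction {a : TotalSpace F E}
    (v : TangentSpace (I.prod 𝓘(ℝ, F)) a) :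
    IsFibreDerivation a (mfderiv (I.prod 𝓘(ℝ, F)) I (π F E) a v)
      (fun α => directionalDeriv (I.prod 𝓘(ℝ, F)) (linearFunction α) a v) := by
  intro n f α β h
  have h1 : linearFunction β = fun q => ∑ i, f i q.proj * linearFunction (α i) q :=
    funext fun q => h q.proj q.2
  simp only [h1]
  rw [directionalDeriv_sum_mul (f := fun i (q : TotalSpace F E) => f i q.proj) _
    (fun i => contMDiff_comp_proj (f i).contMDiff) (fun i => contMDiff_linearFunction (α i))]
  refine Finset.sum_congr rfl fun i _ => ?_
  rw [directionalDeriv_comp_proj (f i).contMDiff]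
  rfl

/-- A derivation of the sections of `E*` at `a` over `u` comes from a tangent vector at `a`
projecting to `u`. -/
theorem IsFibreDerivation.exists_tangent {a : TotalSpace F E} {u : TangentSpace I a.proj}
    {Λ : BundleForm I F E 1 → ℝ} (h : IsFibreDerivation a u Λ) :
    ∃ v : TangentSpace (I.prod 𝓘(ℝ, F)) a, mfderiv (I.prod 𝓘(ℝ, F)) I (π F E) a v = u ∧
      ∀ α, directionalDeriv (I.prod 𝓘(ℝ, F)) (linearFunction α) a v = Λ α := by
  have ha : a ∈ (trivializationAt F E a.proj).source :=
    FiberBundle.mem_trivializationAt_proj_source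
  let fr := cutoffFrame I F E a.proj
  let v := tangentLift I (trivializationAt F E a.proj) a
    (u, ∑ i, Λ (fr.ε i) • Module.finBasis ℝ F i)
  have hv := components_tangentLift ha (u, ∑ i, Λ (fr.ε i) • Module.finBasis ℝ F i)
  have hv1 : mfderiv (I.prod 𝓘(ℝ, F)) I (π F E) a v = u := congrArg Prod.fst hv
  have hv2 : fibreComponent I (trivializationAt F E a.proj) a v
    = ∑ i, Λ (fr.ε i) • Module.finBasis ℝ F i := congrArg Prod.snd hv
  refine ⟨v, hv1, fun α => ?_⟩
  have h1 := isFibreDerivation_linearFunction v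
  rw [hv1] at h1
  rw [h.eq_sum fr α, h1.eq_sum fr α]
  refine Finset.sum_congr rfl fun i _ => ?_
  have hε := fr.eventually_ε.mono fun x hx b => hx b i
  rw [← repr_fibreComponent ha hε, hv2, Module.Basis.repr_sum_self]

/-- A functional of the sections of `E*` which is linear over the functions comes from an element
of `E`. -/
theorem IsFibreDerivation.exists_vector {a : TotalSpace F E}
    {Λ : BundleForm I F E 1 → ℝ} (h : IsFibreDerivation a 0 Λ) :
    ∃ b : E a.proj, ∀ α : BundleForm I F E 1, α.toLin a.proj b = Λ α := by
  let fr := cutoffFrame I F E a.proj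
  refine ⟨∑ i, Λ (fr.ε i) • fr.e i a.proj, fun α => ?_⟩
  rw [h.eq_sum fr α, map_sum]
  refine Finset.sum_congr rfl fun i _ => ?_
  rw [directionalDeriv_zero_vector, map_smul, smul_eq_mul]
  ring

/-- The sections of `E*` separate the vectors of `E`. -/
theorem vector_ext {x : M} {b c : E x} (h : ∀ α : BundleForm I F E 1, α.toLin x b = α.toLin x c) :
    b = c := by
  let fr := cutoffFrame I F E x
  have hb := fr.sum_smul x b
  have hc := fr.sum_smul x c
  rw [fr.χ_self, one_smul] at hb hc
  rw [← hb, ← hc]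
  simp only [h]

/-- The functions on `M` separate tangent vectors. -/
theorem tangent_ext_base {x : M} {v w : TangentSpace I x}
    (h : ∀ f : C^∞⟮I, M; ℝ⟯, directionalDeriv I f x v = directionalDeriv I f x w) : v = w := by
  obtain ⟨ψ⟩ : Nonempty (SmoothBumpFunction I x) := inferInstance
  have hx : x ∈ (extChartAt I x).source := mem_extChartAt_source x
  have key : ∀ l : B →L[ℝ] ℝ, l (mfderiv I 𝓘(ℝ, B) (extChartAt I x) x v)
      = l (mfderiv I 𝓘(ℝ, B) (extChartAt I x) x w) := by
    intro l
    have hs : ContMDiff I 𝓘(ℝ, ℝ) ∞ fun y => ψ y • l (extChartAt I x y) :=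
      ψ.contMDiff_smul (l.contMDiff.comp_contMDiffOn (contMDiffOn_extChartAt (n := ∞)))
    have h1 : (fun y => ψ y • l (extChartAt I x y)) =ᶠ[𝓝 x] fun y => l (extChartAt I x y) := by
      filter_upwards [ψ.eventuallyEq_one] with y hy
      rw [hy, Pi.one_apply, one_smul]
    have h2 : ∀ u : TangentSpace I x, directionalDeriv I (fun y => ψ y • l (extChartAt I x y)) x u
        = l (mfderiv I 𝓘(ℝ, B) (extChartAt I x) x u) := by
      intro u
      rw [directionalDeriv_congr h1, directionalDeriv_comp (f := l)
        ((l.contMDiff (n := ∞)).mdifferentiable (by simp) _)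
        (mdifferentiableAt_extChartAt (mem_chart_source H x))]
      unfold directionalDeriv
      rw [ContinuousLinearMap.mfderiv_eq]
      rfl
    rw [← h2, ← h2]
    exact h ⟨_, hs⟩
  have h3 : mfderiv I 𝓘(ℝ, B) (extChartAt I x) x v = mfderiv I 𝓘(ℝ, B) (extChartAt I x) x w := by
    refine (Module.finBasis ℝ B).ext_elem fun i => ?_
    exact key ((Module.finBasis ℝ B).coord i).toContinuousLinearMap
  obtain ⟨L, hL⟩ := isInvertible_mfderiv_extChartAt (I := I) hx
  rw [← hL] at h3
  exact L.injective h3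

theorem contMDiff_fibreLine (a : TotalSpace F E) (b : E a.proj) :
    ContMDiff 𝓘(ℝ, ℝ) (I.prod 𝓘(ℝ, F)) ∞
      (fun t : ℝ => (⟨a.proj, a.2 + t • b⟩ : TotalSpace F E)) := by
  intro t
  rw [contMDiffAt_totalSpace]
  refine ⟨contMDiffAt_const, ?_⟩
  set e := trivializationAt F E a.proj
  have hx : a.proj ∈ e.baseSet := FiberBundle.mem_baseSet_trivializationAt' a.proj
  have h : (fun t : ℝ => (e ⟨a.proj, a.2 + t • b⟩).2)
      = fun t => (e ⟨a.proj, a.2⟩).2 + t • (e ⟨a.proj, b⟩).2 := by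
    funext t
    have hl := e.linear ℝ hx
    rw [hl.map_add, hl.map_smul]
  change ContMDiffAt _ _ _ (fun t : ℝ => (e ⟨a.proj, a.2 + t • b⟩).2) t
  rw [h]
  exact (contDiff_const.add (contDiff_id.smul contDiff_const)).contMDiff.contMDiffAt

theorem mfderiv_proj_verticalVector (a : TotalSpace F E) (b : E a.proj) :
    mfderiv (I.prod 𝓘(ℝ, F)) I (π F E) a (verticalVector I a b) = 0 := by
  let c : ℝ → TotalSpace F E := fun t => ⟨a.proj, a.2 + t • b⟩
  have h0 : a = c 0 := by simp [c]
  have h1 := mfderiv_comp (0 : ℝ) ((contMDiff_proj E (n := ∞)).mdifferentiable (I := I.prod 𝓘(ℝ, F))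
    (by simp) (c 0)) ((contMDiff_fibreLine (I := I) a b).mdifferentiable (by simp) 0)
  have h2 : (π F E ∘ c) = fun _ => a.proj := rfl
  rw [h2, mfderiv_const] at h1
  have h3 : mfderiv (I.prod 𝓘(ℝ, F)) I (π F E) (c 0) (verticalVector I a b) = 0 :=
    (congrArg (fun L : ℝ →L[ℝ] B => L 1) h1).symm
  rwa [← h0] at h3

theorem directionalDeriv_linearFunction_verticalVector (α : BundleForm I F E 1)
    (a : TotalSpace F E) (b : E a.proj) :
    directionalDeriv (I.prod 𝓘(ℝ, F)) (linearFunction α) a (verticalVector I a b)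
      = α.toLin a.proj b := by
  let c : ℝ → TotalSpace F E := fun t => ⟨a.proj, a.2 + t • b⟩
  have h0 : a = c 0 := by simp [c]
  have h1 := directionalDeriv_comp (φ := c) (y := (0 : ℝ))
    ((contMDiff_linearFunction α).mdifferentiable (by simp) (c 0))
    ((contMDiff_fibreLine (I := I) a b).mdifferentiable (by simp) 0) (1 : ℝ)
  have h2 : (fun t => linearFunction α (c t))
      = fun t => α.toLin a.proj a.2 + t * α.toLin a.proj b := by
    funext t
    rw [linearFunction_eq]
    change α.toLin a.proj (a.2 + t • b) = _
    rw [map_add, map_smul, smul_eq_mul]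
  have h3 : directionalDeriv 𝓘(ℝ, ℝ) (fun t => linearFunction α (c t)) 0 (1 : ℝ)
      = α.toLin a.proj b := by
    rw [h2]
    unfold directionalDeriv
    rw [mfderiv_eq_fderiv]
    have : HasDerivAt (fun t => α.toLin a.proj a.2 + t * α.toLin a.proj b)
      (α.toLin a.proj b) 0 := by
      simpa using ((hasDerivAt_id (0 : ℝ)).mul_const (α.toLin a.proj b)).const_add
        (α.toLin a.proj a.2)
    exact this.deriv
  rw [h3] at h1
  refine Eq.trans ?_ h1.symm
  change directionalDeriv (I.prod 𝓘(ℝ, F)) (linearFunction α) a (verticalVector I a b)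
    = directionalDeriv (I.prod 𝓘(ℝ, F)) (linearFunction α) (c 0) (verticalVector I a b)
  rw [← h0]

end TotalSpace

/-! ### Smooth sections of the prolongation -/

section ProlongationSections

open Filter Topology

variable {B : Type*} [NormedAddCommGroup B] [NormedSpace ℝ B]
  {H : Type*} [TopologicalSpace H] {I : ModelWithCorners ℝ B H}
  {M : Type*} [TopologicalSpace M] [ChartedSpace H M] [IsManifold I ∞ M]
  {F : Type*} [NormedAddCommGroup F] [NormedSpace ℝ F]
  {E : M → Type*} [TopologicalSpace (TotalSpace F E)]
  [∀ x, AddCommGroup (E x)] [∀ x, Module ℝ (E x)] [∀ x, TopologicalSpace (E x)]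
  [FiberBundle F E] [VectorBundle ℝ F E] [ContMDiffVectorBundle ∞ F E I] [T2Space M]
  [FiniteDimensional ℝ B] [FiniteDimensional ℝ F]
  {A : LieAlgebroid I F E}

/-- A smooth family of bilinear forms on the fibres of `E` takes smooth values on smooth sections of
the pullback of `E` to its total space. -/
theorem contMDiff_bilin_along {b c : ∀ a : TotalSpace F E, E a.proj}
    (hb : ∀ α : BundleForm I F E 1,
      ContMDiff (I.prod 𝓘(ℝ, F)) 𝓘(ℝ, ℝ) ∞ fun a => α.toLin a.proj (b a))
    (hc : ∀ α : BundleForm I F E 1,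
      ContMDiff (I.prod 𝓘(ℝ, F)) 𝓘(ℝ, ℝ) ∞ fun a => α.toLin a.proj (c a))
    {β : ∀ x, E x →ₗ[ℝ] E x →ₗ[ℝ] ℝ}
    (hβ : ∀ X Y : Cₛ^∞⟮I; F, E⟯, ContMDiff I 𝓘(ℝ, ℝ) ∞ fun x => β x (X x) (Y x)) :
    ContMDiff (I.prod 𝓘(ℝ, F)) 𝓘(ℝ, ℝ) ∞ fun a : TotalSpace F E => β a.proj (b a) (c a) := by
  intro a
  let fr := cutoffFrame I F E a.proj
  have h : (fun a : TotalSpace F E => β a.proj (b a) (c a)) =ᶠ[𝓝 a] fun q => ∑ i, ∑ j,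
      (fr.ε i).toLin q.proj (b q) * ((fr.ε j).toLin q.proj (c q)
        * β q.proj (fr.e i q.proj) (fr.e j q.proj)) := by
    filter_upwards [eventually_proj fr.eventually_χ] with q h1
    have hb := fr.sum_smul q.proj (b q)
    have hc := fr.sum_smul q.proj (c q)
    rw [h1, one_smul] at hb hc
    conv_lhs => rw [← hb, ← hc]
    simp only [map_sum, map_smul, LinearMap.sum_apply, LinearMap.smul_apply, smul_eq_mul,
      Finset.mul_sum]
    rw [Finset.sum_comm]
    refine Finset.sum_congr rfl fun i _ => Finset.sum_congr rfl fun j _ => ?_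
    ring
  refine ContMDiffAt.congr_of_eventuallyEq ?_ h
  exact contMDiffAt_finsetSum fun i _ => contMDiffAt_finsetSum fun j _ =>
    (hb _).contMDiffAt.mul ((hc _).contMDiffAt.mul (contMDiff_comp_proj (hβ _ _)).contMDiffAt)

theorem contMDiffAt_of_repr {N : Type*} {B' H' : Type*} [NormedAddCommGroup B'] [NormedSpace ℝ B']
    [TopologicalSpace H'] {I' : ModelWithCorners ℝ B' H'} [TopologicalSpace N] [ChartedSpace H' N]
    {g : N → F} {y : N}
    (h : ∀ i, ContMDiffAt I' 𝓘(ℝ, ℝ) ∞ (fun z => (Module.finBasis ℝ F).repr (g z) i) y) :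
    ContMDiffAt I' 𝓘(ℝ, F) ∞ g y := by
  have h1 : g = fun z => ∑ i, (Module.finBasis ℝ F).repr (g z) i • Module.finBasis ℝ F i :=
    funext fun z => ((Module.finBasis ℝ F).sum_repr (g z)).symm
  rw [h1]
  exact contMDiffAt_finsetSum fun i _ => (h i).smul contMDiffAt_const

/-- In the trivialization of the prolongation induced by that of `E`, the coordinates are the fibre
coordinates of both components. -/
theorem contMDiffAt_prolongation {ξ : ∀ a, A.Prolongation a} {a : TotalSpace F E}
    (h1 : ContMDiffAt (I.prod 𝓘(ℝ, F)) 𝓘(ℝ, F) ∞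
      (fun q => (trivializationAt F E a.proj ⟨q.proj, (ξ q).pr₁⟩).2) a)
    (h2 : ContMDiffAt (I.prod 𝓘(ℝ, F)) 𝓘(ℝ, F) ∞
      (fun q => fibreComponent I (trivializationAt F E a.proj) q (ξ q).pr₂) a) :
    ContMDiffAt (I.prod 𝓘(ℝ, F)) ((I.prod 𝓘(ℝ, F)).prod 𝓘(ℝ, F × F)) ∞
      (fun q => TotalSpace.mk' (F × F) q (ξ q)) a := by
  rw [contMDiffAt_section]
  exact h1.prodMk_space h2

/-- A section of the prolongation is smooth if the forms on `E` take smooth values on its first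
component and the linear functions have smooth derivatives along its second component. -/
theorem contMDiff_prolongation_of_forms {ξ : ∀ a, A.Prolongation a}
    (h1 : ∀ α : BundleForm I F E 1,
      ContMDiff (I.prod 𝓘(ℝ, F)) 𝓘(ℝ, ℝ) ∞ fun a => α.toLin a.proj (ξ a).pr₁)
    (h2 : ∀ α : BundleForm I F E 1, ContMDiff (I.prod 𝓘(ℝ, F)) 𝓘(ℝ, ℝ) ∞
      fun a => directionalDeriv (I.prod 𝓘(ℝ, F)) (linearFunction α) a (ξ a).pr₂) :
    ContMDiff (I.prod 𝓘(ℝ, F)) ((I.prod 𝓘(ℝ, F)).prod 𝓘(ℝ, F × F)) ∞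
      (fun q => TotalSpace.mk' (F × F) q (ξ q)) := by
  intro a
  let fr := cutoffFrame I F E a.proj
  refine contMDiffAt_prolongation ?_ ?_
  · refine contMDiffAt_of_repr fun i => (h1 (fr.ε i)).contMDiffAt.congr_of_eventuallyEq ?_
    filter_upwards [eventually_proj fr.eventually_ε] with q hq
    exact (hq _ i).symm
  · refine contMDiffAt_of_repr fun i => (h2 (fr.ε i)).contMDiffAt.congr_of_eventuallyEq ?_
    filter_upwards [eventually_proj (eventually_eventually_nhds.2 fr.eventually_ε),
      (trivializationAt F E a.proj).open_source.mem_nhds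
        FiberBundle.mem_trivializationAt_proj_source] with q hq hqs
    exact repr_fibreComponent hqs (hq.mono fun x hx b => hx b i) _

theorem contMDiffAt_components (p : TotalSpace (F × F) A.Prolongation) :
    ContMDiffAt ((I.prod 𝓘(ℝ, F)).prod 𝓘(ℝ, F × F)) 𝓘(ℝ, F) ∞
      (fun q : TotalSpace (F × F) A.Prolongation =>
        (trivializationAt F E p.proj.proj ⟨q.proj.proj, q.2.pr₁⟩).2) p ∧
    ContMDiffAt ((I.prod 𝓘(ℝ, F)).prod 𝓘(ℝ, F × F)) 𝓘(ℝ, F) ∞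
      (fun q : TotalSpace (F × F) A.Prolongation =>
        fibreComponent I (trivializationAt F E p.proj.proj) q.proj q.2.pr₂) p := by
  have h : ContMDiffAt ((I.prod 𝓘(ℝ, F)).prod 𝓘(ℝ, F × F)) 𝓘(ℝ, F × F) ∞
      (fun q : TotalSpace (F × F) A.Prolongation =>
        ((trivializationAt F E p.proj.proj ⟨q.proj.proj, q.2.pr₁⟩).2,
          fibreComponent I (trivializationAt F E p.proj.proj) q.proj q.2.pr₂)) p :=
    (contMDiffAt_totalSpace.1 (contMDiffAt_id (n := ∞) (x := p))).2
  exact ⟨contDiff_fst.contMDiff.contMDiffAt.comp p h, contDiff_snd.contMDiff.contMDiffAt.comp p h⟩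

theorem contMDiff_pr₁_totalSpace :
    ContMDiff ((I.prod 𝓘(ℝ, F)).prod 𝓘(ℝ, F × F)) (I.prod 𝓘(ℝ, F)) ∞
      (fun q : TotalSpace (F × F) A.Prolongation => (⟨q.proj.proj, q.2.pr₁⟩ : TotalSpace F E)) := by
  intro p
  rw [contMDiffAt_totalSpace]
  exact ⟨((contMDiff_proj E).comp (contMDiff_proj A.Prolongation)).contMDiffAt,
    (contMDiffAt_components p).1⟩

theorem contMDiff_pr₁ (ξ : A.ProlongationSection) :
    ContMDiff (I.prod 𝓘(ℝ, F)) (I.prod 𝓘(ℝ, F)) ∞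
      (fun a => (⟨a.proj, (ξ a).pr₁⟩ : TotalSpace F E)) :=
  contMDiff_pr₁_totalSpace.comp ξ.contMDiff

theorem contMDiff_toLin_pr₁ (ξ : A.ProlongationSection) (α : BundleForm I F E 1) :
    ContMDiff (I.prod 𝓘(ℝ, F)) 𝓘(ℝ, ℝ) ∞ fun a => α.toLin a.proj (ξ a).pr₁ :=
  (contMDiff_linearFunction α).comp (contMDiff_pr₁ ξ)

/-- The second projection of the prolongation to the tangent bundle is smooth: in a trivialization
`e` of `E`, it is `(b, v) ↦ T(e⁻¹)(ρ(b), T(pr_F ∘ e)(v))`. -/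
theorem contMDiff_pr₂_totalSpace :
    ContMDiff ((I.prod 𝓘(ℝ, F)).prod 𝓘(ℝ, F × F)) (I.prod 𝓘(ℝ, F)).tangent ∞
      (fun q : TotalSpace (F × F) A.Prolongation =>
        (⟨q.proj, q.2.pr₂⟩ : TangentBundle (I.prod 𝓘(ℝ, F)) (TotalSpace F E))) := by
  intro p
  set e := trivializationAt F E p.proj.proj with he
  have ha : p.proj ∈ e.source := FiberBundle.mem_trivializationAt_proj_source
  have hV : ContMDiffAt ((I.prod 𝓘(ℝ, F)).prod 𝓘(ℝ, F × F)) (I.prod 𝓘(ℝ, F)).tangent ∞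
      (fun q : TotalSpace (F × F) A.Prolongation => (⟨(q.proj.proj, (e q.proj).2),
        (A.anchor q.proj.proj q.2.pr₁, fibreComponent I e q.proj q.2.pr₂)⟩ :
          TangentBundle (I.prod 𝓘(ℝ, F)) (M × F))) p := by
    have h1 : ContMDiffAt ((I.prod 𝓘(ℝ, F)).prod 𝓘(ℝ, F × F)) 𝓘(ℝ, F).tangent ∞
        (fun q : TotalSpace (F × F) A.Prolongation =>
          (⟨(e q.proj).2, fibreComponent I e q.proj q.2.pr₂⟩ : TangentBundle 𝓘(ℝ, F) F)) p := by
      rw [contMDiffAt_totalSpace]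
      refine ⟨((contMDiffOn_snd_trivialization e).contMDiffAt (e.open_source.mem_nhds ha)).comp p
        (contMDiffAt_proj A.Prolongation), ?_⟩
      refine (contMDiffAt_components p).2.congr_of_eventuallyEq (Eventually.of_forall fun q => ?_)
      exact congrArg Prod.snd (trivializationAt_model_space_apply (I := 𝓘(ℝ, F))
        (⟨(e q.proj).2, fibreComponent I e q.proj q.2.pr₂⟩ : TangentBundle 𝓘(ℝ, F) F)
        (e p.proj).2)
    exact (contMDiff_equivTangentBundleProd_symm (n := ∞)).contMDiffAt.comp p
      ((A.contMDiff_anchor.comp contMDiff_pr₁_totalSpace).contMDiffAt.prodMk h1)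
  have hT := ((e.contMDiffOn_symm (IB := I) (n := ∞)).contMDiffOn_tangentMapWithin (m := ∞)
    (by simp) e.open_target.uniqueMDiffOn).contMDiffAt (x := (⟨(p.proj.proj, (e p.proj).2),
        (A.anchor p.proj.proj p.2.pr₁, fibreComponent I e p.proj p.2.pr₂)⟩ :
          TangentBundle (I.prod 𝓘(ℝ, F)) (M × F)))
    ((e.open_target.preimage (FiberBundle.continuous_proj _ _)).mem_nhds (by
      change (p.proj.proj, (e p.proj).2) ∈ e.target
      rw [e.mk_proj_snd ha]; exact e.map_source ha))
  refine (hT.comp p hV).congr_of_eventuallyEq ?_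
  filter_upwards [(FiberBundle.continuous_proj (F × F) A.Prolongation).continuousAt.eventually
    (e.open_source.mem_nhds ha)] with ⟨q, z⟩ hq
  replace hq : q ∈ e.source := hq
  have h1 := tangentLift_components hq z.pr₂
  rw [← z.anchor_pr₁] at h1
  have h2 : e.toOpenPartialHomeomorph.symm (e q) = q := e.toOpenPartialHomeomorph.left_inv hq
  have h3 : ∀ p : M × F, p = e q → ∀ w : B × F, tangentLift I e q w = z.pr₂ →
      (⟨q, z.pr₂⟩ : TangentBundle (I.prod 𝓘(ℝ, F)) (TotalSpace F E))
        = ⟨e.toOpenPartialHomeomorph.symm p, mfderivWithin (I.prod 𝓘(ℝ, F)) (I.prod 𝓘(ℝ, F))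
          e.toOpenPartialHomeomorph.symm e.target p w⟩ := by
    rintro p rfl w hw
    have h4 := mfderivWithin_of_isOpen (I := I.prod 𝓘(ℝ, F)) (I' := I.prod 𝓘(ℝ, F))
      (f := e.toOpenPartialHomeomorph.symm) e.open_target (e.map_source hq)
    have h5 : ∀ q' : TotalSpace F E, q' = q → ∀ v : B × F,
        (⟨q, v⟩ : TangentBundle (I.prod 𝓘(ℝ, F)) (TotalSpace F E)) = ⟨q', v⟩ := by
      rintro _ rfl v
      rfl
    refine (h5 _ h2 _).trans (congrArg (TotalSpace.mk _) ?_)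
    exact hw.symm.trans (congrArg (fun L : B × F →L[ℝ] B × F => L w) h4.symm)
  exact h3 _ (e.mk_proj_snd hq) _ h1

theorem contMDiff_pr₂ (ξ : A.ProlongationSection) :
    ContMDiff (I.prod 𝓘(ℝ, F)) (I.prod 𝓘(ℝ, F)).tangent ∞
      (fun a => (⟨a, (ξ a).pr₂⟩ : TangentBundle (I.prod 𝓘(ℝ, F)) (TotalSpace F E))) :=
  contMDiff_pr₂_totalSpace.comp ξ.contMDiff

theorem contMDiff_directionalDeriv_pr₂ (ξ : A.ProlongationSection) {g : TotalSpace F E → ℝ}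
    (hg : ContMDiff (I.prod 𝓘(ℝ, F)) 𝓘(ℝ, ℝ) ∞ g) : ContMDiff (I.prod 𝓘(ℝ, F)) 𝓘(ℝ, ℝ) ∞
      fun a => directionalDeriv (I.prod 𝓘(ℝ, F)) g a (ξ a).pr₂ :=
  contMDiff_directionalDeriv hg (contMDiff_pr₂ ξ)

end ProlongationSections

/-! ### Prolongation elements as derivations -/

section ProlongationBracket

open Filter Topology VectorField

variable {B : Type*} [NormedAddCommGroup B] [NormedSpace ℝ B]
  {H : Type*} [TopologicalSpace H] {I : ModelWithCorners ℝ B H}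
  {M : Type*} [TopologicalSpace M] [ChartedSpace H M] [IsManifold I ∞ M]
  {F : Type*} [NormedAddCommGroup F] [NormedSpace ℝ F]
  {E : M → Type*} [TopologicalSpace (TotalSpace F E)]
  [∀ x, AddCommGroup (E x)] [∀ x, Module ℝ (E x)] [∀ x, TopologicalSpace (E x)]
  [FiberBundle F E] [VectorBundle ℝ F E] [ContMDiffVectorBundle ∞ F E I] [T2Space M]
  [FiniteDimensional ℝ B] [FiniteDimensional ℝ F]
  {A : LieAlgebroid I F E}

/-- The derivative of a function on `E` along the second component of an element of the
prolongation. -/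
def Prolongation.deriv {a : TotalSpace F E} (z : A.Prolongation a) (g : TotalSpace F E → ℝ) : ℝ :=
  directionalDeriv (I.prod 𝓘(ℝ, F)) g a z.pr₂

namespace Prolongation

variable {a : TotalSpace F E}

@[simp] theorem pr₁_add (z w : A.Prolongation a) : (z + w).pr₁ = z.pr₁ + w.pr₁ := rfl

@[simp] theorem pr₁_smul (r : ℝ) (z : A.Prolongation a) : (r • z).pr₁ = r • z.pr₁ := rfl

@[simp] theorem pr₁_neg (z : A.Prolongation a) : (-z).pr₁ = -z.pr₁ := rfl

@[simp] theorem pr₁_zero : (0 : A.Prolongation a).pr₁ = 0 := rfl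

@[simp] theorem deriv_add (z w : A.Prolongation a) (g : TotalSpace F E → ℝ) :
    (z + w).deriv g = z.deriv g + w.deriv g :=
  directionalDeriv_add_vector g a _ _

@[simp] theorem deriv_smul (r : ℝ) (z : A.Prolongation a) (g : TotalSpace F E → ℝ) :
    (r • z).deriv g = r * z.deriv g :=
  directionalDeriv_smul_vector g a _ _

@[simp] theorem deriv_neg (z : A.Prolongation a) (g : TotalSpace F E → ℝ) :
    (-z).deriv g = - z.deriv g := by
  rw [← neg_one_smul ℝ, deriv_smul, neg_one_mul]

@[simp] theorem deriv_zero (g : TotalSpace F E → ℝ) : (0 : A.Prolongation a).deriv g = 0 :=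
  directionalDeriv_zero_vector g a

theorem deriv_fun_add (z : A.Prolongation a) {f g : TotalSpace F E → ℝ}
    (hf : ContMDiff (I.prod 𝓘(ℝ, F)) 𝓘(ℝ, ℝ) ∞ f) (hg : ContMDiff (I.prod 𝓘(ℝ, F)) 𝓘(ℝ, ℝ) ∞ g) :
    z.deriv (fun q => f q + g q) = z.deriv f + z.deriv g :=
  directionalDeriv_add hf hg a _

theorem deriv_fun_mul (z : A.Prolongation a) {f g : TotalSpace F E → ℝ}
    (hf : ContMDiff (I.prod 𝓘(ℝ, F)) 𝓘(ℝ, ℝ) ∞ f) (hg : ContMDiff (I.prod 𝓘(ℝ, F)) 𝓘(ℝ, ℝ) ∞ g) :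
    z.deriv (fun q => f q * g q) = f a * z.deriv g + z.deriv f * g a :=
  directionalDeriv_mul hf hg a _

theorem deriv_fun_sum_mul {ι : Type*} (s : Finset ι) (z : A.Prolongation a)
    {f g : ι → TotalSpace F E → ℝ} (hf : ∀ i, ContMDiff (I.prod 𝓘(ℝ, F)) 𝓘(ℝ, ℝ) ∞ (f i))
    (hg : ∀ i, ContMDiff (I.prod 𝓘(ℝ, F)) 𝓘(ℝ, ℝ) ∞ (g i)) :
    z.deriv (fun q => ∑ i ∈ s, f i q * g i q)
      = ∑ i ∈ s, (f i a * z.deriv (g i) + z.deriv (f i) * g i a) :=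
  directionalDeriv_sum_mul s hf hg a _

theorem deriv_comp_proj (z : A.Prolongation a) {f : M → ℝ} (hf : ContMDiff I 𝓘(ℝ, ℝ) ∞ f) :
    z.deriv (fun q => f q.proj) = A.anchorDeriv f a.proj z.pr₁ := by
  refine (directionalDeriv_comp_proj hf a z.pr₂).trans ?_
  rw [← z.anchor_pr₁]
  rfl

/-- Elements of the prolongation are separated by the forms on `E`, evaluated on the first
component, and the linear functions, differentiated along the second one. -/
theorem ext_forms {z w : A.Prolongation a}
    (h1 : ∀ α : BundleForm I F E 1, α.toLin a.proj z.pr₁ = α.toLin a.proj w.pr₁)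
    (h2 : ∀ α : BundleForm I F E 1, z.deriv (linearFunction α) = w.deriv (linearFunction α)) :
    z = w := by
  have h := vector_ext h1
  exact Prolongation.ext h (tangent_ext (by rw [← z.anchor_pr₁, ← w.anchor_pr₁, h]) h2)

theorem contMDiff_deriv (ξ : A.ProlongationSection) {g : TotalSpace F E → ℝ}
    (hg : ContMDiff (I.prod 𝓘(ℝ, F)) 𝓘(ℝ, ℝ) ∞ g) :
    ContMDiff (I.prod 𝓘(ℝ, F)) 𝓘(ℝ, ℝ) ∞ fun q => (ξ q).deriv g :=
  contMDiff_directionalDeriv_pr₂ ξ hg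

end Prolongation

/-- A section of the prolongation from compatible families of vectors of `E` and tangent vectors of its
total space which are smooth in the sense of forms and linear functions. -/
theorem exists_prolongation_of_forms {b : ∀ a : TotalSpace F E, E a.proj}
    {V : ∀ a : TotalSpace F E, TangentSpace (I.prod 𝓘(ℝ, F)) a}
    (h : ∀ a, A.anchor a.proj (b a) = mfderiv (I.prod 𝓘(ℝ, F)) I (π F E) a (V a))
    (h1 : ∀ α : BundleForm I F E 1,
      ContMDiff (I.prod 𝓘(ℝ, F)) 𝓘(ℝ, ℝ) ∞ fun a => α.toLin a.proj (b a))
    (h2 : ∀ α : BundleForm I F E 1, ContMDiff (I.prod 𝓘(ℝ, F)) 𝓘(ℝ, ℝ) ∞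
      fun a => directionalDeriv (I.prod 𝓘(ℝ, F)) (linearFunction α) a (V a)) :
    ∃ ξ : A.ProlongationSection, ∀ a, (ξ a).pr₁ = b a ∧ (ξ a).pr₂ = V a :=
  ⟨⟨fun a => ⟨(b a, V a), h a⟩, contMDiff_prolongation_of_forms h1 h2⟩, fun _ => ⟨rfl, rfl⟩⟩

/-! ### The bracket of the prolongation -/

variable (A) in
/-- The value at `α ∈ Γ(E*)` of the first component of the bracket, from the condition that the
projection of the prolongation to `E` is compatible with the differentials. -/
def bracketFunctional (ξ η : A.ProlongationSection) (a : TotalSpace F E)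
    (α : BundleForm I F E 1) : ℝ :=
  (ξ a).deriv (fun q => α.toLin q.proj (η q).pr₁) - (η a).deriv (fun q => α.toLin q.proj (ξ q).pr₁)
    - A.dForm α a.proj (ξ a).pr₁ (η a).pr₁

theorem isFibreDerivation_bracketFunctional (ξ η : A.ProlongationSection) (a : TotalSpace F E) :
    IsFibreDerivation a 0 (A.bracketFunctional ξ η a) := by
  have key : ∀ (ξ η : A.ProlongationSection) (n : ℕ) (f : Fin n → C^∞⟮I, M; ℝ⟯)
      (α : Fin n → BundleForm I F E 1) (β : BundleForm I F E 1),
      (∀ x b, β.toLin x b = ∑ i, f i x * (α i).toLin x b) →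
      (ξ a).deriv (fun q => β.toLin q.proj (η q).pr₁)
        = ∑ i, (f i a.proj * (ξ a).deriv (fun q => (α i).toLin q.proj (η q).pr₁)
          + A.anchorDeriv (f i) a.proj (ξ a).pr₁ * (α i).toLin a.proj (η a).pr₁) := by
    intro ξ η n f α β h
    simp only [h]
    rw [Prolongation.deriv_fun_sum_mul (f := fun i (q : TotalSpace F E) => f i q.proj) _ (ξ a)
      (fun i => contMDiff_comp_proj (f i).contMDiff) (fun i => contMDiff_toLin_pr₁ η (α i))]
    refine Finset.sum_congr rfl fun i _ => ?_
    rw [(ξ a).deriv_comp_proj (f i).contMDiff]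
  intro n f α β h
  unfold bracketFunctional
  rw [key ξ η n f α β h, key η ξ n f α β h, A.dForm_sum h, ← Finset.sum_sub_distrib,
    ← Finset.sum_sub_distrib]
  refine Finset.sum_congr rfl fun i _ => ?_
  rw [directionalDeriv_zero_vector]
  ring

theorem directionalDeriv_mlieBracket_pr₂ (ξ η : A.ProlongationSection) {g : TotalSpace F E → ℝ}
    (hg : ContMDiff (I.prod 𝓘(ℝ, F)) 𝓘(ℝ, ℝ) ∞ g) (a : TotalSpace F E) :
    directionalDeriv (I.prod 𝓘(ℝ, F)) g a
      (mlieBracket (I.prod 𝓘(ℝ, F)) (fun b => (ξ b).pr₂) (fun b => (η b).pr₂) a)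
      = (ξ a).deriv (fun q => (η q).deriv g) - (η a).deriv (fun q => (ξ q).deriv g) :=
  have : T2Space (TotalSpace F E) := t2Space_totalSpace
  directionalDeriv_mlieBracket hg (contMDiff_pr₂ ξ) (contMDiff_pr₂ η) a

/-- The first component of the bracket exists because `bracketFunctional` is linear over the functions.
It is compatible with the second component because the functional of `df` is the commutator of the
derivations `ξ` and `η` on `f ∘ τ`, as `d(df) = 0`. -/
theorem exists_bracket (ξ η : A.ProlongationSection) : ∃ ζ : A.ProlongationSection, ∀ a,
    (∀ α : BundleForm I F E 1, α.toLin a.proj (ζ a).pr₁ = A.bracketFunctional ξ η a α) ∧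
      (ζ a).pr₂ = mlieBracket (I.prod 𝓘(ℝ, F)) (fun b => (ξ b).pr₂) (fun b => (η b).pr₂) a := by
  choose b hb using fun a => (isFibreDerivation_bracketFunctional ξ η a).exists_vector
  suffices h : ∃ ζ : A.ProlongationSection, ∀ a, (ζ a).pr₁ = b a ∧ (ζ a).pr₂
      = mlieBracket (I.prod 𝓘(ℝ, F)) (fun b => (ξ b).pr₂) (fun b => (η b).pr₂) a by
    obtain ⟨ζ, hζ⟩ := h
    exact ⟨ζ, fun a => ⟨fun α => by rw [(hζ a).1, hb], (hζ a).2⟩⟩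
  refine exists_prolongation_of_forms ?_ ?_ ?_
  · intro a
    refine tangent_ext_base fun f => ?_
    rw [← directionalDeriv_comp_proj f.contMDiff,
      directionalDeriv_mlieBracket_pr₂ ξ η (contMDiff_comp_proj f.contMDiff)]
    refine (hb a (A.dFun f)).trans ?_
    unfold bracketFunctional
    rw [A.dForm_dFun, sub_zero]
    simp only [toLin_dFun, Prolongation.deriv_comp_proj _ f.contMDiff]
  · intro α
    simp only [hb]
    exact ((Prolongation.contMDiff_deriv ξ (contMDiff_toLin_pr₁ η α)).sub
      (Prolongation.contMDiff_deriv η (contMDiff_toLin_pr₁ ξ α))).sub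
      (contMDiff_bilin_along (contMDiff_toLin_pr₁ ξ) (contMDiff_toLin_pr₁ η) (A.contMDiff_dForm α))
  · intro α
    simp only [directionalDeriv_mlieBracket_pr₂ ξ η (contMDiff_linearFunction α)]
    exact (Prolongation.contMDiff_deriv ξ
        (Prolongation.contMDiff_deriv η (contMDiff_linearFunction α))).sub
      (Prolongation.contMDiff_deriv η
        (Prolongation.contMDiff_deriv ξ (contMDiff_linearFunction α)))

/-- The bracket of sections of the prolongation: its second component is the Lie bracket of the vector
fields, its first one is defined by duality through `bracketFunctional`. -/
def prolongationBracket (ξ η : A.ProlongationSection) : A.ProlongationSection :=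
  (exists_bracket ξ η).choose

theorem toLin_prolongationBracket (ξ η : A.ProlongationSection) (a : TotalSpace F E)
    (α : BundleForm I F E 1) : α.toLin a.proj (prolongationBracket ξ η a).pr₁
      = (ξ a).deriv (fun q => α.toLin q.proj (η q).pr₁)
        - (η a).deriv (fun q => α.toLin q.proj (ξ q).pr₁)
        - A.dForm α a.proj (ξ a).pr₁ (η a).pr₁ :=
  ((exists_bracket ξ η).choose_spec a).1 α

theorem pr₂_prolongationBracket (ξ η : A.ProlongationSection) (a : TotalSpace F E) :
    (prolongationBracket ξ η a).pr₂
      = mlieBracket (I.prod 𝓘(ℝ, F)) (fun b => (ξ b).pr₂) (fun b => (η b).pr₂) a :=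
  ((exists_bracket ξ η).choose_spec a).2

theorem deriv_prolongationBracket (ξ η : A.ProlongationSection) (a : TotalSpace F E)
    {g : TotalSpace F E → ℝ} (hg : ContMDiff (I.prod 𝓘(ℝ, F)) 𝓘(ℝ, ℝ) ∞ g) :
    (prolongationBracket ξ η a).deriv g
      = (ξ a).deriv (fun q => (η q).deriv g) - (η a).deriv (fun q => (ξ q).deriv g) := by
  rw [Prolongation.deriv, pr₂_prolongationBracket, directionalDeriv_mlieBracket_pr₂ ξ η hg]

theorem prolongationBracket_add_right (ξ η ζ : A.ProlongationSection) :
    prolongationBracket ξ (η + ζ) = prolongationBracket ξ η + prolongationBracket ξ ζ := by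
  refine ContMDiffSection.ext fun a => ?_
  refine Prolongation.ext_forms (A := A) (fun α => ?_) fun α => ?_
  · simp only [ContMDiffSection.coe_add, Pi.add_apply, Prolongation.pr₁_add, map_add,
      toLin_prolongationBracket, Prolongation.deriv_add]
    rw [Prolongation.deriv_fun_add _ (contMDiff_toLin_pr₁ η α) (contMDiff_toLin_pr₁ ζ α)]
    ring
  · simp only [ContMDiffSection.coe_add, Pi.add_apply, Prolongation.deriv_add,
      deriv_prolongationBracket _ _ a (contMDiff_linearFunction α)]
    rw [Prolongation.deriv_fun_add _ (Prolongation.contMDiff_deriv η (contMDiff_linearFunction α))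
      (Prolongation.contMDiff_deriv ζ (contMDiff_linearFunction α))]
    ring

theorem prolongationBracket_skew (ξ η : A.ProlongationSection) :
    prolongationBracket ξ η = - prolongationBracket η ξ := by
  refine ContMDiffSection.ext fun a => ?_
  refine Prolongation.ext_forms (A := A) (fun α => ?_) fun α => ?_
  · simp only [ContMDiffSection.coe_neg, Pi.neg_apply, Prolongation.pr₁_neg, map_neg,
      toLin_prolongationBracket, A.dForm_swap α _ (ξ a).pr₁]
    ring
  · simp only [ContMDiffSection.coe_neg, Pi.neg_apply, Prolongation.deriv_neg,
      deriv_prolongationBracket _ _ a (contMDiff_linearFunction α)]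
    ring

theorem prolongationBracket_funSmul (ξ : A.ProlongationSection)
    (f : C^∞⟮I.prod 𝓘(ℝ, F), TotalSpace F E; ℝ⟯) (η : A.ProlongationSection) :
    prolongationBracket ξ (funSmul f η) = funSmul f (prolongationBracket ξ η)
      + funSmul ⟨_, Prolongation.contMDiff_deriv ξ f.contMDiff⟩ η := by
  refine ContMDiffSection.ext fun a => ?_
  refine Prolongation.ext_forms (A := A) (fun α => ?_) fun α => ?_
  · simp only [ContMDiffSection.coe_add, Pi.add_apply, Prolongation.pr₁_add, map_add,
      toLin_prolongationBracket, Prolongation.deriv_smul, funSmul_apply, Prolongation.pr₁_smul,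
      map_smul, smul_eq_mul]
    rw [Prolongation.deriv_fun_mul _ f.contMDiff (contMDiff_toLin_pr₁ η α)]
    change _ = _ + α.toLin a.proj ((ξ a).deriv f • (η a).pr₁)
    rw [map_smul, smul_eq_mul]
    ring
  · simp only [ContMDiffSection.coe_add, Pi.add_apply, Prolongation.deriv_add, funSmul_apply,
      Prolongation.deriv_smul, deriv_prolongationBracket _ _ a (contMDiff_linearFunction α)]
    rw [Prolongation.deriv_fun_mul _ f.contMDiff
      (Prolongation.contMDiff_deriv η (contMDiff_linearFunction α))]
    change _ = _ + ((ξ a).deriv f • η a).deriv (linearFunction α)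
    rw [Prolongation.deriv_smul]
    ring

end ProlongationBracket

/-! ### Vertical and complete lifts of sections -/

section Lifts

open Filter Topology VectorField

variable {B : Type*} [NormedAddCommGroup B] [NormedSpace ℝ B]
  {H : Type*} [TopologicalSpace H] {I : ModelWithCorners ℝ B H}
  {M : Type*} [TopologicalSpace M] [ChartedSpace H M] [IsManifold I ∞ M]
  {F : Type*} [NormedAddCommGroup F] [NormedSpace ℝ F]
  {E : M → Type*} [TopologicalSpace (TotalSpace F E)]
  [∀ x, AddCommGroup (E x)] [∀ x, Module ℝ (E x)] [∀ x, TopologicalSpace (E x)]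
  [FiberBundle F E] [VectorBundle ℝ F E] [ContMDiffVectorBundle ∞ F E I] [T2Space M]
  [FiniteDimensional ℝ B] [FiniteDimensional ℝ F]
  (A : LieAlgebroid I F E)

/-- The Lie derivative `𝓛_X α` as a section of `E*`. -/
def lieForm (X : Cₛ^∞⟮I; F, E⟯) (α : BundleForm I F E 1) : BundleForm I F E 1 :=
  BundleForm.ofLin (fun x => A.dForm α x (X x) + (A.dFun ⟨_, α.contMDiff_toLin X⟩).toLin x)
    fun Y => (A.contMDiff_dForm α X Y).add (BundleForm.contMDiff_toLin _ Y)

theorem toLin_lieForm (X : Cₛ^∞⟮I; F, E⟯) (α : BundleForm I F E 1) (x : M) (b : E x) :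
    (A.lieForm X α).toLin x b
      = A.dForm α x (X x) b + A.anchorDeriv (fun y => α.toLin y (X y)) x b := rfl

theorem toLin_lieForm_section (X : Cₛ^∞⟮I; F, E⟯) (α : BundleForm I F E 1)
    (Y : Cₛ^∞⟮I; F, E⟯) (x : M) :
    (A.lieForm X α).toLin x (Y x)
      = A.anchorDeriv (fun y => α.toLin y (Y y)) x (X x) - α.toLin x (A.bracket X Y x) := by
  rw [toLin_lieForm, dForm_apply]
  ring

theorem lieDerivOneForm_eq (X : Cₛ^∞⟮I; F, E⟯) (α : BundleForm I F E 1)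
    (Y : Cₛ^∞⟮I; F, E⟯) (x : M) :
    A.lieDerivOneForm X α Y x = (A.lieForm X α).toLin x (Y x) := by
  rw [lieDerivOneForm, differential_one_eq_dForm, toLin_lieForm]
  exact congrArg (fun f => _ + A.anchorDeriv f x (Y x)) (funext fun y => α.eval_one ![X] y)

/-- `α ↦ 𝓛_X α` is a derivation over `ρ(X)`, and so it defines a vector field on `E`. -/
theorem isFibreDerivation_lieForm (X : Cₛ^∞⟮I; F, E⟯) (a : TotalSpace F E) :
    IsFibreDerivation a (A.anchor a.proj (X a.proj))
      (fun α => linearFunction (A.lieForm X α) a) := by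
  intro n f α β h
  simp only [linearFunction_eq, toLin_lieForm, h]
  rw [A.dForm_sum h, A.anchorDeriv_sum_mul _ (fun i => (f i).contMDiff)
    (fun i => (α i).contMDiff_toLin X), ← Finset.sum_add_distrib]
  refine Finset.sum_congr rfl fun i _ => ?_
  change _ = _ + A.anchorDeriv (f i) a.proj (X a.proj) * _
  ring

theorem exists_completeLift (X : Cₛ^∞⟮I; F, E⟯) : ∃ ξ : A.ProlongationSection, ∀ a,
    (ξ a).pr₁ = X a.proj ∧
      ∀ α, (ξ a).deriv (linearFunction α) = linearFunction (A.lieForm X α) a := by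
  choose V hV using fun a => (A.isFibreDerivation_lieForm X a).exists_tangent
  obtain ⟨ξ, hξ⟩ : ∃ ξ : A.ProlongationSection, ∀ a, (ξ a).pr₁ = X a.proj ∧ (ξ a).pr₂ = V a := by
    refine exists_prolongation_of_forms (fun a => (hV a).1.symm)
      (fun α => contMDiff_comp_proj (α.contMDiff_toLin X)) fun α => ?_
    simp only [(hV _).2]
    exact contMDiff_linearFunction _
  refine ⟨ξ, fun a => ⟨(hξ a).1, fun α => ?_⟩⟩
  rw [Prolongation.deriv, (hξ a).2, (hV a).2]

/-- The complete lift of a section of `E` to the prolongation. -/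
def completeLift (X : Cₛ^∞⟮I; F, E⟯) : A.ProlongationSection := (A.exists_completeLift X).choose

@[simp]
theorem pr₁_completeLift (X : Cₛ^∞⟮I; F, E⟯) (a : TotalSpace F E) :
    (A.completeLift X a).pr₁ = X a.proj := ((A.exists_completeLift X).choose_spec a).1

@[simp]
theorem deriv_completeLift (X : Cₛ^∞⟮I; F, E⟯) (a : TotalSpace F E) (α : BundleForm I F E 1) :
    (A.completeLift X a).deriv (linearFunction α) = linearFunction (A.lieForm X α) a :=
  ((A.exists_completeLift X).choose_spec a).2 α

theorem exists_verticalLift (X : Cₛ^∞⟮I; F, E⟯) :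
    ∃ ξ : A.ProlongationSection, A.IsVerticalLift X ξ := by
  refine exists_prolongation_of_forms (b := fun _ => 0)
    (V := fun a => verticalVector I a (X a.proj)) (fun a => ?_) (fun α => ?_) fun α => ?_
  · rw [map_zero, mfderiv_proj_verticalVector]
  · simp only [map_zero]
    exact contMDiff_const
  · simp only [directionalDeriv_linearFunction_verticalVector]
    exact contMDiff_comp_proj (α.contMDiff_toLin X)

/-- The vertical lift of a section of `E` to the prolongation. -/
def verticalLift (X : Cₛ^∞⟮I; F, E⟯) : A.ProlongationSection := (A.exists_verticalLift X).choose

theorem isVerticalLift_verticalLift (X : Cₛ^∞⟮I; F, E⟯) : A.IsVerticalLift X (A.verticalLift X) :=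
  (A.exists_verticalLift X).choose_spec

@[simp]
theorem pr₁_verticalLift (X : Cₛ^∞⟮I; F, E⟯) (a : TotalSpace F E) :
    (A.verticalLift X a).pr₁ = 0 := (A.isVerticalLift_verticalLift X a).1

@[simp]
theorem deriv_verticalLift (X : Cₛ^∞⟮I; F, E⟯) (a : TotalSpace F E) (α : BundleForm I F E 1) :
    (A.verticalLift X a).deriv (linearFunction α) = α.toLin a.proj (X a.proj) := by
  rw [Prolongation.deriv, (A.isVerticalLift_verticalLift X a).2,
    directionalDeriv_linearFunction_verticalVector]

theorem isVerticalLift_iff {X : Cₛ^∞⟮I; F, E⟯} {ξ : A.ProlongationSection} :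
    A.IsVerticalLift X ξ ↔ ξ = A.verticalLift X := by
  constructor
  · intro h
    refine ContMDiffSection.ext fun a => Prolongation.ext ?_ ?_
    · rw [(h a).1, pr₁_verticalLift]
    · rw [(h a).2, (A.isVerticalLift_verticalLift X a).2]
  · rintro rfl
    exact A.isVerticalLift_verticalLift X

theorem isCompleteLift_iff {X : Cₛ^∞⟮I; F, E⟯} {ξ : A.ProlongationSection} :
    A.IsCompleteLift X ξ ↔ ξ = A.completeLift X := by
  constructor
  · rintro ⟨h1, -, h3⟩
    refine ContMDiffSection.ext fun a => Prolongation.ext_forms (A := A) (fun α => ?_) fun α => ?_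
    · rw [h1, pr₁_completeLift]
    · obtain ⟨x, b⟩ := a
      obtain ⟨Y, rfl⟩ : ∃ Y : Cₛ^∞⟮I; F, E⟯, Y x = b := ⟨sectionThrough I F E x b, by simp⟩
      rw [deriv_completeLift]
      exact (h3 α Y x).trans (A.lieDerivOneForm_eq X α Y x)
  · rintro rfl
    refine ⟨A.pr₁_completeLift X, fun a => ?_, fun α Y x => ?_⟩
    · rw [← Prolongation.anchor_pr₁, pr₁_completeLift]
    · rw [lieDerivOneForm_eq]
      exact A.deriv_completeLift X ⟨x, Y x⟩ α

/-- The sum `Xᶜ + Yᵛ` of a complete and a vertical lift. -/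
def lift (X Y : Cₛ^∞⟮I; F, E⟯) : A.ProlongationSection := A.completeLift X + A.verticalLift Y

@[simp]
theorem pr₁_lift (X Y : Cₛ^∞⟮I; F, E⟯) (a : TotalSpace F E) :
    (A.lift X Y a).pr₁ = X a.proj := by
  change (A.completeLift X a + A.verticalLift Y a).pr₁ = _
  rw [Prolongation.pr₁_add, pr₁_completeLift, pr₁_verticalLift, add_zero]

@[simp]
theorem deriv_lift (X Y : Cₛ^∞⟮I; F, E⟯) (a : TotalSpace F E) (α : BundleForm I F E 1) :
    (A.lift X Y a).deriv (linearFunction α)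
      = linearFunction (A.lieForm X α) a + α.toLin a.proj (Y a.proj) := by
  change (A.completeLift X a + A.verticalLift Y a).deriv _ = _
  rw [Prolongation.deriv_add, deriv_completeLift, deriv_verticalLift]

theorem deriv_lift_comp_proj (X Y : Cₛ^∞⟮I; F, E⟯) (a : TotalSpace F E) {f : M → ℝ}
    (hf : ContMDiff I 𝓘(ℝ, ℝ) ∞ f) :
    (A.lift X Y a).deriv (fun q => f q.proj) = A.anchorDeriv f a.proj (X a.proj) := by
  rw [Prolongation.deriv_comp_proj _ hf, pr₁_lift]

/-- A section of the prolongation is recognized as a lift by its action on forms and linear functions. -/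
theorem eq_lift {ξ : A.ProlongationSection} {X Y : Cₛ^∞⟮I; F, E⟯}
    (h1 : ∀ a, (ξ a).pr₁ = X a.proj)
    (h2 : ∀ a (α : BundleForm I F E 1), (ξ a).deriv (linearFunction α)
      = linearFunction (A.lieForm X α) a + α.toLin a.proj (Y a.proj)) : ξ = A.lift X Y := by
  refine ContMDiffSection.ext fun a => Prolongation.ext_forms (A := A) (fun α => ?_) fun α => ?_
  · rw [h1, pr₁_lift]
  · rw [h2, deriv_lift]

theorem completeLift_eq_lift (X : Cₛ^∞⟮I; F, E⟯) : A.completeLift X = A.lift X 0 :=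
  A.eq_lift (A.pr₁_completeLift X) fun a α => by
    rw [deriv_completeLift, ContMDiffSection.coe_zero, Pi.zero_apply, map_zero, add_zero]

theorem verticalLift_eq_lift (X : Cₛ^∞⟮I; F, E⟯) : A.verticalLift X = A.lift 0 X :=
  A.eq_lift (A.pr₁_verticalLift X) fun a α => by
    rw [deriv_verticalLift, linearFunction_eq, toLin_lieForm]
    simp [anchorDeriv_const]

/-- An element `z` of the prolongation at `a` and the value at `a` of the complete lift of a section
through `z.pr₁` differ by a vertical vector. -/
theorem exists_lift_sectionThrough_eq {a : TotalSpace F E} (z : A.Prolongation a) :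
    ∃ Y : Cₛ^∞⟮I; F, E⟯, A.lift (sectionThrough I F E a.proj z.pr₁) Y a = z := by
  let X := sectionThrough I F E a.proj z.pr₁
  have hX : X a.proj = z.pr₁ := sectionThrough_self _ _
  have h : IsFibreDerivation a 0
      (fun α => z.deriv (linearFunction α) - linearFunction (A.lieForm X α) a) := by
    intro n f α β h
    have h1 := isFibreDerivation_linearFunction z.pr₂ n f α β h
    have h2 := A.isFibreDerivation_lieForm X a n f α β h
    rw [hX, z.anchor_pr₁] at h2
    refine (congrArg₂ (· - ·) h1 h2).trans ?_
    rw [← Finset.sum_sub_distrib]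
    refine Finset.sum_congr rfl fun i _ => ?_
    rw [directionalDeriv_zero_vector]
    simp only [Prolongation.deriv]
    ring
  obtain ⟨b, hb⟩ := h.exists_vector
  refine ⟨sectionThrough I F E a.proj b, Prolongation.ext_forms (A := A) (fun α => ?_) fun α => ?_⟩
  · rw [pr₁_lift, hX]
  · rw [deriv_lift, sectionThrough_self, hb]
    ring

/-- The lifts span every fibre of the prolongation. -/
theorem exists_lift_eq {a : TotalSpace F E} (z : A.Prolongation a) :
    ∃ X Y : Cₛ^∞⟮I; F, E⟯, A.lift X Y a = z :=
  ⟨_, A.exists_lift_sectionThrough_eq z⟩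

theorem toLin_lieForm_add (X X' : Cₛ^∞⟮I; F, E⟯) (α : BundleForm I F E 1) (x : M) (b : E x) :
    (A.lieForm (X + X') α).toLin x b = (A.lieForm X α).toLin x b + (A.lieForm X' α).toLin x b := by
  obtain ⟨Z, rfl⟩ : ∃ Z : Cₛ^∞⟮I; F, E⟯, Z x = b := ⟨sectionThrough I F E x b, by simp⟩
  simp only [toLin_lieForm_section, A.bracket_add_left, ContMDiffSection.coe_add, Pi.add_apply,
    map_add, A.anchorDeriv_add_vector]
  ring

theorem lift_add (X Y X' Y' : Cₛ^∞⟮I; F, E⟯) :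
    A.lift X Y + A.lift X' Y' = A.lift (X + X') (Y + Y') := by
  refine A.eq_lift (fun a => ?_) fun a α => ?_
  · change (A.lift X Y a + A.lift X' Y' a).pr₁ = _
    rw [Prolongation.pr₁_add, pr₁_lift, pr₁_lift]
    rfl
  · change (A.lift X Y a + A.lift X' Y' a).deriv _ = _
    rw [Prolongation.deriv_add, deriv_lift, deriv_lift, linearFunction_eq, linearFunction_eq,
      linearFunction_eq, toLin_lieForm_add, ContMDiffSection.coe_add, Pi.add_apply, map_add]
    ring

theorem lift_zero : A.lift 0 0 = 0 := by
  have h := A.lift_add 0 0 0 0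
  rwa [add_zero, add_eq_left] at h

/-- `[𝓛_X, 𝓛_X'] = 𝓛_⟦X, X'⟧`, from the Jacobi identity. -/
theorem lieForm_commutator (X X' : Cₛ^∞⟮I; F, E⟯) (α : BundleForm I F E 1) (x : M) (b : E x) :
    (A.lieForm X (A.lieForm X' α)).toLin x b - (A.lieForm X' (A.lieForm X α)).toLin x b
      = (A.lieForm (A.bracket X X') α).toLin x b := by
  obtain ⟨Z, rfl⟩ : ∃ Z : Cₛ^∞⟮I; F, E⟯, Z x = b := ⟨sectionThrough I F E x b, by simp⟩
  have h1 := congrArg (fun W => α.toLin x (W x)) (A.jacobi X X' Z)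
  have h2 : A.bracket X' (A.bracket Z X) x = - A.bracket X' (A.bracket X Z) x := by
    rw [A.bracket_skew Z X, ← neg_one_smul ℝ, A.bracket_smul_right]
    simp
  simp only [ContMDiffSection.coe_add, Pi.add_apply, map_add, ContMDiffSection.coe_zero,
    Pi.zero_apply, map_zero, h2, map_neg, A.bracket_skew_apply Z] at h1
  simp only [toLin_lieForm_section]
  rw [A.anchorDeriv_sub (A.contMDiff_anchorDeriv (α.contMDiff_toLin Z) X') (α.contMDiff_toLin _),
    A.anchorDeriv_sub (A.contMDiff_anchorDeriv (α.contMDiff_toLin Z) X) (α.contMDiff_toLin _),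
    A.anchorDeriv_bracket (α.contMDiff_toLin Z)]
  linarith

/-- The bracket of lifts: `⟦Xᶜ, X'ᶜ⟧ = ⟦X, X'⟧ᶜ`, `⟦Xᶜ, Y'ᵛ⟧ = ⟦X, Y'⟧ᵛ` and `⟦Yᵛ, Y'ᵛ⟧ = 0`. -/
theorem prolongationBracket_lift (X Y X' Y' : Cₛ^∞⟮I; F, E⟯) :
    prolongationBracket (A.lift X Y) (A.lift X' Y')
      = A.lift (A.bracket X X') (A.bracket X Y' - A.bracket X' Y) := by
  refine A.eq_lift (fun a => vector_ext (I := I) (F := F) fun α => ?_) fun a α => ?_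
  · rw [toLin_prolongationBracket]
    simp only [pr₁_lift]
    rw [A.deriv_lift_comp_proj X Y a (α.contMDiff_toLin X'),
      A.deriv_lift_comp_proj X' Y' a (α.contMDiff_toLin X), dForm_apply]
    ring
  · rw [deriv_prolongationBracket _ _ a (contMDiff_linearFunction α)]
    simp only [deriv_lift]
    rw [Prolongation.deriv_fun_add _ (contMDiff_linearFunction _)
        (contMDiff_comp_proj (α.contMDiff_toLin Y')),
      Prolongation.deriv_fun_add _ (contMDiff_linearFunction _)
        (contMDiff_comp_proj (α.contMDiff_toLin Y)), deriv_lift, deriv_lift,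
      A.deriv_lift_comp_proj X Y a (α.contMDiff_toLin Y'),
      A.deriv_lift_comp_proj X' Y' a (α.contMDiff_toLin Y), toLin_lieForm_section,
      toLin_lieForm_section, linearFunction_eq, linearFunction_eq, linearFunction_eq,
      ← lieForm_commutator]
    simp only [ContMDiffSection.coe_sub, Pi.sub_apply, map_sub]
    ring

/-! ### The Lie algebroid structure of the prolongation -/

theorem prolongationBracket_add_left (ξ η ζ : A.ProlongationSection) :
    prolongationBracket (ξ + η) ζ = prolongationBracket ξ ζ + prolongationBracket η ζ := by
  rw [prolongationBracket_skew, prolongationBracket_add_right, prolongationBracket_skew ζ ξ,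
    prolongationBracket_skew ζ η]
  abel

/-- The Jacobiator of the bracket of the prolongation, at a point. -/
def jacobiator (ξ η ζ : A.ProlongationSection) (a : TotalSpace F E) : A.Prolongation a :=
  prolongationBracket ξ (prolongationBracket η ζ) a
    + prolongationBracket η (prolongationBracket ζ ξ) a
    + prolongationBracket ζ (prolongationBracket ξ η) a

theorem jacobiator_cyclic (ξ η ζ : A.ProlongationSection) (a : TotalSpace F E) :
    A.jacobiator ξ η ζ a = A.jacobiator η ζ ξ a := by
  unfold jacobiator
  abel

/-- The Jacobiator is tensorial, as the second projection is a homomorphism of brackets. -/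
theorem jacobiator_congr {ξ η ζ ζ' : A.ProlongationSection} {a : TotalSpace F E}
    (h : ζ a = ζ' a) : A.jacobiator ξ η ζ a = A.jacobiator ξ η ζ' a := by
  have : T2Space (TotalSpace F E) := t2Space_totalSpace
  refine tensorial_congr (T := fun ζ => A.jacobiator ξ η ζ a) (fun ζ ζ' => ?_) (fun f ζ => ?_) h
  · simp only [jacobiator, prolongationBracket_add_right, prolongationBracket_add_left,
      ContMDiffSection.coe_add, Pi.add_apply]
    abel
  · have h1 := jacobiator_funSmul prolongationBracket
      (fun ξ f => ⟨_, Prolongation.contMDiff_deriv ξ f.contMDiff⟩)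
      prolongationBracket_add_right prolongationBracket_skew prolongationBracket_funSmul
      ξ η ζ f a
    have h2 := deriv_prolongationBracket ξ η a f.contMDiff
    refine h1.trans ?_
    change _ + ((ξ a).deriv (fun q => (η q).deriv f) - (η a).deriv (fun q => (ξ q).deriv f)
      - (prolongationBracket ξ η a).deriv f) • _ = _
    rw [h2, sub_self, zero_smul, add_zero]
    rfl

theorem jacobiator_lift (X₁ Y₁ X₂ Y₂ X₃ Y₃ : Cₛ^∞⟮I; F, E⟯) (a : TotalSpace F E) :
    A.jacobiator (A.lift X₁ Y₁) (A.lift X₂ Y₂) (A.lift X₃ Y₃) a = 0 := by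
  have hn : ∀ X Y, A.bracket X (-Y) = - A.bracket X Y := fun X Y => by
    rw [← neg_one_smul ℝ, A.bracket_smul_right, neg_one_smul]
  have hs : ∀ X Y Z, A.bracket X (Y - Z) = A.bracket X Y - A.bracket X Z := fun X Y Z => by
    rw [sub_eq_add_neg, A.bracket_add_right, hn, sub_eq_add_neg]
  have hj : ∀ X Y Z, A.bracket (A.bracket X Y) Z = A.bracket X (A.bracket Y Z)
      - A.bracket Y (A.bracket X Z) := fun X Y Z => by
    have h := A.jacobi X Y Z
    rw [A.bracket_skew Z X, hn, A.bracket_skew Z (A.bracket X Y)] at h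
    rw [← sub_eq_zero, ← neg_eq_zero, ← h]
    abel
  have h : prolongationBracket (A.lift X₁ Y₁) (prolongationBracket (A.lift X₂ Y₂) (A.lift X₃ Y₃))
      + prolongationBracket (A.lift X₂ Y₂) (prolongationBracket (A.lift X₃ Y₃) (A.lift X₁ Y₁))
      + prolongationBracket (A.lift X₃ Y₃) (prolongationBracket (A.lift X₁ Y₁) (A.lift X₂ Y₂))
      = 0 := by
    simp only [prolongationBracket_lift, lift_add]
    rw [← A.lift_zero, A.jacobi]
    congr 1
    simp only [hs, hj]
    abel
  exact congrArg (fun ζ => ζ a) h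

/-- The Lie algebroid structure of the prolongation. The Jacobi identity is verified on lifts, which
suffices since the Jacobiator is tensorial. -/
def prolongation : LieAlgebroid (I.prod 𝓘(ℝ, F)) (F × F) A.Prolongation where
  anchor a :=
    { toFun := Prolongation.pr₂
      map_add' := fun _ _ => rfl
      map_smul' := fun _ _ => rfl }
  bracket := prolongationBracket
  contMDiff_anchor := contMDiff_pr₂_totalSpace
  bracket_add_right := prolongationBracket_add_right
  bracket_smul_right c ξ η := by
    refine (congrArg (prolongationBracket ξ) ?_).trans
      ((prolongationBracket_funSmul ξ ⟨fun _ => c, contMDiff_const⟩ η).trans ?_)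
    · rfl
    · refine ContMDiffSection.ext fun a => ?_
      change c • prolongationBracket ξ η a + (ξ a).deriv (fun _ => c) • η a = _
      rw [Prolongation.deriv, directionalDeriv_const, zero_smul, add_zero]
      rfl
  bracket_skew := prolongationBracket_skew
  jacobi ξ η ζ := by
    refine ContMDiffSection.ext fun a => ?_
    obtain ⟨X₁, Y₁, h₁⟩ := A.exists_lift_eq (ξ a)
    obtain ⟨X₂, Y₂, h₂⟩ := A.exists_lift_eq (η a)
    obtain ⟨X₃, Y₃, h₃⟩ := A.exists_lift_eq (ζ a)
    change A.jacobiator ξ η ζ a = 0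
    rw [A.jacobiator_congr h₃.symm, A.jacobiator_cyclic, A.jacobiator_congr h₁.symm,
      A.jacobiator_cyclic, A.jacobiator_congr h₂.symm, A.jacobiator_cyclic]
    exact A.jacobiator_lift _ _ _ _ _ _ a
  leibniz ξ η fη f h a := by
    have h1 : fη = funSmul f η := ContMDiffSection.ext h
    rw [h1]
    exact congrArg (fun ζ => ζ a) (prolongationBracket_funSmul ξ f η)

end Lifts

/-! ### The characterization of the bracket of the prolongation -/

section Characterization

open Filter Topology

variable {B : Type*} [NormedAddCommGroup B] [NormedSpace ℝ B]
  {H : Type*} [TopologicalSpace H] {I : ModelWithCorners ℝ B H}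
  {M : Type*} [TopologicalSpace M] [ChartedSpace H M] [IsManifold I ∞ M]
  {F : Type*} [NormedAddCommGroup F] [NormedSpace ℝ F]
  {E : M → Type*} [TopologicalSpace (TotalSpace F E)]
  [∀ x, AddCommGroup (E x)] [∀ x, Module ℝ (E x)] [∀ x, TopologicalSpace (E x)]
  [FiberBundle F E] [VectorBundle ℝ F E] [ContMDiffVectorBundle ∞ F E I] [T2Space M]
  [FiniteDimensional ℝ B] [FiniteDimensional ℝ F]
  (A : LieAlgebroid I F E)

theorem anchorDeriv_linearCombination {ι : Type*} (t : Finset ι) {f : M → ℝ} (x : M)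
    (r : ι → ℝ) (b : ι → E x) :
    A.anchorDeriv f x (∑ i ∈ t, r i • b i) = ∑ i ∈ t, r i * A.anchorDeriv f x (b i) := by
  unfold anchorDeriv
  rw [map_sum, directionalDeriv_sum_vector]
  simp only [map_smul, directionalDeriv_smul_vector]

/-- The first two terms of `toLin_prolongationBracket`, for first components which are linear
combinations of sections of `E`. -/
theorem deriv_toLin_linearCombination {p q : ℕ} {ξ η : A.ProlongationSection}
    {h : Fin p → C^∞⟮I.prod 𝓘(ℝ, F), TotalSpace F E; ℝ⟯} {X : Fin p → Cₛ^∞⟮I; F, E⟯}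
    {s : Fin q → C^∞⟮I.prod 𝓘(ℝ, F), TotalSpace F E; ℝ⟯} {Y : Fin q → Cₛ^∞⟮I; F, E⟯}
    (hξ : ∀ a, (ξ a).pr₁ = ∑ i, h i a • X i a.proj)
    (hη : ∀ a, (η a).pr₁ = ∑ j, s j a • Y j a.proj) (α : BundleForm I F E 1)
    (a : TotalSpace F E) :
    (ξ a).deriv (fun q => α.toLin q.proj (η q).pr₁)
      = ∑ i, ∑ j, h i a * s j a * A.anchorDeriv (fun x => α.toLin x (Y j x)) a.proj (X i a.proj)
        + ∑ j, (ξ a).deriv (s j) * α.toLin a.proj (Y j a.proj) := by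
  simp only [hη, map_sum, map_smul, smul_eq_mul]
  rw [Prolongation.deriv_fun_sum_mul (f := fun j => s j) _ (ξ a) (fun j => (s j).contMDiff)
    (fun j => contMDiff_comp_proj (α.contMDiff_toLin (Y j))), Finset.sum_add_distrib,
    Finset.sum_comm]
  congr 1
  refine Finset.sum_congr rfl fun j _ => ?_
  rw [(ξ a).deriv_comp_proj (α.contMDiff_toLin (Y j)), hξ, anchorDeriv_linearCombination,
    Finset.mul_sum]
  exact Finset.sum_congr rfl fun i _ => by ring

theorem isProlongation_prolongation : A.IsProlongation A.prolongation where
  anchor_eq _ _ := rfl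
  bracket_eq ξ η p q h X s Y hξ hη a := by
    refine ⟨vector_ext (I := I) (F := F) fun α => ?_, pr₂_prolongationBracket ξ η a⟩
    refine (toLin_prolongationBracket ξ η a α).trans ?_
    rw [A.deriv_toLin_linearCombination hξ hη, A.deriv_toLin_linearCombination hη hξ,
      map_sub, map_add, hξ, hη]
    simp only [map_sum, map_smul, LinearMap.sum_apply, LinearMap.smul_apply, smul_eq_mul,
      dForm_apply, Prolongation.deriv]
    simp only [mul_sub, Finset.mul_sum, Finset.sum_sub_distrib, ← mul_assoc]
    simp only [mul_comm (s _ a) (h _ a),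
      Finset.sum_comm (s := (Finset.univ : Finset (Fin q))) (t := (Finset.univ : Finset (Fin p)))]
    ring

variable {A}

theorem bracket_funSmul_of_eventually_one
    {L : LieAlgebroid (I.prod 𝓘(ℝ, F)) (F × F) A.Prolongation}
    {f : C^∞⟮I.prod 𝓘(ℝ, F), TotalSpace F E; ℝ⟯} {a : TotalSpace F E} (hf : ∀ᶠ q in 𝓝 a, f q = 1)
    (ξ η : A.ProlongationSection) :
    L.bracket (funSmul f ξ) (funSmul f η) a = L.bracket ξ η a := by
  have h1 : f a = 1 := hf.self_of_nhds
  have h2 : ∀ z : A.Prolongation a, L.anchorDeriv f a z = 0 := fun z =>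
    directionalDeriv_eventually_const hf _
  rw [L.bracket_funSmul_right, L.bracket_funSmul_left, h1, h2, h2, one_smul, one_smul, zero_smul,
    zero_smul, sub_zero, add_zero]

/-- The first component of a section of the prolongation is locally a linear combination of sections
of `E`, so that the bracket of two sections of the prolongation is determined at each point by the
formula for linear combinations. -/
theorem IsProlongation.unique {L L' : LieAlgebroid (I.prod 𝓘(ℝ, F)) (F × F) A.Prolongation}
    (hL : A.IsProlongation L) (hL' : A.IsProlongation L') : L = L' := by
  refine LieAlgebroid.ext ?_ ?_
  · funext a
    exact LinearMap.ext fun z => (hL.anchor_eq a z).trans (hL'.anchor_eq a z).symm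
  · funext ξ η
    refine ContMDiffSection.ext fun a => ?_
    let fr := cutoffFrame I F E a.proj
    let χ : C^∞⟮I.prod 𝓘(ℝ, F), TotalSpace F E; ℝ⟯ := ⟨_, contMDiff_comp_proj fr.χ.contMDiff⟩
    have hχ : ∀ᶠ q in 𝓝 a, χ q = 1 := eventually_proj fr.eventually_χ
    let s (ζ : A.ProlongationSection) (i : Fin (Module.finrank ℝ F)) :
      C^∞⟮I.prod 𝓘(ℝ, F), TotalSpace F E; ℝ⟯ := ⟨_, contMDiff_toLin_pr₁ ζ (fr.ε i)⟩
    have key : ∀ (ζ : A.ProlongationSection) (q : TotalSpace F E), (funSmul χ ζ q).pr₁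
        = ∑ i, s ζ i q • fr.e i q.proj := fun ζ q => (fr.sum_smul q.proj (ζ q).pr₁).symm
    rw [← bracket_funSmul_of_eventually_one (L := L) hχ,
      ← bracket_funSmul_of_eventually_one (L := L') hχ]
    have h1 := hL.bracket_eq _ _ _ _ _ _ _ _ (key ξ) (key η) a
    have h2 := hL'.bracket_eq _ _ _ _ _ _ _ _ (key ξ) (key η) a
    exact Prolongation.ext (h1.1.trans h2.1.symm) (h1.2.trans h2.2.symm)

end Characterization

/-! ### The complete lift of a section of `⋀² E*` -/

section FormLift

open Filter Topology

variable {B : Type*} [NormedAddCommGroup B] [NormedSpace ℝ B]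
  {H : Type*} [TopologicalSpace H] {I : ModelWithCorners ℝ B H}
  {M : Type*} [TopologicalSpace M] [ChartedSpace H M] [IsManifold I ∞ M]
  {F : Type*} [NormedAddCommGroup F] [NormedSpace ℝ F]
  {E : M → Type*} [TopologicalSpace (TotalSpace F E)]
  [∀ x, AddCommGroup (E x)] [∀ x, Module ℝ (E x)] [∀ x, TopologicalSpace (E x)]
  [FiberBundle F E] [VectorBundle ℝ F E] [ContMDiffVectorBundle ∞ F E I] [T2Space M]
  [FiniteDimensional ℝ B] [FiniteDimensional ℝ F]
  (A : LieAlgebroid I F E)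

/-- The vertical lift `z ↦ α(z.pr₁)` of a section `α` of `E*`, on the fibre at `a`. -/
def verticalLiftLin (α : BundleForm I F E 1) (a : TotalSpace F E) : A.Prolongation a →ₗ[ℝ] ℝ where
  toFun z := α.toLin a.proj z.pr₁
  map_add' z w := map_add _ z.pr₁ w.pr₁
  map_smul' r z := map_smul _ r z.pr₁

theorem verticalLiftLin_lift (α : BundleForm I F E 1) (X Y : Cₛ^∞⟮I; F, E⟯) (a : TotalSpace F E) :
    A.verticalLiftLin α a (A.lift X Y a) = α.toLin a.proj (X a.proj) :=
  congrArg (α.toLin a.proj) (A.pr₁_lift X Y a)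

/-- The complete lift `(b, v) ↦ v(α̂) + dα(a, b)` of a section `α` of `E*`, on the fibre at `a`. -/
def completeLiftLin (α : BundleForm I F E 1) (a : TotalSpace F E) : A.Prolongation a →ₗ[ℝ] ℝ where
  toFun z := z.deriv (linearFunction α) + A.dForm α a.proj a.2 z.pr₁
  map_add' z w := by
    rw [Prolongation.deriv_add, Prolongation.pr₁_add, map_add]
    ring
  map_smul' r z := by
    rw [Prolongation.deriv_smul, Prolongation.pr₁_smul, map_smul, smul_eq_mul, RingHom.id_apply,
      smul_eq_mul]
    ring

theorem completeLiftLin_lift (α : BundleForm I F E 1) (X Y : Cₛ^∞⟮I; F, E⟯) (a : TotalSpace F E) :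
    A.completeLiftLin α a (A.lift X Y a)
      = A.anchorDeriv (fun x => α.toLin x (X x)) a.proj a.2 + α.toLin a.proj (Y a.proj) := by
  change (A.lift X Y a).deriv (linearFunction α) + A.dForm α a.proj a.2 (A.lift X Y a).pr₁ = _
  rw [deriv_lift, pr₁_lift, linearFunction_eq, toLin_lieForm, A.dForm_swap α a.proj a.2]
  ring

theorem contMDiff_completeLiftLin (α : BundleForm I F E 1) (ξ : A.ProlongationSection) :
    ContMDiff (I.prod 𝓘(ℝ, F)) 𝓘(ℝ, ℝ) ∞ fun a => A.completeLiftLin α a (ξ a) :=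
  (Prolongation.contMDiff_deriv ξ (contMDiff_linearFunction α)).add
    (contMDiff_bilin_along (fun α => contMDiff_linearFunction α) (contMDiff_toLin_pr₁ ξ)
      (A.contMDiff_dForm α))

/-- The contraction `Ω(·, X)`. -/
def _root_.BundleForm.contract (Ω : BundleForm I F E 2) (X : Cₛ^∞⟮I; F, E⟯) : BundleForm I F E 1 :=
  BundleForm.ofLin (fun x => (Ω.toBilin x).flip (X x)) fun Y => Ω.contMDiff_toBilin Y X

@[simp]
theorem _root_.BundleForm.toLin_contract (Ω : BundleForm I F E 2) (X : Cₛ^∞⟮I; F, E⟯) (x : M)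
    (b : E x) : (Ω.contract X).toLin x b = Ω.toBilin x b (X x) := rfl

/-- The complete lift of `Ω = ∑ⱼ Ω(·, eⱼ) ⊗ εʲ` near a point, from the Leibniz rule
`(β ⊗ ε)ᶜ = βᶜ ⊗ εᵛ + βᵛ ⊗ εᶜ`. -/
def completeLiftBilin (Ω : BundleForm I F E 2) {x₀ : M}
    (fr : CutoffFrame (I := I) (F := F) (E := E) x₀) (a : TotalSpace F E) :
    A.Prolongation a →ₗ[ℝ] A.Prolongation a →ₗ[ℝ] ℝ :=
  ∑ j, ((A.completeLiftLin (Ω.contract (fr.e j)) a).smulRight (A.verticalLiftLin (fr.ε j) a)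
    + (A.verticalLiftLin (Ω.contract (fr.e j)) a).smulRight (A.completeLiftLin (fr.ε j) a))

theorem completeLiftBilin_apply (Ω : BundleForm I F E 2) {x₀ : M}
    (fr : CutoffFrame (I := I) (F := F) (E := E) x₀) (a : TotalSpace F E) (z w : A.Prolongation a) :
    A.completeLiftBilin Ω fr a z w
      = ∑ j, (A.completeLiftLin (Ω.contract (fr.e j)) a z * A.verticalLiftLin (fr.ε j) a w
        + A.verticalLiftLin (Ω.contract (fr.e j)) a z * A.completeLiftLin (fr.ε j) a w) := by
  simp [completeLiftBilin]

/-- The values of `completeLiftBilin` on lifts. They do not involve the frame, and the lifts span the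
fibres, so that `completeLiftBilin` does not depend on the frame where `χ = 1`. -/
theorem completeLiftBilin_lift (Ω : BundleForm I F E 2) {x₀ : M}
    (fr : CutoffFrame (I := I) (F := F) (E := E) x₀) {a : TotalSpace F E}
    (ha : ∀ᶠ x in 𝓝 a.proj, fr.χ x = 1) (X Y X' Y' : Cₛ^∞⟮I; F, E⟯) :
    A.completeLiftBilin Ω fr a (A.lift X Y a) (A.lift X' Y' a)
      = A.anchorDeriv (fun x => Ω.toBilin x (X x) (X' x)) a.proj a.2
        + Ω.toBilin a.proj (Y a.proj) (X' a.proj) + Ω.toBilin a.proj (X a.proj) (Y' a.proj) := by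
  have key : ∀ {x : M}, fr.χ x = 1 → ∀ b c : E x,
      ∑ j, Ω.toBilin x b (fr.e j x) * (fr.ε j).toLin x c = Ω.toBilin x b c := by
    intro x hx b c
    have h := congrArg (Ω.toBilin x b) (fr.sum_smul x c)
    rw [hx, one_smul, map_sum] at h
    rw [← h]
    exact Finset.sum_congr rfl fun j _ => by rw [map_smul, smul_eq_mul, mul_comm]
  have h1 : A.anchorDeriv (fun x => Ω.toBilin x (X x) (X' x)) a.proj a.2
      = A.anchorDeriv (fun x => ∑ j, Ω.toBilin x (X x) (fr.e j x) * (fr.ε j).toLin x (X' x))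
        a.proj a.2 :=
    directionalDeriv_congr (ha.mono fun x hx => (key hx _ _).symm) _
  rw [h1, A.anchorDeriv_sum_mul _ (fun j => Ω.contMDiff_toBilin X (fr.e j))
    (fun j => (fr.ε j).contMDiff_toLin X'), ← key ha.self_of_nhds (Y a.proj),
    ← key ha.self_of_nhds (X a.proj) (Y' a.proj), completeLiftBilin_apply,
    ← Finset.sum_add_distrib, ← Finset.sum_add_distrib]
  refine Finset.sum_congr rfl fun j _ => ?_
  simp only [completeLiftLin_lift, verticalLiftLin_lift, BundleForm.toLin_contract]
  ring

/-- The complete lift of a section of `⋀² E*` to the prolongation. At `a` it is given by a frame near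
`τ(a)`; it is smooth since nearby points may use the same frame. -/
def completeLiftForm (Ω : BundleForm I F E 2) :
    BundleForm (I.prod 𝓘(ℝ, F)) (F × F) A.Prolongation 2 :=
  BundleForm.ofBilin (fun a => A.completeLiftBilin Ω (cutoffFrame I F E a.proj) a)
    (fun a z => by
      obtain ⟨X, Y, rfl⟩ := A.exists_lift_eq z
      rw [A.completeLiftBilin_lift Ω _ (cutoffFrame I F E a.proj).eventually_χ,
        Ω.toBilin_swap a.proj (Y a.proj)]
      simp only [Ω.toBilin_self, anchorDeriv_const]
      ring)
    fun ξ η a => by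
      let fr := cutoffFrame I F E a.proj
      have h : (fun q => A.completeLiftBilin Ω (cutoffFrame I F E q.proj) q (ξ q) (η q))
          =ᶠ[𝓝 a] fun q => A.completeLiftBilin Ω fr q (ξ q) (η q) := by
        filter_upwards [eventually_proj (eventually_eventually_nhds.2 fr.eventually_χ)] with q hq
        obtain ⟨X, Y, hξ⟩ := A.exists_lift_eq (ξ q)
        obtain ⟨X', Y', hη⟩ := A.exists_lift_eq (η q)
        rw [← hξ, ← hη, A.completeLiftBilin_lift Ω _ hq,
          A.completeLiftBilin_lift Ω _ (cutoffFrame I F E q.proj).eventually_χ]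
      refine ContMDiffAt.congr_of_eventuallyEq ?_ h
      simp only [completeLiftBilin_apply]
      exact contMDiffAt_finsetSum fun j _ =>
        (((A.contMDiff_completeLiftLin _ ξ).mul (contMDiff_toLin_pr₁ η (fr.ε j))).add
          ((contMDiff_toLin_pr₁ ξ (Ω.contract (fr.e j))).mul
            (A.contMDiff_completeLiftLin _ η))).contMDiffAt

theorem toBilin_completeLiftForm_lift (Ω : BundleForm I F E 2) (X Y X' Y' : Cₛ^∞⟮I; F, E⟯)
    (a : TotalSpace F E) :
    (A.completeLiftForm Ω).toBilin a (A.lift X Y a) (A.lift X' Y' a)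
      = A.anchorDeriv (fun x => Ω.toBilin x (X x) (X' x)) a.proj a.2
        + Ω.toBilin a.proj (Y a.proj) (X' a.proj) + Ω.toBilin a.proj (X a.proj) (Y' a.proj) :=
  A.completeLiftBilin_lift Ω _ (cutoffFrame I F E a.proj).eventually_χ X Y X' Y'

variable {A} in
/-- The defining conditions of a complete lift, with `Xᶜ = lift X 0` and `Xᵛ = lift 0 X`. -/
theorem isCompleteLiftForm_iff {k : ℕ} {α : (Fin k → Cₛ^∞⟮I; F, E⟯) → M → ℝ}
    {β : (Fin k → A.ProlongationSection) → TotalSpace F E → ℝ} :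
    A.IsCompleteLiftForm α β ↔ ∀ (X : Fin k → Cₛ^∞⟮I; F, E⟯) (a : TotalSpace F E),
      β (fun i => A.lift (X i) 0) a = A.anchorDeriv (α X) a.proj a.2 ∧
      (1 ≤ k → β (fun i => A.lift (if (i : ℕ) < 1 then 0 else X i)
        (if (i : ℕ) < 1 then X i else 0)) a = α X a.proj) ∧
      ∀ s : ℕ, 2 ≤ s → s ≤ k → β (fun i => A.lift (if (i : ℕ) < s then 0 else X i)
        (if (i : ℕ) < s then X i else 0)) a = 0 := by
  have h : ∀ (X : Fin k → Cₛ^∞⟮I; F, E⟯) (s : ℕ),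
      (fun i : Fin k => if (i : ℕ) < s then A.verticalLift (X i) else A.completeLift (X i))
        = fun i : Fin k => A.lift (if (i : ℕ) < s then 0 else X i)
          (if (i : ℕ) < s then X i else 0) := by
    intro X s
    funext i
    split_ifs
    · exact A.verticalLift_eq_lift (X i)
    · exact A.completeLift_eq_lift (X i)
  have h0 : ∀ X : Fin k → Cₛ^∞⟮I; F, E⟯, (fun i => A.completeLift (X i))
      = fun i => A.lift (X i) 0 := fun X => funext fun i => A.completeLift_eq_lift (X i)
  simp only [IsCompleteLiftForm, isVerticalLift_iff, isCompleteLift_iff]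
  constructor
  · intro H X a
    have := H X _ _ (fun _ => rfl) (fun _ => rfl) a
    simpa only [h, h0] using this
  · intro H X Xv Xc hv hc a
    obtain rfl := funext hv
    obtain rfl := funext hc
    simpa only [h, h0] using H X a

theorem isCompleteLiftForm_completeLiftForm (Ω : BundleForm I F E 2) :
    A.IsCompleteLiftForm Ω.eval (A.completeLiftForm Ω).eval := by
  rw [isCompleteLiftForm_iff]
  intro X a
  have hX : Ω.eval X = fun x => Ω.toBilin x (X 0 x) (X 1 x) := funext (Ω.eval_two X)
  refine ⟨?_, fun _ => ?_, fun s hs hs' => ?_⟩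
  · rw [BundleForm.eval_two, toBilin_completeLiftForm_lift, hX]
    simp
  · rw [BundleForm.eval_two, toBilin_completeLiftForm_lift, hX]
    simp [anchorDeriv_const]
  · obtain rfl : s = 2 := le_antisymm hs' hs
    rw [BundleForm.eval_two, toBilin_completeLiftForm_lift]
    simp [anchorDeriv_const]

variable {A} in
/-- The defining conditions of the complete lift of `Ω` determine it on all lifts `Xᶜ + Yᵛ`. -/
theorem IsCompleteLiftForm.toBilin_lift {Ω : BundleForm I F E 2}
    {Ω' : BundleForm (I.prod 𝓘(ℝ, F)) (F × F) A.Prolongation 2}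
    (h : A.IsCompleteLiftForm Ω.eval Ω'.eval) (X Y X' Y' : Cₛ^∞⟮I; F, E⟯) (a : TotalSpace F E) :
    Ω'.toBilin a (A.lift X Y a) (A.lift X' Y' a)
      = A.anchorDeriv (fun x => Ω.toBilin x (X x) (X' x)) a.proj a.2
        + Ω.toBilin a.proj (Y a.proj) (X' a.proj) + Ω.toBilin a.proj (X a.proj) (Y' a.proj) := by
  rw [isCompleteLiftForm_iff] at h
  have hc : ∀ X X' : Cₛ^∞⟮I; F, E⟯, Ω'.toBilin a (A.lift X 0 a) (A.lift X' 0 a)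
      = A.anchorDeriv (fun x => Ω.toBilin x (X x) (X' x)) a.proj a.2 := fun X X' => by
    have h1 := (h ![X, X'] a).1
    rwa [BundleForm.eval_two, show Ω.eval ![X, X'] = _ from funext (Ω.eval_two _)] at h1
  have hv : ∀ X X' : Cₛ^∞⟮I; F, E⟯, Ω'.toBilin a (A.lift 0 X a) (A.lift X' 0 a)
      = Ω.toBilin a.proj (X a.proj) (X' a.proj) := fun X X' => by
    have h1 := (h ![X, X'] a).2.1 one_le_two
    rwa [BundleForm.eval_two, Ω.eval_two] at h1
  have hz : ∀ X X' : Cₛ^∞⟮I; F, E⟯, Ω'.toBilin a (A.lift 0 X a) (A.lift 0 X' a) = 0 :=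
      fun X X' => by
    have h1 := (h ![X, X'] a).2.2 2 le_rfl le_rfl
    rwa [BundleForm.eval_two] at h1
  have hl : ∀ X Y : Cₛ^∞⟮I; F, E⟯, A.lift X Y a = A.lift X 0 a + A.lift 0 Y a := fun X Y => by
    rw [← A.completeLift_eq_lift, ← A.verticalLift_eq_lift]
    rfl
  rw [hl X Y, hl X' Y']
  simp only [map_add, LinearMap.add_apply]
  rw [Ω'.toBilin_swap a (A.lift X 0 a) (A.lift 0 Y' a), hc, hv, hv, hz,
    Ω.toBilin_swap a.proj (X a.proj) (Y' a.proj)]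
  ring

theorem eq_completeLiftForm {Ω : BundleForm I F E 2}
    {Ω' : BundleForm (I.prod 𝓘(ℝ, F)) (F × F) A.Prolongation 2}
    (h : A.IsCompleteLiftForm Ω.eval Ω'.eval) : Ω' = A.completeLiftForm Ω := by
  refine BundleForm.ext_toBilin fun a z w => ?_
  obtain ⟨X, Y, rfl⟩ := A.exists_lift_eq z
  obtain ⟨X', Y', rfl⟩ := A.exists_lift_eq w
  rw [h.toBilin_lift, toBilin_completeLiftForm_lift]

/-! ### The differential of the complete lift -/

/-- The lift `Xᶜ + Yᵛ` acts on `fᶜ` by `(ρ(X)f)ᶜ + (ρ(Y)f)ᵛ`: indeed `fᶜ` is the linear function of `df`,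
and `𝓛_X df = d(ρ(X)f)`. -/
theorem deriv_lift_anchorDeriv {f : M → ℝ} (hf : ContMDiff I 𝓘(ℝ, ℝ) ∞ f) (X Y : Cₛ^∞⟮I; F, E⟯)
    (a : TotalSpace F E) :
    (A.lift X Y a).deriv (fun q => A.anchorDeriv f q.proj q.2)
      = A.anchorDeriv (fun x => A.anchorDeriv f x (X x)) a.proj a.2
        + A.anchorDeriv f a.proj (Y a.proj) := by
  let φ : C^∞⟮I, M; ℝ⟯ := ⟨f, hf⟩
  refine (A.deriv_lift X Y a (A.dFun φ)).trans ?_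
  rw [linearFunction_eq, toLin_lieForm, dForm_dFun, zero_add]
  rfl

theorem deriv_toBilin_completeLiftForm (Ω : BundleForm I F E 2) (X Y X' Y' Z W : Cₛ^∞⟮I; F, E⟯)
    (a : TotalSpace F E) :
    (A.lift Z W a).deriv
        (fun q => (A.completeLiftForm Ω).toBilin q (A.lift X Y q) (A.lift X' Y' q))
      = A.anchorDeriv (fun x => A.anchorDeriv (fun y => Ω.toBilin y (X y) (X' y)) x (Z x))
          a.proj a.2
        + A.anchorDeriv (fun x => Ω.toBilin x (X x) (X' x)) a.proj (W a.proj)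
        + A.anchorDeriv (fun x => Ω.toBilin x (Y x) (X' x)) a.proj (Z a.proj)
        + A.anchorDeriv (fun x => Ω.toBilin x (X x) (Y' x)) a.proj (Z a.proj) := by
  simp only [toBilin_completeLiftForm_lift]
  have h1 := A.contMDiff_anchorDeriv_totalSpace (Ω.contMDiff_toBilin X X')
  have h2 := contMDiff_comp_proj (F := F) (E := E) (Ω.contMDiff_toBilin Y X')
  have h3 := contMDiff_comp_proj (F := F) (E := E) (Ω.contMDiff_toBilin X Y')
  have h12 : ContMDiff (I.prod 𝓘(ℝ, F)) 𝓘(ℝ, ℝ) ∞ fun q : TotalSpace F E =>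
      A.anchorDeriv (fun x => Ω.toBilin x (X x) (X' x)) q.proj q.2
        + Ω.toBilin q.proj (Y q.proj) (X' q.proj) := h1.add h2
  rw [Prolongation.deriv_fun_add _ h12 h3, Prolongation.deriv_fun_add _ h1 h2,
    A.deriv_lift_anchorDeriv (Ω.contMDiff_toBilin X X'),
    A.deriv_lift_comp_proj Z W a (Ω.contMDiff_toBilin Y X'),
    A.deriv_lift_comp_proj Z W a (Ω.contMDiff_toBilin X Y')]

theorem differential_two_eq (Ω : BundleForm I F E 2) (X : Fin 3 → Cₛ^∞⟮I; F, E⟯) :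
    A.differential Ω X = A.differential Ω ![X 0, X 1, X 2] :=
  congrArg (A.differential Ω) (funext fun i => by fin_cases i <;> rfl)

theorem differential_two_zero (Ω : BundleForm I F E 2) (X Y : Cₛ^∞⟮I; F, E⟯) (x : M) :
    A.differential Ω ![X, Y, 0] x = 0 ∧ A.differential Ω ![X, 0, Y] x = 0
      ∧ A.differential Ω ![0, X, Y] x = 0 := by
  have h : ∀ X Y, A.differential Ω ![X, Y, 0] x = 0 := fun X Y => by
    have h1 := A.differential_two_add Ω X Y 0 0 x
    rwa [add_zero, left_eq_add] at h1
  exact ⟨h X Y, by rw [differential_two_swap₁₂, h, neg_zero],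
    by rw [differential_two_swap₀₁, differential_two_swap₁₂, h, neg_zero, neg_zero]⟩

theorem anchorDeriv_differential_two (Ω : BundleForm I F E 2) (X : Fin 3 → Cₛ^∞⟮I; F, E⟯) (x : M)
    (b : E x) : A.anchorDeriv (A.differential Ω X) x b
      = A.anchorDeriv (fun x => A.anchorDeriv (fun y => Ω.toBilin y (X 1 y) (X 2 y)) x (X 0 x)) x b
      - A.anchorDeriv (fun x => A.anchorDeriv (fun y => Ω.toBilin y (X 0 y) (X 2 y)) x (X 1 x)) x b
      + A.anchorDeriv (fun x => A.anchorDeriv (fun y => Ω.toBilin y (X 0 y) (X 1 y)) x (X 2 x)) x b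
      - A.anchorDeriv (fun x => Ω.toBilin x (A.bracket (X 0) (X 1) x) (X 2 x)) x b
      + A.anchorDeriv (fun x => Ω.toBilin x (A.bracket (X 0) (X 2) x) (X 1 x)) x b
      - A.anchorDeriv (fun x => Ω.toBilin x (A.bracket (X 1) (X 2) x) (X 0 x)) x b := by
  have hd : ∀ i j k, ContMDiff I 𝓘(ℝ, ℝ) ∞
      fun x => A.anchorDeriv (fun y => Ω.toBilin y (X i y) (X j y)) x (X k x) := fun i j k =>
    A.contMDiff_anchorDeriv (Ω.contMDiff_toBilin (X i) (X j)) (X k)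
  have hb : ∀ i j k, ContMDiff I 𝓘(ℝ, ℝ) ∞
      fun x => Ω.toBilin x (A.bracket (X i) (X j) x) (X k x) := fun i j k =>
    Ω.contMDiff_toBilin (A.bracket (X i) (X j)) (X k)
  have key : ∀ {f₁ f₂ f₃ f₄ f₅ f₆ : M → ℝ}, ContMDiff I 𝓘(ℝ, ℝ) ∞ f₁ → ContMDiff I 𝓘(ℝ, ℝ) ∞ f₂ →
      ContMDiff I 𝓘(ℝ, ℝ) ∞ f₃ → ContMDiff I 𝓘(ℝ, ℝ) ∞ f₄ → ContMDiff I 𝓘(ℝ, ℝ) ∞ f₅ →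
      ContMDiff I 𝓘(ℝ, ℝ) ∞ f₆ →
      A.anchorDeriv (fun y => f₁ y - f₂ y + f₃ y - f₄ y + f₅ y - f₆ y) x b
        = A.anchorDeriv f₁ x b - A.anchorDeriv f₂ x b + A.anchorDeriv f₃ x b
          - A.anchorDeriv f₄ x b + A.anchorDeriv f₅ x b - A.anchorDeriv f₆ x b := by
    intro f₁ f₂ f₃ f₄ f₅ f₆ h₁ h₂ h₃ h₄ h₅ h₆
    have k₂ : ContMDiff I 𝓘(ℝ, ℝ) ∞ fun y => f₁ y - f₂ y := h₁.sub h₂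
    have k₃ : ContMDiff I 𝓘(ℝ, ℝ) ∞ fun y => f₁ y - f₂ y + f₃ y := k₂.add h₃
    have k₄ : ContMDiff I 𝓘(ℝ, ℝ) ∞ fun y => f₁ y - f₂ y + f₃ y - f₄ y := k₃.sub h₄
    have k₅ : ContMDiff I 𝓘(ℝ, ℝ) ∞ fun y => f₁ y - f₂ y + f₃ y - f₄ y + f₅ y := k₄.add h₅
    rw [A.anchorDeriv_sub k₅ h₆, A.anchorDeriv_add k₄ h₅, A.anchorDeriv_sub k₃ h₄,
      A.anchorDeriv_add k₂ h₃, A.anchorDeriv_sub h₁ h₂]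
  rw [show A.differential Ω X = _ from funext (A.differential_two Ω X)]
  exact key (hd 1 2 0) (hd 0 2 1) (hd 0 1 2) (hb 0 1 2) (hb 0 2 1) (hb 1 2 0)

/-- The values of `d Ωᶜ` on lifts `Xᵢᶜ + Yᵢᵛ`, which are those of the complete lift of `dΩ`. -/
theorem differential_completeLiftForm_lift (Ω : BundleForm I F E 2) (X Y : Fin 3 → Cₛ^∞⟮I; F, E⟯)
    (a : TotalSpace F E) :
    A.prolongation.differential (A.completeLiftForm Ω) (fun i => A.lift (X i) (Y i)) a
      = A.anchorDeriv (A.differential Ω X) a.proj a.2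
        + A.differential Ω ![Y 0, X 1, X 2] a.proj + A.differential Ω ![X 0, Y 1, X 2] a.proj
        + A.differential Ω ![X 0, X 1, Y 2] a.proj := by
  have hs : ∀ (f : TotalSpace F E → ℝ) (z : A.Prolongation a),
    A.prolongation.anchorDeriv f a z = z.deriv f := fun _ _ => rfl
  have hb : ∀ ξ η, A.prolongation.bracket ξ η = prolongationBracket ξ η := fun _ _ => rfl
  rw [differential_two, A.anchorDeriv_differential_two]
  simp only [hs, deriv_toBilin_completeLiftForm]
  simp only [hb, prolongationBracket_lift, toBilin_completeLiftForm_lift]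
  simp only [differential_two, Matrix.cons_val, ContMDiffSection.coe_sub, Pi.sub_apply, map_sub,
    LinearMap.sub_apply, A.bracket_skew_apply (Y _) (X _), map_neg, LinearMap.neg_apply]
  ring

theorem isCompleteLiftForm_differential (Ω : BundleForm I F E 2) :
    A.IsCompleteLiftForm (A.differential Ω)
      (A.prolongation.differential (A.completeLiftForm Ω)) := by
  have h1 := fun X Y x => (A.differential_two_zero Ω X Y x).1
  have h2 := fun X Y x => (A.differential_two_zero Ω X Y x).2.1
  have h3 := fun X Y x => (A.differential_two_zero Ω X Y x).2.2
  have h0 : ∀ X Y, A.differential Ω ![0, X, Y] = fun _ => 0 := fun X Y => funext (h3 X Y)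
  rw [isCompleteLiftForm_iff]
  intro X a
  refine ⟨?_, fun _ => ?_, fun s hs hs' => ?_⟩
  · simp only [differential_completeLiftForm_lift, h1, h2, h3, add_zero]
  · rw [differential_completeLiftForm_lift, differential_two_eq, A.differential_two_eq Ω X]
    simp [h1, h2, h0, anchorDeriv_const]
  · obtain rfl | rfl : s = 2 ∨ s = 3 := by omega
    · rw [differential_completeLiftForm_lift, differential_two_eq]
      simp [h1, h2, h0, anchorDeriv_const]
    · rw [differential_completeLiftForm_lift, differential_two_eq]
      simp [h1, h2, h0, anchorDeriv_const]

/-! ### Symplectic sections -/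

theorem completeLiftForm_nondegenerate {Ω : BundleForm I F E 2}
    (hΩ : ∀ (x : M) (u : E x), (∀ v : E x, Ω.toFun x ![u, v] = 0) → u = 0) (a : TotalSpace F E)
    (z : A.Prolongation a) (hz : ∀ w, (A.completeLiftForm Ω).toBilin a z w = 0) : z = 0 := by
  -- the pairing with vertical lifts is `Ω` on first components, so the first component vanishes
  have h1 : z.pr₁ = 0 := by
    obtain ⟨X, Y, rfl⟩ := A.exists_lift_eq z
    refine hΩ a.proj _ fun v => ?_
    have h := hz (A.lift 0 (sectionThrough I F E a.proj v) a)
    rw [toBilin_completeLiftForm_lift] at h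
    rw [← Ω.toBilin_apply]
    simpa [anchorDeriv_const] using h
  obtain ⟨Y, hY⟩ := A.exists_lift_sectionThrough_eq z
  rw [h1, map_zero] at hY
  subst hY
  -- now `z` is vertical, and its pairing with complete lifts is again given by `Ω`
  have h2 : Y a.proj = 0 := by
    refine hΩ a.proj _ fun v => ?_
    have h := hz (A.lift (sectionThrough I F E a.proj v) 0 a)
    rw [toBilin_completeLiftForm_lift] at h
    rw [← Ω.toBilin_apply]
    simpa [anchorDeriv_const] using h
  rw [← verticalLift_eq_lift]
  refine Prolongation.ext_forms (A := A) (fun α => ?_) fun α => ?_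
  · rw [pr₁_verticalLift, Prolongation.pr₁_zero]
  · rw [deriv_verticalLift, h2, map_zero, Prolongation.deriv_zero]

theorem IsSymplecticSection.completeLiftForm {Ω : BundleForm I F E 2}
    (hΩ : A.IsSymplecticSection Ω) :
    A.prolongation.IsSymplecticSection (A.completeLiftForm Ω) := by
  have : T2Space (TotalSpace F E) := t2Space_totalSpace
  refine ⟨fun a z hz => A.completeLiftForm_nondegenerate hΩ.1 a z hz, fun ξ a => ?_⟩
  choose X Y h using fun i => A.exists_lift_eq (ξ i a)
  rw [differential_two_eq, differential_two_congr _ _ (h 0).symm (h 1).symm (h 2).symm]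
  have h0 : A.differential Ω X = fun _ => 0 := funext (hΩ.2 X)
  have h1 := A.differential_completeLiftForm_lift Ω X Y a
  rw [differential_two_eq] at h1
  rw [h1, hΩ.2, hΩ.2, hΩ.2, h0, anchorDeriv_const]
  ring

end FormLift

end LieAlgebroid

end

theorem theorem6p4
    {B : Type*} [NormedAddCommGroup B] [NormedSpace ℝ B] [FiniteDimensional ℝ B]
    {H : Type*} [TopologicalSpace H] {I : ModelWithCorners ℝ B H} [I.Boundaryless]
    {M : Type*} [TopologicalSpace M] [T2Space M] [ParacompactSpace M]
    [ChartedSpace H M] [IsManifold I ∞ M]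
    {F : Type*} [NormedAddCommGroup F] [NormedSpace ℝ F] [FiniteDimensional ℝ F]
    {E : M → Type*} [TopologicalSpace (TotalSpace F E)]
    [∀ x, AddCommGroup (E x)] [∀ x, Module ℝ (E x)] [∀ x, TopologicalSpace (E x)]
    [FiberBundle F E] [VectorBundle ℝ F E] [ContMDiffVectorBundle ∞ F E I]
    (A : LieAlgebroid I F E) :
    -- sections of `E` have unique vertical and complete lifts to the prolongation
    (∀ X : Cₛ^∞⟮I; F, E⟯, (∃! ξ : A.ProlongationSection, A.IsVerticalLift X ξ) ∧
      ∃! ξ : A.ProlongationSection, A.IsCompleteLift X ξ) ∧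
    -- the prolongation has a unique Lie algebroid structure `L` given by the defining formulas
    ∃ L : LieAlgebroid (I.prod 𝓘(ℝ, F)) (F × F) A.Prolongation,
      (A.IsProlongation L ∧ ∀ L', A.IsProlongation L' → L' = L) ∧
      ∀ Ω : BundleForm I F E 2,
        -- `Ω` has a unique complete lift `Ωc`, and `d Ωc` is the complete lift of `d Ω`
        ∃ Ωc : BundleForm (I.prod 𝓘(ℝ, F)) (F × F) A.Prolongation 2,
          (A.IsCompleteLiftForm Ω.eval Ωc.eval ∧
            ∀ Ω', A.IsCompleteLiftForm Ω.eval (BundleForm.eval Ω') → Ω' = Ωc) ∧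
          A.IsCompleteLiftForm (A.differential Ω) (L.differential Ωc) ∧
          (A.IsSymplecticSection Ω → L.IsSymplecticSection Ωc) := by
  have lifts : ∀ X : Cₛ^∞⟮I; F, E⟯, (∃! ξ : A.ProlongationSection, A.IsVerticalLift X ξ) ∧
      ∃! ξ : A.ProlongationSection, A.IsCompleteLift X ξ := fun X =>
    ⟨⟨A.verticalLift X, A.isVerticalLift_iff.2 rfl, fun _ h => A.isVerticalLift_iff.1 h⟩,
      ⟨A.completeLift X, A.isCompleteLift_iff.2 rfl, fun _ h => A.isCompleteLift_iff.1 h⟩⟩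
  exact ⟨lifts, A.prolongation,
    ⟨A.isProlongation_prolongation, fun _ h => h.unique A.isProlongation_prolongation⟩,
    fun Ω => ⟨A.completeLiftForm Ω,
      ⟨A.isCompleteLiftForm_completeLiftForm Ω, fun _ h => A.eq_completeLiftForm h⟩,
      A.isCompleteLiftForm_differential Ω, fun h => h.completeLiftForm⟩⟩
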